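/- Let $(R,\mathfrak m,k)$ be a commutative noetherian local ring of Krull dimension $d$. A complex $M$ of $R$-modules (cohomologically graded) is called *maximal Cohen–Macaulay* (MCM) if $H^*(M)=\bigoplus_i H^i(M)$ is a finitely generated $R$-module (in particular bounded), the canonical map $H^0(M)\to H^0(k\otimes^{\mathbf L}_R M)$ is nonzero, and $H^i_{\mathfrak m}(M)=H^i(\mathbf R\Gamma_{\mathfrak m}M)=0$ for all $i\neq d$. Let $D$ be a normalized dualizing complex for $R$: a complex with $H^*(D)$ finitely generated and $H^0(D)\neq 0$ that is quasi-isomorphic to a complex of injective $R$-modules concentrated in degrees $0,\dots,d$, and such that the homothety map $R\to\operatorname{RHom}_R(D,D)$ is an isomorphism in the derived category $\mathbf D(R)$. For an $R$-module $N$ let $$\zeta^i_N\colon \operatorname{Ext}^i_R(k,N)\xrightarrow{\ \cong\ }\operatorname{Ext}^i_R(k,\mathbf R\Gamma_{\mathfrak m}N)\longrightarrow \operatorname{Ext}^i_R(R,\mathbf R\Gamma_{\mathfrak m}N)\cong H^i_{\mathfrak m}(N)$$ be the composite in which the middle map is induced by the surjection $R\to k$. 1. Let $M$ be a complex of $R$-modules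 with $H^*(M)$ finitely generated, and set $N=H^0(\operatorname{RHom}_R(M,D))$. Then $M$ is MCM if and only if $\operatorname{RHom}_R(M,D)\simeq N$ in $\mathbf D(R)$ (with $N$ regarded as a complex concentrated in degree $0$) and $\zeta^d_N\neq 0$. 2. For every finitely generated $R$-module $N$ with $\zeta^d_N\neq 0$, the complex $\operatorname{RHom}_R(N,D)$ is MCM. -/

import Mathlib

open CategoryTheory CategoryTheory.Limits MonoidalCategory Opposite

universe u

noncomputable section

namespace MCM

section Torsion

variable {R : Type u} [CommRing R] (I : Ideal R)

/-- The `I`-power torsion submodule `Γ_I M = {m ∈ M | I ^ n m = 0 for some n}`. -/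
def torsion (M : Type u) [AddCommGroup M] [Module R M] : Submodule R M where
  carrier := {m | ∃ n : ℕ, ∀ r ∈ I ^ n, r • m = 0}
  zero_mem' := ⟨0, fun r _ => smul_zero r⟩
  add_mem' := by
    rintro a b ⟨n, hn⟩ ⟨k, hk⟩
    refine ⟨n + k, fun r hr => ?_⟩
    rw [smul_add, hn r (Ideal.pow_le_pow_right (Nat.le_add_right n k) hr),
      hk r (Ideal.pow_le_pow_right (Nat.le_add_left k n) hr), add_zero]
  smul_mem' := by
    rintro c a ⟨n, hn⟩
    exact ⟨n, fun r hr => by rw [smul_comm, hn r hr, smul_zero]⟩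

/-- The functor `Γ_I` on `R`-modules. -/
def torsionFunctor : ModuleCat.{u} R ⥤ ModuleCat.{u} R where
  obj M := ModuleCat.of R (torsion I M)
  map {M N} f := ModuleCat.ofHom <| f.hom.restrict (p := torsion I M) (q := torsion I N) <| by
    rintro m ⟨n, hn⟩
    exact ⟨n, fun r hr => by rw [← map_smul, hn r hr, map_zero]⟩

instance : (torsionFunctor I).Additive where

end Torsion

section Resolutions

variable {R : Type u} [CommRing R]

/-- A quasi-isomorphism from a complex `X` to a K-injective complex. -/
structure SemiInjectiveResolution (X : CochainComplex (ModuleCat.{u} R) ℤ) where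
  complex : CochainComplex (ModuleCat.{u} R) ℤ
  ι : X ⟶ complex
  kInjective : complex.IsKInjective
  quasiIso : QuasiIso ι

/-- A quasi-isomorphism from a K-projective complex to a complex `X`. -/
structure SemiProjectiveResolution (X : CochainComplex (ModuleCat.{u} R) ℤ) where
  complex : CochainComplex (ModuleCat.{u} R) ℤ
  π : complex ⟶ X
  kProjective : complex.IsKProjective
  quasiIso : QuasiIso π

/-- The local cohomology `H^i_I(X) = H^i(Γ_I J)` of a complex `X`, computed by a
semi-injective resolution `X ⟶ J`. -/
def SemiInjectiveResolution.localCohomology {X : CochainComplex (ModuleCat.{u} R) ℤ}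
    (J : SemiInjectiveResolution X) (I : Ideal R) (i : ℤ) : ModuleCat.{u} R :=
  (((torsionFunctor I).mapHomologicalComplex (ComplexShape.up ℤ)).obj J.complex).homology i

/-- The complex of `R`-modules `Hom_R(X, Y)`. -/
def homComplex (X Y : CochainComplex (ModuleCat.{u} R) ℤ) :
    CochainComplex (ModuleCat.{u} R) ℤ where
  X n := ModuleCat.of R (CochainComplex.HomComplex.Cochain X Y n)
  d i j := ModuleCat.ofHom (CochainComplex.HomComplex.δ_hom R X Y i j)
  shape i j hij := by
    ext x : 2
    exact CochainComplex.HomComplex.δ_shape _ _ hij x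
  d_comp_d' i j k _ _ := by
    ext x : 2
    exact CochainComplex.HomComplex.δ_δ i j k x

/-- `RHom_R(X, D) = Hom_R(X, J)`, computed by a semi-injective resolution `D ⟶ J`. -/
def RHom (X : CochainComplex (ModuleCat.{u} R) ℤ) {D : CochainComplex (ModuleCat.{u} R) ℤ}
    (J : SemiInjectiveResolution D) : CochainComplex (ModuleCat.{u} R) ℤ :=
  homComplex X J.complex

/-- A module, as a complex concentrated in degree `0`. -/
abbrev single (N : ModuleCat.{u} R) : CochainComplex (ModuleCat.{u} R) ℤ :=
  (HomologicalComplex.single (ModuleCat.{u} R) (ComplexShape.up ℤ) 0).obj N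

/-- The map `R ⟶ Hom_R(Y, Y)`, sending `r` to multiplication by `r` on `Y`. -/
def homothety (Y : CochainComplex (ModuleCat.{u} R) ℤ) :
    single (ModuleCat.of R R) ⟶ homComplex Y Y :=
  HomologicalComplex.mkHomFromSingle
    (ModuleCat.ofHom (LinearMap.toSpanSingleton R (CochainComplex.HomComplex.Cochain Y Y 0)
      (CochainComplex.HomComplex.Cochain.ofHom (𝟙 Y))))
    (by
      intro k _
      ext
      change CochainComplex.HomComplex.δ 0 k
        ((1 : R) • CochainComplex.HomComplex.Cochain.ofHom (𝟙 Y)) = 0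
      rw [CochainComplex.HomComplex.δ_smul, CochainComplex.HomComplex.δ_ofHom, smul_zero])

/-- Two complexes are isomorphic in the derived category `D(R)`. -/
def DerivedIso (X Y : CochainComplex (ModuleCat.{u} R) ℤ) : Prop :=
  letI := HasDerivedCategory.standard (ModuleCat.{u} R)
  Nonempty (DerivedCategory.Q.obj X ≅ DerivedCategory.Q.obj Y)

/-- The total cohomology `⨁ i, H^i(X)` is a finitely generated `R`-module. -/
def FinitelyGeneratedCohomology (X : CochainComplex (ModuleCat.{u} R) ℤ) : Prop :=
  Module.Finite R (DirectSum ℤ fun i => X.homology i)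

end Resolutions

/-- The Krull dimension of `R` as a natural number; it is meant for rings of finite dimension. -/
def dim (R : Type u) [CommRing R] : ℕ := ((ringKrullDim R).unbotD 0).toNat

lemma ringKrullDim_eq_dim (R : Type u) [CommRing R] [IsLocalRing R] [IsNoetherianRing R] :
    ringKrullDim R = dim R := by
  have h := finiteRingKrullDim_iff_ne_bot_and_top.1 (inferInstance : FiniteRingKrullDim R)
  obtain ⟨x, hx⟩ := WithBot.ne_bot_iff_exists.1 h.1
  obtain ⟨n, rfl⟩ := (ENat.ne_top_iff_exists (n := x)).1 (by rintro rfl; exact h.2 hx.symm)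
  rw [dim, ← hx]
  rfl

section Local

variable {R : Type u} [CommRing R] [IsLocalRing R]

variable (R) in
/-- The residue field `k` of `R`, as an `R`-module. -/
abbrev residueField : ModuleCat.{u} R := ModuleCat.of R (IsLocalRing.ResidueField R)

variable (R) in
/-- The surjection `R ⟶ k`. -/
def toResidueField : ModuleCat.of R R ⟶ residueField R :=
  ModuleCat.ofHom (Algebra.linearMap R (IsLocalRing.ResidueField R))

/-- The chain map `P ⟶ k ⊗ P`, `x ↦ 1 ⊗ x`. If `P` is a semi-projective resolution of `M`, then
`k ⊗ P` represents `k ⊗ᴸ M`. -/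
def toTensorResidueField (P : CochainComplex (ModuleCat.{u} R) ℤ) :
    P ⟶ ((tensorLeft (residueField R)).mapHomologicalComplex (ComplexShape.up ℤ)).obj P where
  f i := (λ_ (P.X i)).inv ≫ toResidueField R ▷ P.X i
  comm' i j _ := by
    change ((λ_ (P.X i)).inv ≫ toResidueField R ▷ P.X i) ≫ residueField R ◁ P.d i j =
      P.d i j ≫ (λ_ (P.X j)).inv ≫ toResidueField R ▷ P.X j
    rw [Category.assoc, ← whisker_exchange, leftUnitor_inv_naturality_assoc]
    rfl

/-- Big Cohen-Macaulay complexes: `H(M)` is bounded, `H^0(M) ⟶ H^0(k ⊗ᴸ M)` is nonzero, and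
`H^i_𝔪(M) = 0` for `i ≠ dim R`. -/
structure IsBigCohenMacaulay (M : CochainComplex (ModuleCat.{u} R) ℤ) : Prop where
  bounded : ∃ a b : ℤ, ∀ i : ℤ, i < a ∨ b < i → IsZero (M.homology i)
  nonzero : ∃ P : SemiProjectiveResolution M,
    HomologicalComplex.homologyMap (toTensorResidueField P.complex) 0 ≠ 0
  vanishing : ∃ J : SemiInjectiveResolution M, ∀ i : ℤ, i ≠ (dim R : ℤ) →
    IsZero (J.localCohomology (IsLocalRing.maximalIdeal R) i)

/-- Maximal Cohen-Macaulay (MCM) complexes. -/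
structure IsMCM (M : CochainComplex (ModuleCat.{u} R) ℤ) : Prop extends
    IsBigCohenMacaulay M where
  finitelyGenerated : FinitelyGeneratedCohomology M

/-- Normalized dualizing complexes: `D` has finitely generated cohomology and nonzero cohomology
in degree `0`, and it is quasi-isomorphic to a complex `J` of injective modules, concentrated in
the degrees `0, …, dim R`, for which the homothety map
`R ⟶ Hom_R(J, J) = RHom_R(D, D)` is a quasi-isomorphism. -/
structure IsNormalizedDualizing (D : CochainComplex (ModuleCat.{u} R) ℤ) : Prop where
  finitelyGenerated : FinitelyGeneratedCohomology D
  nonzero : ¬ IsZero (D.homology 0)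
  exists_resolution : ∃ (J : CochainComplex (ModuleCat.{u} R) ℤ) (ι : D ⟶ J), QuasiIso ι ∧
    (∀ i : ℤ, Injective (J.X i)) ∧
    (∀ i : ℤ, i < 0 ∨ (dim R : ℤ) < i → IsZero (J.X i)) ∧
    QuasiIso (homothety J)

/-- The functor `Hom_R(X, -)` from `R`-modules to `R`-modules. -/
abbrev homFunctor (X : ModuleCat.{u} R) : ModuleCat.{u} R ⥤ ModuleCat.{u} R :=
  (linearCoyoneda R (ModuleCat.{u} R)).obj (op X)

/-- `Ext^i_R(X, N)`, the `i`-th right derived functor of `Hom_R(X, -)` at `N`. -/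
abbrev ext (X : ModuleCat.{u} R) (i : ℕ) (N : ModuleCat.{u} R) : ModuleCat.{u} R :=
  ((homFunctor X).rightDerived i).obj N

/-- `H^i_𝔪(N)` for a module `N`, the `i`-th right derived functor of `Γ_𝔪` at `N`. -/
abbrev localCohomologyModule (i : ℕ) (N : ModuleCat.{u} R) : ModuleCat.{u} R :=
  ((torsionFunctor (IsLocalRing.maximalIdeal R)).rightDerived i).obj N

lemma apply_mem_torsion {N : ModuleCat.{u} R} (f : residueField R ⟶ N)
    (x : IsLocalRing.ResidueField R) :
    f.hom x ∈ torsion (IsLocalRing.maximalIdeal R) N := by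
  refine ⟨1, fun r hr => ?_⟩
  rw [pow_one] at hr
  rw [← map_smul, Algebra.smul_def, IsLocalRing.ResidueField.algebraMap_eq,
    (IsLocalRing.residue_eq_zero_iff r).2 hr, zero_mul, map_zero]

variable (R) in
/-- The natural bijection `Hom_R(k, N) ⟶ Hom_R(k, Γ_𝔪 N)`: linear maps from `k` take values in
`Γ_𝔪 N`. -/
def homToHomTorsion : homFunctor (residueField R) ⟶
    torsionFunctor (IsLocalRing.maximalIdeal R) ⋙ homFunctor (residueField R) where
  app N := ModuleCat.ofHom
    { toFun := fun f : residueField R ⟶ N => (ModuleCat.ofHom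
        (f.hom.codRestrict (torsion (IsLocalRing.maximalIdeal R) N) (apply_mem_torsion f)) :
          residueField R ⟶ (torsionFunctor (IsLocalRing.maximalIdeal R)).obj N)
      map_add' := fun _ _ => rfl
      map_smul' := fun _ _ => rfl }
  naturality _ _ _ := rfl

variable (R) in
/-- Evaluation at `1`: the natural isomorphism `Hom_R(R, N) ≅ N`. -/
def evalOne : homFunctor (ModuleCat.of R R) ⟶ 𝟭 (ModuleCat.{u} R) where
  app N := ModuleCat.ofHom
    { toFun := fun f : ModuleCat.of R R ⟶ N => f.hom (1 : R)
      map_add' := fun _ _ => rfl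
      map_smul' := fun _ _ => rfl }
  naturality _ _ _ := rfl

variable (R) in
/-- The composite `Hom_R(k, N) ≅ Hom_R(k, Γ_𝔪 N) ⟶ Hom_R(R, Γ_𝔪 N) ≅ Γ_𝔪 N`, where the map in the
middle is induced by the surjection `R ⟶ k`. -/
def homToTorsion : homFunctor (residueField R) ⟶
    torsionFunctor (IsLocalRing.maximalIdeal R) :=
  homToHomTorsion R ≫
    Functor.whiskerLeft (torsionFunctor (IsLocalRing.maximalIdeal R))
      ((linearCoyoneda R (ModuleCat.{u} R)).map (toResidueField R).op ≫ evalOne R)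

/-- The canonical map `ζ^i_N : Ext^i_R(k, N) ⟶ H^i_𝔪(N)`. On an injective resolution `N ⟶ J` it is
`H^i` of the composite `Hom_R(k, J) ≅ Hom_R(k, Γ_𝔪 J) ⟶ Hom_R(R, Γ_𝔪 J) ≅ Γ_𝔪 J`. -/
def zeta (i : ℕ) (N : ModuleCat.{u} R) : ext (residueField R) i N ⟶ localCohomologyModule i N :=
  (NatTrans.rightDerived (homToTorsion R) i).app N

end Local

end MCM

end

/-! Replace `D` by its bounded model `I`, a complex of injectives in degrees `0, …, d`, and write
`M† = Hom(M, I)`. Two facts about `I` carry the proof.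

Biduality (`quasiIso_bidual`): `M → M††` is a quasi-isomorphism whenever `H(M)` is finitely
generated. The homothety map gives this for `R`, hence for `Rⁿ`; the four lemma along `0 → K → Rⁿ →
N → 0`, by descending induction on the degree, gives it for finitely generated modules, and
truncation gives it for complexes.

Torsion (`exists_quasiIso_torsionComplex_singleAt`): `Γ_𝔪 I` is quasi-isomorphic to `E[-d]`, where
`E` is an injective `𝔪`-torsion cogenerator. This rests on `k†` having cohomology exactly in degree
`d`. Biduality for `k` shows that every morphism `k† → I` is, up to homotopy, a multiple of one
evaluation, which rules out cohomology in two degrees. The remaining degree `t` satisfies `t ≤ d` by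
the shape of `I`, and `t ≥ d` by Bass's argument climbing a longest chain of primes.

Local duality follows. If `P` is a bounded above complex of finitely generated projectives, then
`Γ_𝔪 Hom(P, I) = Hom(P, Γ_𝔪 I) ≃ Hom(P, E[-d])`. Since `Hom(-, E)` is exact and faithful,
`H^i_𝔪(P†)` vanishes exactly when `H^{d-i}(P)` does. With `P ≃ M†`, so that `P† ≃ M`, the vanishing
condition for MCM becomes: `M†` has cohomology in degree `0` only. With `P ≃ M` instead, `P†` is a
K-injective resolution of `N`, and the nonvanishing conditions match (`hasSocleClass_hom_iff`): a
cocycle of `P^0` that is nonzero modulo `𝔪P^0` and boundaries is detected by a map `P^0 → E` killing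
both, and such a map represents a nonzero value of `ζ^d_N`. The second assertion follows by taking
`M = N†`, using biduality again. -/

namespace MCM

/-! ### Cohomology of complexes of modules in terms of elements -/

section Homology

variable {R : Type u} [CommRing R]

/-- The class of a cocycle in the homology of a complex of modules. -/
noncomputable def hclass (K : CochainComplex (ModuleCat.{u} R) ℤ) (i : ℤ) :
    LinearMap.ker (K.d i (i + 1)).hom →ₗ[R] K.homology i :=
  (K.liftCycles (ModuleCat.ofHom (LinearMap.ker (K.d i (i + 1)).hom).subtype) (i + 1) (by simp)
    (by ext x; exact x.2) ≫ K.homologyπ i).hom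

variable {K L : CochainComplex (ModuleCat.{u} R) ℤ} {i : ℤ}

lemma iCycles_d_apply (c : K.cycles i) : (K.d i (i + 1)).hom (K.iCycles i c) = 0 :=
  LinearMap.congr_fun (congrArg ModuleCat.Hom.hom (K.iCycles_d i (i + 1))) c

lemma iCycles_injective : Function.Injective (K.iCycles i) :=
  (ModuleCat.mono_iff_injective _).1 inferInstance

lemma liftCycles_subtype_apply (c : K.cycles i) :
    (K.liftCycles (ModuleCat.ofHom (LinearMap.ker (K.d i (i + 1)).hom).subtype) (i + 1) (by simp)
    (by ext x; exact x.2)).hom ⟨K.iCycles i c, iCycles_d_apply c⟩ = c := by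
  apply iCycles_injective
  rw [← ModuleCat.comp_apply, HomologicalComplex.liftCycles_i]
  rfl

lemma hclass_surjective : Function.Surjective (hclass K i) := by
  intro h
  obtain ⟨c, rfl⟩ := (ModuleCat.epi_iff_surjective (K.homologyπ i)).1 inferInstance h
  refine ⟨⟨K.iCycles i c, iCycles_d_apply c⟩, ?_⟩
  conv_rhs => rw [← liftCycles_subtype_apply c]
  rfl

lemma hclass_eq_zero_iff (x : LinearMap.ker (K.d i (i + 1)).hom) (j : ℤ) (hj : j + 1 = i) :
    hclass K i x = 0 ↔ ∃ y : K.X j, (K.d j i).hom y = x := by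
  set c : K.cycles i := (K.liftCycles (ModuleCat.ofHom (LinearMap.ker (K.d i (i + 1)).hom).subtype)
    (i + 1) (by simp) (by ext x; exact x.2)).hom x with hc
  have hx : K.iCycles i c = x := by
    rw [hc, ← ModuleCat.comp_apply, HomologicalComplex.liftCycles_i]
    rfl
  have hjp : (ComplexShape.up ℤ).prev i = j := by
    rw [← hj]; simp
  have hex : (ShortComplex.mk (K.toCycles j i) (K.homologyπ i) (by simp)).Exact :=
    ShortComplex.exact_of_g_is_cokernel _ (K.homologyIsCokernel j i hjp)
  rw [ShortComplex.moduleCat_exact_iff] at hex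
  constructor
  · intro h
    obtain ⟨y, hy⟩ := hex c h
    refine ⟨y, ?_⟩
    rw [← hx]
    rw [← hy]
    exact (LinearMap.congr_fun (congrArg ModuleCat.Hom.hom (K.toCycles_i j i)) y).symm
  · rintro ⟨y, hy⟩
    have hcy : c = K.toCycles j i y := by
      apply iCycles_injective
      rw [hx, ← hy]
      exact (LinearMap.congr_fun (congrArg ModuleCat.Hom.hom (K.toCycles_i j i)) y).symm
    change K.homologyπ i c = 0
    rw [hcy]
    exact LinearMap.congr_fun (congrArg ModuleCat.Hom.hom (K.toCycles_comp_homologyπ j i)) y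

lemma hom_comm_apply (f : K ⟶ L) (i j : ℤ) (x : K.X i) :
    (L.d i j).hom ((f.f i).hom x) = (f.f j).hom ((K.d i j).hom x) :=
  LinearMap.congr_fun (congrArg ModuleCat.Hom.hom (f.comm i j)) x

lemma d_d_apply (K : CochainComplex (ModuleCat.{u} R) ℤ) (i j k : ℤ) (x : K.X i) :
    (K.d j k).hom ((K.d i j).hom x) = 0 :=
  LinearMap.congr_fun (congrArg ModuleCat.Hom.hom (K.d_comp_d i j k)) x

lemma iCycles_liftCycles_subtype_apply (x : LinearMap.ker (K.d i (i + 1)).hom) :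
    (K.iCycles i).hom ((K.liftCycles (ModuleCat.ofHom
      (LinearMap.ker (K.d i (i + 1)).hom).subtype) (i + 1) (by simp) (by ext x; exact x.2)).hom x) =
      x.1 := by
  have h := K.liftCycles_i (ModuleCat.ofHom (LinearMap.ker (K.d i (i + 1)).hom).subtype) (i + 1)
    (by simp) (by ext x; exact x.2)
  exact LinearMap.congr_fun (congrArg ModuleCat.Hom.hom h) x

lemma homologyMap_hclass (f : K ⟶ L) (x : K.X i) (hx : x ∈ LinearMap.ker (K.d i (i + 1)).hom)
    (hx' : (f.f i).hom x ∈ LinearMap.ker (L.d i (i + 1)).hom) :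
    (HomologicalComplex.homologyMap f i).hom (hclass K i ⟨x, hx⟩) =
      hclass L i ⟨(f.f i).hom x, hx'⟩ := by
  refine (LinearMap.congr_fun (congrArg ModuleCat.Hom.hom
    (HomologicalComplex.homologyπ_naturality f i)) _).trans (congrArg (L.homologyπ i).hom ?_)
  apply iCycles_injective
  refine (LinearMap.congr_fun (congrArg ModuleCat.Hom.hom
    (HomologicalComplex.cyclesMap_i f i)) _).trans ?_
  exact (congrArg (f.f i).hom (iCycles_liftCycles_subtype_apply _)).trans
    (iCycles_liftCycles_subtype_apply (⟨_, hx'⟩ : LinearMap.ker (L.d i (i + 1)).hom)).symm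

lemma map_mem_ker (f : K ⟶ L) {x : K.X i} (hx : x ∈ LinearMap.ker (K.d i (i + 1)).hom) :
    (f.f i).hom x ∈ LinearMap.ker (L.d i (i + 1)).hom := by
  rw [LinearMap.mem_ker, hom_comm_apply, LinearMap.mem_ker.1 hx, map_zero]

lemma isZero_homology_iff (K : CochainComplex (ModuleCat.{u} R) ℤ) (j i k : ℤ) (hj : j + 1 = i)
    (hk : i + 1 = k) : IsZero (K.homology i) ↔
      ∀ x : K.X i, (K.d i k).hom x = 0 → ∃ y : K.X j, (K.d j i).hom y = x := by
  subst hk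
  constructor
  · intro h x hx
    refine (hclass_eq_zero_iff ⟨x, LinearMap.mem_ker.2 hx⟩ j hj).1 ?_
    have := ModuleCat.subsingleton_of_isZero h
    exact Subsingleton.elim _ _
  · intro h
    rw [ModuleCat.isZero_iff_subsingleton]
    refine subsingleton_of_forall_eq 0 fun y => ?_
    obtain ⟨x, rfl⟩ := hclass_surjective y
    exact (hclass_eq_zero_iff x j hj).2 (h x.1 x.2)

lemma homologyMap_injective_iff (f : K ⟶ L) (j i k : ℤ) (hj : j + 1 = i) (hk : i + 1 = k) :
    Function.Injective (HomologicalComplex.homologyMap f i).hom ↔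
      ∀ x : K.X i, (K.d i k).hom x = 0 → (∃ y : L.X j, (L.d j i).hom y = (f.f i).hom x) →
        ∃ y : K.X j, (K.d j i).hom y = x := by
  subst hk
  constructor
  · intro h x hx hy
    refine (hclass_eq_zero_iff ⟨x, LinearMap.mem_ker.2 hx⟩ j hj).1 (h ?_)
    rw [map_zero]
    exact (homologyMap_hclass f x _ (map_mem_ker f (LinearMap.mem_ker.2 hx))).trans
      ((hclass_eq_zero_iff _ j hj).2 hy)
  · intro h
    rw [injective_iff_map_eq_zero]
    intro a ha
    obtain ⟨⟨x, hx⟩, rfl⟩ := hclass_surjective a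
    rw [homologyMap_hclass f x hx (map_mem_ker f hx)] at ha
    exact (hclass_eq_zero_iff _ j hj).2 (h x hx ((hclass_eq_zero_iff _ j hj).1 ha))

lemma homologyMap_surjective_iff (f : K ⟶ L) (j i k : ℤ) (hj : j + 1 = i) (hk : i + 1 = k) :
    Function.Surjective (HomologicalComplex.homologyMap f i).hom ↔
      ∀ z : L.X i, (L.d i k).hom z = 0 → ∃ x : K.X i, (K.d i k).hom x = 0 ∧
        ∃ y : L.X j, (L.d j i).hom y = z - (f.f i).hom x := by
  subst hk
  constructor
  · intro h z hz
    obtain ⟨a, ha⟩ := h (hclass L i ⟨z, LinearMap.mem_ker.2 hz⟩)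
    obtain ⟨⟨x, hx⟩, rfl⟩ := hclass_surjective a
    rw [homologyMap_hclass f x hx (map_mem_ker f hx)] at ha
    exact ⟨x, hx, (hclass_eq_zero_iff
      ((⟨z, LinearMap.mem_ker.2 hz⟩ : LinearMap.ker (L.d i (i + 1)).hom) -
        ⟨_, map_mem_ker f hx⟩) j hj).1
      (by rw [map_sub, ha, sub_self])⟩
  · intro h a
    obtain ⟨⟨z, hz⟩, rfl⟩ := hclass_surjective a
    obtain ⟨x, hx, y, hy⟩ := h z hz
    refine ⟨hclass K i ⟨x, LinearMap.mem_ker.2 hx⟩, ?_⟩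
    rw [homologyMap_hclass f x _ (map_mem_ker f (LinearMap.mem_ker.2 hx)), ← sub_eq_zero, ← map_sub]
    refine (hclass_eq_zero_iff _ j hj).2 ⟨-y, ?_⟩
    rw [map_neg, hy, neg_sub]
    rfl

lemma homologyMap_eq_zero_iff (f : K ⟶ L) (j i k : ℤ) (hj : j + 1 = i) (hk : i + 1 = k) :
    HomologicalComplex.homologyMap f i = 0 ↔
      ∀ x : K.X i, (K.d i k).hom x = 0 → ∃ y : L.X j, (L.d j i).hom y = (f.f i).hom x := by
  subst hk
  constructor
  · intro h x hx
    refine (hclass_eq_zero_iff ⟨_, map_mem_ker f (LinearMap.mem_ker.2 hx)⟩ j hj).1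
      ((homologyMap_hclass f x (LinearMap.mem_ker.2 hx) _).symm.trans ?_)
    rw [h]
    rfl
  · intro h
    ext a
    obtain ⟨⟨x, hx⟩, rfl⟩ := hclass_surjective a
    exact (homologyMap_hclass f x hx (map_mem_ker f hx)).trans
      ((hclass_eq_zero_iff _ j hj).2 (h x hx))

lemma quasiIso_iff_bijective (f : K ⟶ L) :
    QuasiIso f ↔ ∀ i, Function.Bijective (HomologicalComplex.homologyMap f i).hom := by
  simp_rw [quasiIso_iff, quasiIsoAt_iff_isIso_homologyMap, ConcreteCategory.isIso_iff_bijective]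

end Homology

/-! ### The Hom complex and K-injectivity -/

section HomComplex

variable {R : Type u} [CommRing R]

open CochainComplex.HomComplex

/-- Precomposition with a morphism of complexes, as a map `Hom(X', Y) ⟶ Hom(X, Y)`. -/
noncomputable def precomp {X X' : CochainComplex (ModuleCat.{u} R) ℤ} (f : X ⟶ X')
    (Y : CochainComplex (ModuleCat.{u} R) ℤ) : homComplex X' Y ⟶ homComplex X Y where
  f n := ModuleCat.ofHom
    { toFun := fun φ : Cochain X' Y n => (Cochain.ofHom f).comp φ (zero_add n)
      map_add' := fun _ _ => Cochain.comp_add _ _ _ _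
      map_smul' := fun _ _ => Cochain.comp_smul _ _ _ _ }
  comm' i j _ := by
    ext φ
    exact δ_ofHom_comp f φ j

/-- Postcomposition with a morphism of complexes, as a map `Hom(X, Y) ⟶ Hom(X, Y')`. -/
noncomputable def postcomp (X : CochainComplex (ModuleCat.{u} R) ℤ)
    {Y Y' : CochainComplex (ModuleCat.{u} R) ℤ} (g : Y ⟶ Y') :
    homComplex X Y ⟶ homComplex X Y' where
  f n := ModuleCat.ofHom
    { toFun := fun φ : Cochain X Y n => φ.comp (Cochain.ofHom g) (add_zero n)
      map_add' := fun _ _ => Cochain.add_comp _ _ _ _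
      map_smul' := fun _ _ => Cochain.smul_comp _ _ _ _ }
  comm' i j _ := by
    ext φ
    exact δ_comp_ofHom φ g j

variable {X X' X'' Y : CochainComplex (ModuleCat.{u} R) ℤ}

lemma homComplex_hom_ext {K : CochainComplex (ModuleCat.{u} R) ℤ} {f g : homComplex X Y ⟶ K}
    (h : ∀ (n : ℤ) (φ : Cochain X Y n), (f.f n).hom φ = (g.f n).hom φ) : f = g :=
  HomologicalComplex.hom_ext _ _ fun n => ModuleCat.hom_ext (LinearMap.ext (h n))

lemma precomp_comp (f : X ⟶ X') (g : X' ⟶ X'') :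
    precomp (f ≫ g) Y = precomp g Y ≫ precomp f Y :=
  homComplex_hom_ext fun n φ => by
    change (Cochain.ofHom (f ≫ g)).comp φ (zero_add n) =
      (Cochain.ofHom f).comp ((Cochain.ofHom g).comp φ (zero_add n)) (zero_add n)
    rw [Cochain.ofHom_comp, Cochain.comp_assoc_of_first_is_zero_cochain]

lemma precomp_zero : precomp (0 : X ⟶ X') Y = 0 :=
  homComplex_hom_ext fun n φ => by
    change (Cochain.ofHom 0).comp φ (zero_add n) = 0
    rw [Cochain.ofHom_zero, Cochain.zero_comp]

lemma acyclic_mappingCone (f : X ⟶ X') [QuasiIso f] :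
    (CochainComplex.mappingCone f).Acyclic := by
  have h : HomotopyCategory.quasiIso (ModuleCat.{u} R) (ComplexShape.up ℤ)
      ((HomotopyCategory.quotient _ _).map f) := by
    rw [HomotopyCategory.quotient_map_mem_quasiIso_iff, HomologicalComplex.mem_quasiIso_iff]
    infer_instance
  rw [HomotopyCategory.quasiIso_eq_trW_subcategoryAcyclic] at h
  exact (HomotopyCategory.quotient_obj_mem_subcategoryAcyclic_iff_acyclic _).1
    ((ObjectProperty.trW_iff_of_distinguished _ _
      (HomotopyCategory.mappingCone_triangleh_distinguished f)).1 h)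

/-- If `Y` is K-injective, then `Hom(-, Y)` preserves quasi-isomorphisms. -/
instance quasiIso_precomp (f : X ⟶ X') [QuasiIso f] [Y.IsKInjective] :
    QuasiIso (precomp f Y) := by
  -- Both halves glue data into a cocycle on the acyclic cone of `f`; it is a coboundary because `Y`
  -- is K-injective.
  have hcone := acyclic_mappingCone f
  rw [quasiIso_iff_bijective]
  intro i
  constructor
  · rw [homologyMap_injective_iff _ (i - 1) i (i + 1) (by lia) rfl]
    rintro (z : Cochain X' Y i) hz ⟨(h : Cochain X Y (i - 1)), hh⟩
    -- The cocycle `z` on `X'` and the cochain `h` bounding its restriction to `X` glue, with the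
    -- sign that `descCocycle` demands.
    obtain ⟨u, hu⟩ := CochainComplex.IsKInjective.eq_δ_of_cocycle
      (CochainComplex.mappingCone.descCocycle f (i.negOnePow • h) (Cocycle.mk z (i + 1) rfl hz)
        (sub_add_cancel i 1) (by
          rw [δ_units_smul]
          exact congrArg _ hh)) hcone (i - 1) (by lia)
    refine ⟨(Cochain.ofHom (CochainComplex.mappingCone.inr f)).comp u (zero_add _), ?_⟩
    change δ _ _ _ = _
    rw [δ_ofHom_comp, hu]
    exact CochainComplex.mappingCone.inr_descCochain f _ _ (sub_add_cancel i 1)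
  · rw [homologyMap_surjective_iff _ (i - 1) i (i + 1) (by lia) rfl]
    intro (w : Cochain X Y i) hw
    -- Here `w` is glued with zero on `X'`. Restricting a primitive `u` to `X'` gives the preimage
    -- `x`, and to the shifted copy of `X` the correcting cochain `y`.
    obtain ⟨u, hu⟩ := CochainComplex.IsKInjective.eq_δ_of_cocycle
      (CochainComplex.mappingCone.descCocycle f w (0 : Cocycle X' Y (i + 1))
        rfl (by
          change δ i (i + 1) w = 0 at hw
          rw [hw]
          simp)) hcone i rfl
    let x : Cochain X' Y i := -(i.negOnePow •
      (Cochain.ofHom (CochainComplex.mappingCone.inr f)).comp u (zero_add _))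
    let y : Cochain X Y (i - 1) := (CochainComplex.mappingCone.inl f).comp u (by lia)
    have h1 : (Cochain.ofHom (CochainComplex.mappingCone.inr f)).comp (δ i (i + 1) u) (zero_add _)
        = 0 := by
      rw [hu]
      exact CochainComplex.mappingCone.inr_descCochain f w 0 rfl
    have h2 : (CochainComplex.mappingCone.inl f).comp (δ i (i + 1) u)
        (by lia : -1 + (i + 1) = i) = w := by
      rw [hu]
      exact CochainComplex.mappingCone.inl_descCochain f w 0 rfl
    have hx : δ i (i + 1) x = 0 := by
      rw [δ_neg, δ_units_smul, δ_ofHom_comp, h1, smul_zero, neg_zero]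
    have hy : δ (i - 1) i y = w - (Cochain.ofHom f).comp x (zero_add _) := by
      rw [δ_comp _ u (by lia) 0 (i + 1) i (by lia) (by lia) rfl, h2,
        CochainComplex.mappingCone.δ_inl, Cochain.ofHom_comp,
        Cochain.comp_assoc_of_first_is_zero_cochain, Cochain.comp_neg, Cochain.comp_units_smul,
        sub_neg_eq_add]
    exact ⟨x, hx, y, hy⟩

end HomComplex

/-! ### Short exact sequences, truncation and dévissage -/

section QuasiIso

variable {R : Type u} [CommRing R] {S T : ShortComplex (CochainComplex (ModuleCat.{u} R) ℤ)}

lemma quasiIso_τ₂_of_shortExact (hS : S.ShortExact) (hT : T.ShortExact) (φ : S ⟶ T)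
    (h₁ : QuasiIso φ.τ₁) (h₃ : QuasiIso φ.τ₃) : QuasiIso φ.τ₂ := by
  let := HasDerivedCategory.standard (ModuleCat.{u} R)
  rw [← DerivedCategory.isIso_Q_map_iff_quasiIso] at h₁ h₃ ⊢
  exact Pretriangulated.isIso₂_of_isIso₁₃ (DerivedCategory.triangleOfSES.map hS hT φ)
    (DerivedCategory.triangleOfSES_distinguished hS)
    (DerivedCategory.triangleOfSES_distinguished hT) h₁ h₃

lemma quasiIso_τ₁_of_shortExact (hS : S.ShortExact) (hT : T.ShortExact) (φ : S ⟶ T)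
    (h₂ : QuasiIso φ.τ₂) (h₃ : QuasiIso φ.τ₃) : QuasiIso φ.τ₁ := by
  let := HasDerivedCategory.standard (ModuleCat.{u} R)
  rw [← DerivedCategory.isIso_Q_map_iff_quasiIso] at h₂ h₃ ⊢
  exact Pretriangulated.isIso₁_of_isIso₂₃ (DerivedCategory.triangleOfSES.map hS hT φ)
    (DerivedCategory.triangleOfSES_distinguished hS)
    (DerivedCategory.triangleOfSES_distinguished hT) h₂ h₃

lemma quasiIso_τ₃_of_shortExact (hS : S.ShortExact) (hT : T.ShortExact) (φ : S ⟶ T)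
    (h₁ : QuasiIso φ.τ₁) (h₂ : QuasiIso φ.τ₂) : QuasiIso φ.τ₃ := by
  let := HasDerivedCategory.standard (ModuleCat.{u} R)
  rw [← DerivedCategory.isIso_Q_map_iff_quasiIso] at h₁ h₂ ⊢
  exact Pretriangulated.isIso₃_of_isIso₁₂ (DerivedCategory.triangleOfSES.map hS hT φ)
    (DerivedCategory.triangleOfSES_distinguished hS)
    (DerivedCategory.triangleOfSES_distinguished hT) h₁ h₂

end QuasiIso

section Devissage

variable {R : Type u} [CommRing R]

/-- A module, as a complex concentrated in degree `n`. -/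
noncomputable abbrev singleAt (n : ℤ) (N : ModuleCat.{u} R) : CochainComplex (ModuleCat.{u} R) ℤ :=
  (HomologicalComplex.single (ModuleCat.{u} R) (ComplexShape.up ℤ) n).obj N

lemma isZero_homology_singleAt (n i : ℤ) (h : i ≠ n) (N : ModuleCat.{u} R) :
    IsZero ((singleAt n N).homology i) :=
  HomologicalComplex.isZero_single_obj_homology _ _ _ _ h

variable {W : CochainComplex (ModuleCat.{u} R) ℤ → Prop} {Good : ModuleCat.{u} R → Prop}

lemma quasiIso_of_acyclic {X Y : CochainComplex (ModuleCat.{u} R) ℤ} (f : X ⟶ Y)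
    (hX : ∀ i, IsZero (X.homology i)) (hY : ∀ i, IsZero (Y.homology i)) : QuasiIso f := by
  rw [quasiIso_iff]
  intro i
  rw [quasiIsoAt_iff_isIso_homologyMap]
  exact ⟨0, (hX i).eq_of_src _ _, (hY i).eq_of_src _ _⟩

/-- A complex whose cohomology is concentrated in degree `n` is connected by quasi-isomorphisms to
a module in degree `n`. -/
lemma exists_quasiIso_singleAt (X : CochainComplex (ModuleCat.{u} R) ℤ) (n : ℤ)
    (hX : ∀ i, i ≠ n → IsZero (X.homology i)) :
    ∃ (Y : CochainComplex (ModuleCat.{u} R) ℤ) (f : Y ⟶ X) (g : Y ⟶ singleAt n (X.homology n)),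
      QuasiIso f ∧ QuasiIso g := by
  have hLE : X.IsLE n := by
    rw [CochainComplex.isLE_iff]
    intro i hi
    exact (HomologicalComplex.exactAt_iff_isZero_homology _ _).2 (hX i (by lia))
  have hGE : (X.truncLE n).IsGE n := by
    rw [CochainComplex.isGE_iff]
    intro i hi
    exact (HomologicalComplex.exactAt_iff_isZero_homology _ _).2 ((hX i (by lia)).of_iso
      (asIso (HomologicalComplex.homologyMap (X.ιTruncLE n) i)))
  obtain ⟨M, ⟨e⟩⟩ := CochainComplex.exists_iso_single ((X.truncLE n).truncGE n) n
  have e' : X.homology n ≅ M :=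
    (asIso (HomologicalComplex.homologyMap (X.ιTruncLE n) n)).symm ≪≫
      asIso (HomologicalComplex.homologyMap ((X.truncLE n).πTruncGE n) n) ≪≫
      (HomologicalComplex.homologyFunctor _ _ n).mapIso e ≪≫
      HomologicalComplex.singleObjHomologySelfIso _ _ _
  exact ⟨X.truncLE n, X.ιTruncLE n, (X.truncLE n).πTruncGE n ≫ e.hom ≫
    ((HomologicalComplex.single _ _ n).mapIso e'.symm).hom, inferInstance, inferInstance⟩

/-- Dévissage of a complex with bounded cohomology into its cohomology modules. -/
theorem devissage
    (hqi : ∀ {X Y : CochainComplex (ModuleCat.{u} R) ℤ} (f : X ⟶ Y), QuasiIso f → (W X ↔ W Y))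
    (hext : ∀ S : ShortComplex (CochainComplex (ModuleCat.{u} R) ℤ), S.ShortExact →
      W S.X₁ → W S.X₃ → W S.X₂)
    (hiso : ∀ {M N : ModuleCat.{u} R}, (M ≅ N) → Good M → Good N)
    (hsingle : ∀ (n : ℤ) (N : ModuleCat.{u} R), Good N → W (singleAt n N))
    (X : CochainComplex (ModuleCat.{u} R) ℤ)
    (hX : ∃ a b : ℤ, ∀ i : ℤ, i < a ∨ b < i → IsZero (X.homology i))
    (hgood : ∀ i, Good (X.homology i)) : W X := by
  obtain ⟨a, b, hab⟩ := hX
  -- `W` is not assumed on acyclic complexes. The vanishing module `H^{b+1}(X)` is good, and a zero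
  -- map to it is a quasi-isomorphism.
  have hzero : ∀ Y : CochainComplex (ModuleCat.{u} R) ℤ, (∀ i, IsZero (Y.homology i)) → W Y := by
    intro Y hY
    have h0 : W (singleAt 0 (X.homology (b + 1))) := hsingle 0 _ (hgood _)
    have hz : IsZero (X.homology (b + 1)) := hab _ (Or.inr (by lia))
    refine (hqi (0 : Y ⟶ singleAt 0 (X.homology (b + 1))) (quasiIso_of_acyclic _ hY ?_)).2 h0
    intro i
    by_cases hi : i = 0
    · subst hi
      exact hz.of_iso (HomologicalComplex.singleObjHomologySelfIso _ _ _)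
    · exact isZero_homology_singleAt _ _ hi _
  -- Induction on the length of the interval supporting the cohomology; each step splits off the
  -- lowest degree.
  obtain ⟨n, hn⟩ : ∃ n : ℕ, b < a + n := ⟨(b - a + 1).toNat, by lia⟩
  induction n generalizing a X with
  | zero => exact hzero X fun i => hab i (by simp at hn; lia)
  | succ n ih =>
    have hse := X.shortComplexTruncLE_shortExact a
    refine hext _ hse ?_ ?_
    · obtain ⟨Y, f, g, hf, hg⟩ := exists_quasiIso_singleAt (X.truncLE a) a (fun i hi => by
        rcases lt_or_gt_of_ne hi with h | h
        · have := X.quasiIsoAt_ιTruncLE a i h.le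
          exact (hab i (Or.inl h)).of_iso
            (asIso (HomologicalComplex.homologyMap (X.ιTruncLE a) i))
        · exact CochainComplex.isZero_of_isLE _ a i h)
      have := X.quasiIsoAt_ιTruncLE a a le_rfl
      exact (hqi f hf).1 ((hqi g hg).2 (hsingle a _
        (hiso (asIso (HomologicalComplex.homologyMap (X.ιTruncLE a) a)).symm (hgood a))))
    · rw [hqi (X.shortComplexTruncLEX₃ToTruncGE a (a + 1)) inferInstance]
      have hge : ∀ i, a + 1 ≤ i →
          IsIso (HomologicalComplex.homologyMap (X.πTruncGE (a + 1)) i) := by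
        intro i hi
        have := X.quasiIsoAt_πTruncGE (a + 1) i hi
        infer_instance
      have hlt : ∀ i, i < a + 1 → IsZero ((X.truncGE (a + 1)).homology i) := fun i hi =>
        CochainComplex.isZero_of_isGE _ (a + 1) i hi
      have hzero' : ∀ i, IsZero (X.homology i) → IsZero ((X.truncGE (a + 1)).homology i) := by
        intro i hi
        by_cases h : a + 1 ≤ i
        · have := hge i h
          exact hi.of_iso (asIso (HomologicalComplex.homologyMap (X.πTruncGE (a + 1)) i)).symm
        · exact hlt i (by lia)
      refine ih _ (fun i => ?_) (a + 1) (fun i hi => ?_) (by push_cast at hn; lia)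
      · by_cases h : a + 1 ≤ i
        · have := hge i h
          exact hiso (asIso (HomologicalComplex.homologyMap (X.πTruncGE (a + 1)) i)) (hgood i)
        · exact hiso ((hab (b + 1) (Or.inr (by lia))).iso (hlt i (by lia))) (hgood (b + 1))
      · rcases hi with hi | hi
        · exact hlt i hi
        · exact hzero' i (hab i (Or.inr hi))

end Devissage

/-! ### Exactness of dualization and the biduality map -/

section HomShortExact

variable {R : Type u} [CommRing R]

open CochainComplex.HomComplex

lemma shortExact_eval {S : ShortComplex (CochainComplex (ModuleCat.{u} R) ℤ)} (hS : S.ShortExact)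
    (i : ℤ) : (S.map (HomologicalComplex.eval _ _ i)).ShortExact :=
  (HomologicalComplex.shortExact_iff_degreewise_shortExact S).1 hS i

/-- The short complex obtained by applying `Hom(-, Y)`. -/
noncomputable abbrev homShortComplex (S : ShortComplex (CochainComplex (ModuleCat.{u} R) ℤ))
    (Y : CochainComplex (ModuleCat.{u} R) ℤ) :
    ShortComplex (CochainComplex (ModuleCat.{u} R) ℤ) :=
  ShortComplex.mk (precomp S.g Y) (precomp S.f Y) (by
    rw [← precomp_comp, S.zero, precomp_zero])

lemma shortExact_homShortComplex {S : ShortComplex (CochainComplex (ModuleCat.{u} R) ℤ)}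
    (hS : S.ShortExact) {Y : CochainComplex (ModuleCat.{u} R) ℤ} (hY : ∀ i, Injective (Y.X i)) :
    (homShortComplex S Y).ShortExact := by
  apply HomologicalComplex.shortExact_of_degreewise_shortExact
  intro n
  have hepi : ∀ p, Epi (S.g.f p) := fun p => (shortExact_eval hS p).epi_g
  have hepi' : ∀ p, Epi (S.map (HomologicalComplex.eval _ _ p)).g := hepi
  have hmono : ∀ p, Mono (S.f.f p) := fun p => (shortExact_eval hS p).mono_f
  refine ShortComplex.ShortExact.mk' ?_ ?_ ?_
  · rw [ShortComplex.moduleCat_exact_iff]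
    intro (φ : Cochain S.X₂ Y n) hφ
    change (Cochain.ofHom S.f).comp φ (zero_add n) = 0 at hφ
    have h : ∀ p q hpq, S.f.f p ≫ φ.v p q hpq = 0 := fun p q hpq => by
      simpa using Cochain.congr_v hφ p q hpq
    let ψ : Cochain S.X₃ Y n := Cochain.mk fun p q hpq =>
      (shortExact_eval hS p).exact.desc (φ.v p q hpq) (h p q hpq)
    refine ⟨ψ, ?_⟩
    change (Cochain.ofHom S.g).comp ψ (zero_add n) = φ
    ext p q hpq : 1
    rw [Cochain.zero_cochain_comp_v, Cochain.ofHom_v]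
    exact (shortExact_eval hS p).exact.g_desc _ _
  · rw [ModuleCat.mono_iff_injective, injective_iff_map_eq_zero]
    intro (φ : Cochain S.X₃ Y n) hφ
    change (Cochain.ofHom S.g).comp φ (zero_add n) = 0 at hφ
    change φ = 0
    ext p q hpq : 1
    rw [← cancel_epi (S.g.f p)]
    simpa using Cochain.congr_v hφ p q hpq
  · rw [ModuleCat.epi_iff_surjective]
    intro (φ : Cochain S.X₁ Y n)
    let ψ : Cochain S.X₂ Y n := Cochain.mk fun p q hpq =>
      Injective.factorThru (φ.v p q hpq) (S.f.f p)
    refine ⟨ψ, ?_⟩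
    change (Cochain.ofHom S.f).comp ψ (zero_add n) = φ
    ext p q hpq : 1
    rw [Cochain.zero_cochain_comp_v, Cochain.ofHom_v]
    exact Injective.comp_factorThru _ _

end HomShortExact

section Biduality

variable {R : Type u} [CommRing R]

open CochainComplex.HomComplex

/-- Evaluation at `x`, as a cochain `Hom(X, Y) → Y`. -/
noncomputable def evalCochain {X Y : CochainComplex (ModuleCat.{u} R) ℤ} (n : ℤ) (x : X.X n) :
    Cochain (homComplex X Y) Y n :=
  Cochain.mk fun p q hpq => ModuleCat.ofHom
    { toFun := fun φ : Cochain X Y p =>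
        -- Koszul sign for moving `x` past `φ`; it makes `bidual` a chain map.
        ((n * p).negOnePow : ℤ) • (φ.v n q (by lia)).hom x
      map_add' := fun _ _ => by simp
      map_smul' := fun r _ => by
        rw [Cochain.smul_v, ModuleCat.hom_smul, LinearMap.smul_apply, RingHom.id_apply, smul_comm] }

lemma evalCochain_v_apply {X Y : CochainComplex (ModuleCat.{u} R) ℤ} (n : ℤ) (x : X.X n)
    (p q : ℤ) (hpq : p + n = q) (φ : Cochain X Y p) :
    ((evalCochain (Y := Y) n x).v p q hpq).hom φ =
      ((n * p).negOnePow : ℤ) • (φ.v n q (by lia)).hom x := rfl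

lemma evalCochain_ext {X Y : CochainComplex (ModuleCat.{u} R) ℤ} {n : ℤ}
    {a b : Cochain (homComplex X Y) Y n}
    (h : ∀ (p q : ℤ) (hpq : p + n = q) (φ : Cochain X Y p),
      (a.v p q hpq).hom φ = (b.v p q hpq).hom φ) : a = b := by
  ext p q hpq : 1
  exact ModuleCat.hom_ext (LinearMap.ext (h p q hpq))

/-- The biduality morphism `X ⟶ Hom(Hom(X, Y), Y)`. -/
noncomputable def bidual (X Y : CochainComplex (ModuleCat.{u} R) ℤ) :
    X ⟶ homComplex (homComplex X Y) Y where
  f n := ModuleCat.ofHom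
    { toFun := evalCochain (X := X) (Y := Y) n
      map_add' := fun x y => evalCochain_ext fun p q hpq φ => by
        change _ = ((evalCochain n x).v p q hpq).hom φ + ((evalCochain n y).v p q hpq).hom φ
        simp only [evalCochain_v_apply, map_add, smul_add]
      map_smul' := fun r x => evalCochain_ext fun p q hpq φ => by
        change _ = r • ((evalCochain n x).v p q hpq).hom φ
        simp only [evalCochain_v_apply, map_smul]
        rw [smul_comm] }
  comm' n m hnm := by
    change n + 1 = m at hnm
    ext x
    refine evalCochain_ext fun p q hpq φ => ?_
    change ((δ n m (evalCochain n x)).v p q hpq).hom φ =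
      ((evalCochain (Y := Y) m ((X.d n m).hom x)).v p q hpq).hom φ
    rw [δ_v n m hnm _ p q hpq (q - 1) (p + 1) rfl rfl]
    change (Y.d (q - 1) q).hom (((evalCochain (Y := Y) n x).v p (q - 1) (by lia)).hom φ) +
      (m.negOnePow : ℤ) • ((evalCochain (Y := Y) n x).v (p + 1) q (by lia)).hom (δ p (p + 1) φ) = _
    rw [evalCochain_v_apply, evalCochain_v_apply, evalCochain_v_apply,
      δ_v p (p + 1) rfl φ n q (by lia) (q - 1) m rfl hnm]
    subst hnm
    simp only [ModuleCat.hom_add, LinearMap.add_apply, map_zsmul, Units.smul_def,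
      ModuleCat.hom_zsmul, LinearMap.smul_apply, ModuleCat.hom_comp, LinearMap.comp_apply,
      smul_add, smul_smul]
    -- The first identity cancels the two terms `d (φ x)`; the second matches the signs of `φ (d
    -- x)`.
    have h1 : (((n + 1).negOnePow : ℤ) * ((n * (p + 1)).negOnePow : ℤ)) =
        -((n * p).negOnePow : ℤ) := by
      rw [← Units.val_mul, ← Int.negOnePow_add, ← Units.val_neg, ← Int.negOnePow_succ]
      congr 1
      rw [Int.negOnePow_eq_iff]
      exact ⟨n, by ring⟩
    have h2 : (((n + 1).negOnePow : ℤ) * ((n * (p + 1)).negOnePow : ℤ)) *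
        ((p + 1).negOnePow : ℤ) = (((n + 1) * p).negOnePow : ℤ) := by
      rw [h1, ← Units.val_neg, ← Int.negOnePow_succ, ← Units.val_mul, ← Int.negOnePow_add]
      congr 1
      rw [Int.negOnePow_eq_iff]
      exact ⟨1, by ring⟩
    rw [← add_assoc, ← mul_assoc, h2, h1, neg_smul, add_neg_cancel, zero_add]

lemma bidual_naturality {X X' : CochainComplex (ModuleCat.{u} R) ℤ} (f : X ⟶ X')
    (Y : CochainComplex (ModuleCat.{u} R) ℤ) :
    bidual X Y ≫ precomp (precomp f Y) Y = f ≫ bidual X' Y := by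
  ext n x
  refine evalCochain_ext fun p q hpq φ => ?_
  change (((Cochain.ofHom (precomp f Y)).comp (evalCochain n x) (zero_add n)).v p q hpq).hom φ =
    ((evalCochain n ((f.f n).hom x)).v p q hpq).hom φ
  rw [Cochain.zero_cochain_comp_v, Cochain.ofHom_v]
  change ((evalCochain n x).v p q hpq).hom ((Cochain.ofHom f).comp φ (zero_add p)) = _
  rw [evalCochain_v_apply, evalCochain_v_apply, Cochain.zero_cochain_comp_v, Cochain.ofHom_v]
  rfl

end Biduality

/-! ### Thick classes of complexes -/

section Thick

variable {R : Type u} [CommRing R]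

/-- Properties of complexes that are invariant under quasi-isomorphisms and satisfy two-out-of-three
for short exact sequences. -/
structure IsThick (W : CochainComplex (ModuleCat.{u} R) ℤ → Prop) : Prop where
  iff_of_quasiIso : ∀ {X Y : CochainComplex (ModuleCat.{u} R) ℤ} (f : X ⟶ Y), QuasiIso f →
    (W X ↔ W Y)
  of_acyclic : ∀ X : CochainComplex (ModuleCat.{u} R) ℤ, (∀ i, IsZero (X.homology i)) → W X
  middle : ∀ S : ShortComplex (CochainComplex (ModuleCat.{u} R) ℤ), S.ShortExact →
    W S.X₁ → W S.X₃ → W S.X₂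
  left : ∀ S : ShortComplex (CochainComplex (ModuleCat.{u} R) ℤ), S.ShortExact →
    W S.X₂ → W S.X₃ → W S.X₁
  right : ∀ S : ShortComplex (CochainComplex (ModuleCat.{u} R) ℤ), S.ShortExact →
    W S.X₁ → W S.X₂ → W S.X₃

lemma isZero_homology_of_acyclic {X : CochainComplex (ModuleCat.{u} R) ℤ} (h : X.Acyclic) (i : ℤ) :
    IsZero (X.homology i) :=
  (HomologicalComplex.exactAt_iff_isZero_homology _ _).1 (h i)

variable {W : CochainComplex (ModuleCat.{u} R) ℤ → Prop}

lemma IsThick.iff_of_iso (hW : IsThick W) {X Y : CochainComplex (ModuleCat.{u} R) ℤ} (e : X ≅ Y) :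
    W X ↔ W Y :=
  hW.iff_of_quasiIso e.hom inferInstance

/-- `X` and `X[1]` are the outer terms of a short exact sequence whose middle term is the acyclic
cone of the identity. -/
lemma IsThick.shift_one_iff (hW : IsThick W) (X : CochainComplex (ModuleCat.{u} R) ℤ) :
    W (X⟦(1 : ℤ)⟧) ↔ W X := by
  have hse : (CochainComplex.mappingCone.triangleRotateShortComplex (𝟙 X)).ShortExact :=
    HomologicalComplex.shortExact_of_degreewise_shortExact _ fun n =>
      (CochainComplex.mappingCone.triangleRotateShortComplexSplitting (𝟙 X) n).shortExact
  have hcone : W (CochainComplex.mappingCone (𝟙 X)) :=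
    hW.of_acyclic _ (isZero_homology_of_acyclic (acyclic_mappingCone (𝟙 X)))
  exact ⟨fun h => hW.left _ hse hcone h, fun h => hW.right _ hse h hcone⟩

lemma IsThick.shift_iff (hW : IsThick W) (X : CochainComplex (ModuleCat.{u} R) ℤ) (n : ℤ) :
    W (X⟦n⟧) ↔ W X := by
  induction n using Int.induction_on with
  | zero => exact hW.iff_of_iso ((shiftFunctorZero _ ℤ).app X)
  | succ n ih =>
    rw [← ih, hW.iff_of_iso ((shiftFunctorAdd _ (n : ℤ) 1).app X)]
    exact hW.shift_one_iff _
  | pred n ih =>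
    rw [← ih, hW.iff_of_iso ((shiftFunctorAdd' _ (-(n : ℤ) - 1) 1 (-n) (by lia)).app X)]
    exact (hW.shift_one_iff _).symm

lemma IsThick.singleAt_iff (hW : IsThick W) (n : ℤ) (N : ModuleCat.{u} R) :
    W (singleAt n N) ↔ W (single N) := by
  have h := hW.iff_of_iso (((CochainComplex.singleFunctors (ModuleCat.{u} R)).shiftIso
    (-n) n 0 (by lia)).app N)
  exact h.symm.trans (hW.shift_iff _ _)

theorem IsThick.devissage (hW : IsThick W) {Good : ModuleCat.{u} R → Prop}
    (hiso : ∀ {M N : ModuleCat.{u} R}, (M ≅ N) → Good M → Good N)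
    (hsingle : ∀ N : ModuleCat.{u} R, Good N → W (single N))
    (X : CochainComplex (ModuleCat.{u} R) ℤ)
    (hX : ∃ a b : ℤ, ∀ i : ℤ, i < a ∨ b < i → IsZero (X.homology i))
    (hgood : ∀ i, Good (X.homology i)) : W X :=
  MCM.devissage hW.iff_of_quasiIso hW.middle hiso
    (fun n N hN => (hW.singleAt_iff n N).2 (hsingle N hN)) X hX hgood

lemma shortExact_single {S : ShortComplex (ModuleCat.{u} R)} (hS : S.ShortExact) :
    (S.map (HomologicalComplex.single (ModuleCat.{u} R) (ComplexShape.up ℤ) 0)).ShortExact :=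
  hS.map_of_exact _

/-- The short complex `0 → R → Rⁿ⁺¹ → Rⁿ → 0`. -/
def finSuccShortComplex (R : Type u) [CommRing R] (n : ℕ) : ShortComplex (ModuleCat.{u} R) :=
  ModuleCat.shortComplexOfCompEqZero (LinearMap.single R (fun _ : Fin (n + 1) => R) 0)
    (LinearMap.funLeft R R (Fin.succ : Fin n → Fin (n + 1))) (by
      ext i
      simp [LinearMap.funLeft])

lemma shortExact_finSuccShortComplex (n : ℕ) : (finSuccShortComplex R n).ShortExact := by
  apply ModuleCat.shortComplex_shortExact
  · intro (f : Fin (n + 1) → R)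
    constructor
    · intro hf
      refine ⟨(f 0 : R), ?_⟩
      change (Pi.single 0 (f 0) : Fin (n + 1) → R) = f
      funext i
      refine Fin.cases ?_ (fun j => ?_) i
      · exact Pi.single_eq_same _ _
      · exact (Pi.single_eq_of_ne (Fin.succ_ne_zero j) _).trans (congrFun hf j).symm
    · rintro ⟨(r : R), rfl⟩
      funext j
      exact Pi.single_eq_of_ne (M := fun _ : Fin (n + 1) => R) (Fin.succ_ne_zero j) r
  · intro (a : R) (b : R) h
    have h' := congrFun (show (Pi.single 0 a : Fin (n + 1) → R) = Pi.single 0 b from h) 0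
    have hab : a = b := by simpa using h'
    exact hab
  · intro (f : Fin n → R)
    exact ⟨(Fin.cons 0 f : Fin (n + 1) → R), by funext j; rfl⟩

lemma IsThick.single_fin (hW : IsThick W) (h : W (single (ModuleCat.of R R))) (n : ℕ) :
    W (single (ModuleCat.of R (Fin n → R))) := by
  induction n with
  | zero =>
    refine hW.of_acyclic _ fun i => ?_
    by_cases hi : i = 0
    · subst hi
      have : IsZero (ModuleCat.of R (Fin 0 → R)) := ModuleCat.isZero_of_subsingleton _
      exact this.of_iso (HomologicalComplex.singleObjHomologySelfIso _ _ _)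
    · exact isZero_homology_singleAt _ _ hi _
  | succ n ih => exact hW.middle _ (shortExact_single (shortExact_finSuccShortComplex n)) h ih

/-- On an acyclic complex the zero endomorphism is a quasi-isomorphism, hence so is its dual, which
is again zero. -/
lemma isZero_homology_homComplex {X Y : CochainComplex (ModuleCat.{u} R) ℤ} [Y.IsKInjective]
    (hX : ∀ i, IsZero (X.homology i)) (i : ℤ) : IsZero ((homComplex X Y).homology i) := by
  have : QuasiIso (0 : X ⟶ X) := quasiIso_of_acyclic _ hX hX
  have h : QuasiIso (precomp (0 : X ⟶ X) Y) := inferInstance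
  rw [precomp_zero] at h
  rw [ModuleCat.isZero_iff_subsingleton]
  refine subsingleton_of_forall_eq 0 fun x => ?_
  obtain ⟨y, rfl⟩ := ((quasiIso_iff_bijective _).1 h i).2 x
  rw [HomologicalComplex.homologyMap_zero]
  rfl

end Thick

/-! ### Biduality for finitely generated modules -/

section Model

variable {R : Type u} [CommRing R]

open CochainComplex.HomComplex

/-- Bounded complexes of injective modules whose homothety map is a quasi-isomorphism. -/
structure IsDualizingModel (I : CochainComplex (ModuleCat.{u} R) ℤ) : Prop where
  injective : ∀ i, Injective (I.X i)
  isZero : ∀ i : ℤ, i < 0 ∨ (dim R : ℤ) < i → IsZero (I.X i)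
  quasiIso_homothety : QuasiIso (homothety I)

variable {I : CochainComplex (ModuleCat.{u} R) ℤ}

lemma IsDualizingModel.isKInjective (hI : IsDualizingModel I) : I.IsKInjective := by
  have := hI.injective
  have : I.IsStrictlyGE 0 := by
    rw [CochainComplex.isStrictlyGE_iff]
    exact fun i hi => hI.isZero i (Or.inl hi)
  exact CochainComplex.isKInjective_of_injective I 0

lemma isZero_X_of_subsingleton_cochain {X Y : CochainComplex (ModuleCat.{u} R) ℤ} {n : ℤ}
    (h : ∀ p q : ℤ, p + n = q → IsZero (X.X p) ∨ IsZero (Y.X q)) :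
    IsZero ((homComplex X Y).X n) := by
  rw [ModuleCat.isZero_iff_subsingleton]
  refine subsingleton_of_forall_eq 0 fun (φ : Cochain X Y n) => ?_
  change φ = 0
  ext p q hpq : 1
  rcases h p q hpq with h | h
  · exact h.eq_of_src _ _
  · exact h.eq_of_tgt _ _

lemma isZero_homology_of_isZero_X {X : CochainComplex (ModuleCat.{u} R) ℤ} {i : ℤ}
    (h : IsZero (X.X i)) : IsZero (X.homology i) := by
  rw [isZero_homology_iff X (i - 1) i (i + 1) (by lia) rfl]
  intro x _
  have := ModuleCat.subsingleton_of_isZero h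
  exact ⟨0, Subsingleton.elim _ _⟩

lemma isZero_single_X {N : ModuleCat.{u} R} {n : ℤ} (h : n ≠ 0) : IsZero ((single N).X n) :=
  HomologicalComplex.isZero_single_obj_X _ _ _ _ h

lemma IsDualizingModel.isZero_hom_single (hI : IsDualizingModel I) (N : ModuleCat.{u} R) (n : ℤ)
    (hn : n < 0 ∨ (dim R : ℤ) < n) : IsZero ((homComplex (single N) I).X n) := by
  refine isZero_X_of_subsingleton_cochain fun p q hpq => ?_
  by_cases hp : p = 0
  · exact Or.inr (hI.isZero q (by lia))
  · exact Or.inl (isZero_single_X hp)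

/-- The identification of a module with the degree `0` part of the corresponding complex. -/
noncomputable def singleEquiv (N : ModuleCat.{u} R) : N ≃ₗ[R] (single N).X 0 :=
  (HomologicalComplex.singleObjXSelf (ComplexShape.up ℤ) 0 N).symm.toLinearEquiv

lemma single_map_apply {M N : ModuleCat.{u} R} (f : M ⟶ N) (x : M) :
    (((HomologicalComplex.single (ModuleCat.{u} R) (ComplexShape.up ℤ) 0).map f).f 0).hom
      (singleEquiv M x) = singleEquiv N (f.hom x) := by
  rw [HomologicalComplex.single_map_f_self (ComplexShape.up ℤ) 0 f]
  exact congrArg (singleEquiv N) (congrArg f.hom ((singleEquiv M).symm_apply_apply x))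

lemma singleEquiv_smul_one (r : R) : singleEquiv (ModuleCat.of R R) r =
    r • singleEquiv (ModuleCat.of R R) (1 : R) := by
  rw [← map_smul]
  congr 1
  exact (mul_one r).symm

/-- Evaluation at `x ∈ N`, as a morphism `Hom(N, Y) ⟶ Y`. -/
noncomputable def evalSingle {N : ModuleCat.{u} R} (x : N)
    (Y : CochainComplex (ModuleCat.{u} R) ℤ) : homComplex (single N) Y ⟶ Y where
  f n := ModuleCat.ofHom
    { toFun := fun φ : Cochain (single N) Y n => (φ.v 0 n (zero_add n)).hom (singleEquiv N x)
      map_add' := fun _ _ => rfl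
      map_smul' := fun _ _ => rfl }
  comm' n m hnm := by
    change n + 1 = m at hnm
    ext (φ : Cochain (single N) Y n)
    change (Y.d n m).hom ((φ.v 0 n (zero_add n)).hom (singleEquiv N x)) =
      ((δ n m φ).v 0 m (zero_add m)).hom (singleEquiv N x)
    rw [δ_v n m hnm φ 0 m (zero_add m) n 1 (by lia) rfl]
    have h : (single N).d 0 1 = 0 := HomologicalComplex.single_obj_d _ _ _ _ _
    rw [h, zero_comp, smul_zero, add_zero]
    rfl

/-- The cochain on `N` in degree `0` given by a linear map. -/
noncomputable def singleCochain {N : ModuleCat.{u} R} {Y : CochainComplex (ModuleCat.{u} R) ℤ}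
    {n : ℤ} (f : N →ₗ[R] Y.X n) : Cochain (single N) Y n :=
  Cochain.single (ModuleCat.ofHom (f ∘ₗ (singleEquiv N).symm.toLinearMap)) n

lemma singleCochain_v_apply {N : ModuleCat.{u} R} {Y : CochainComplex (ModuleCat.{u} R) ℤ}
    {n : ℤ} (f : N →ₗ[R] Y.X n) (x : N) :
    ((singleCochain f).v 0 n (zero_add n)).hom (singleEquiv N x) = f x := by
  rw [singleCochain, Cochain.single_v]
  exact congrArg f ((singleEquiv N).symm_apply_apply x)

lemma single_cochain_ext {N : ModuleCat.{u} R} {Y : CochainComplex (ModuleCat.{u} R) ℤ}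
    {n : ℤ} {φ ψ : Cochain (single N) Y n}
    (h : ∀ x : N, (φ.v 0 n (zero_add n)).hom (singleEquiv N x) =
      (ψ.v 0 n (zero_add n)).hom (singleEquiv N x)) : φ = ψ := by
  ext p q hpq : 1
  by_cases hp : p = 0
  · subst hp
    obtain rfl : n = q := by lia
    refine ModuleCat.hom_ext (LinearMap.ext fun y => ?_)
    obtain ⟨x, rfl⟩ := (singleEquiv N).surjective y
    exact h x
  · exact (isZero_single_X hp).eq_of_src _ _

instance isIso_evalSingle_one (Y : CochainComplex (ModuleCat.{u} R) ℤ) :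
    IsIso (evalSingle (N := ModuleCat.of R R) (1 : R) Y) := by
  have : ∀ n, IsIso ((evalSingle (N := ModuleCat.of R R) (1 : R) Y).f n) := by
    intro n
    rw [ConcreteCategory.isIso_iff_bijective]
    constructor
    · intro (φ : Cochain _ Y n) (ψ : Cochain _ Y n) h
      change (φ.v 0 n (zero_add n)).hom (singleEquiv _ _) =
        (ψ.v 0 n (zero_add n)).hom (singleEquiv _ _) at h
      refine single_cochain_ext fun (r : R) => ?_
      rw [singleEquiv_smul_one, map_smul, map_smul, h]
    · intro y
      refine ⟨singleCochain (LinearMap.toSpanSingleton R (Y.X n) y), ?_⟩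
      exact (singleCochain_v_apply (N := ModuleCat.of R R) _ (1 : R)).trans (one_smul R y)
  exact HomologicalComplex.Hom.isIso_of_components _

lemma homothety_apply (Y : CochainComplex (ModuleCat.{u} R) ℤ) (r : R) :
    ((homothety Y).f 0).hom (singleEquiv (ModuleCat.of R R) r) =
      (r • Cochain.ofHom (𝟙 Y) : Cochain Y Y 0) := by
  refine (LinearMap.congr_fun (congrArg ModuleCat.Hom.hom
    (HomologicalComplex.mkHomFromSingle_f (K := homComplex Y Y) _ _)) _).trans ?_
  exact congrArg (fun r : R => (r • Cochain.ofHom (𝟙 Y) : Cochain Y Y 0))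
    ((singleEquiv (ModuleCat.of R R)).symm_apply_apply r)

/-- Under `Hom(R, Y) ≅ Y`, biduality for `R` becomes the homothety map; the dualizing hypothesis
enters biduality here. -/
lemma bidual_single_ring (Y : CochainComplex (ModuleCat.{u} R) ℤ) :
    bidual (single (ModuleCat.of R R)) Y =
      homothety Y ≫ precomp (evalSingle (N := ModuleCat.of R R) (1 : R) Y) Y := by
  refine HomologicalComplex.from_single_hom_ext (ModuleCat.hom_ext (LinearMap.ext fun y => ?_))
  obtain ⟨(r : R), rfl⟩ := (singleEquiv (ModuleCat.of R R)).surjective y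
  refine evalCochain_ext fun p q hpq φ => ?_
  obtain rfl : p = q := by lia
  have h : ((homothety Y ≫ precomp (evalSingle (N := ModuleCat.of R R) (1 : R) Y) Y).f 0).hom
      (singleEquiv (ModuleCat.of R R) r) = (Cochain.ofHom (evalSingle (N := ModuleCat.of R R)
        (1 : R) Y)).comp (r • Cochain.ofHom (𝟙 Y)) (zero_add 0) :=
    congrArg ((precomp (evalSingle (N := ModuleCat.of R R) (1 : R) Y) Y).f 0).hom
      (homothety_apply Y r)
  rw [h, Cochain.zero_cochain_comp_v, Cochain.ofHom_v, Cochain.smul_v, Cochain.ofHom_v]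
  change ((evalCochain 0 (singleEquiv (ModuleCat.of R R) r)).v p p hpq).hom φ =
    r • (φ.v 0 p (zero_add p)).hom (singleEquiv _ _)
  rw [evalCochain_v_apply, zero_mul, Int.negOnePow_zero, Units.val_one, one_smul,
    singleEquiv_smul_one, map_smul]

lemma isThick_bidual (hI : IsDualizingModel I) : IsThick fun X => QuasiIso (bidual X I) where
  iff_of_quasiIso {X Y} f _ := by
    have := hI.isKInjective
    rw [← quasiIso_iff_comp_right (bidual X I) (precomp (precomp f I) I), bidual_naturality,
      quasiIso_iff_comp_left]
  of_acyclic X hX := by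
    have := hI.isKInjective
    exact quasiIso_of_acyclic _ hX (isZero_homology_homComplex (isZero_homology_homComplex hX))
  middle S hS h₁ h₃ := quasiIso_τ₂_of_shortExact hS
    (shortExact_homShortComplex (shortExact_homShortComplex hS hI.injective) hI.injective)
    ⟨bidual _ I, bidual _ I, bidual _ I, bidual_naturality _ I, bidual_naturality _ I⟩ h₁ h₃
  left S hS h₂ h₃ := quasiIso_τ₁_of_shortExact hS
    (shortExact_homShortComplex (shortExact_homShortComplex hS hI.injective) hI.injective)
    ⟨bidual _ I, bidual _ I, bidual _ I, bidual_naturality _ I, bidual_naturality _ I⟩ h₂ h₃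
  right S hS h₁ h₂ := quasiIso_τ₃_of_shortExact hS
    (shortExact_homShortComplex (shortExact_homShortComplex hS hI.injective) hI.injective)
    ⟨bidual _ I, bidual _ I, bidual _ I, bidual_naturality _ I, bidual_naturality _ I⟩ h₁ h₂

lemma quasiIso_bidual_single_fin (hI : IsDualizingModel I) (n : ℕ) :
    QuasiIso (bidual (single (ModuleCat.of R (Fin n → R))) I) := by
  refine (isThick_bidual hI).single_fin ?_ n
  have := hI.isKInjective
  have := hI.quasiIso_homothety
  rw [bidual_single_ring]
  infer_instance

/-- A finitely generated module over a noetherian ring as a quotient of `Rⁿ`. -/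
lemma exists_shortExact_fin [IsNoetherianRing R] (N : ModuleCat.{u} R) [Module.Finite R N] :
    ∃ (n : ℕ) (S : ShortComplex (ModuleCat.{u} R)), S.ShortExact ∧
      S.X₂ = ModuleCat.of R (Fin n → R) ∧ S.X₃ = N ∧ Module.Finite R S.X₁ := by
  obtain ⟨n, f, hf⟩ := Module.Finite.exists_fin' R N
  exact ⟨n, f.shortComplexKer, f.shortExact_shortComplexKer hf, rfl, rfl,
    inferInstanceAs (Module.Finite R (LinearMap.ker f))⟩

/-- Descending induction on `m = d + 2 - n`, over all modules at once so that it applies to the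
syzygy `K`. In the four lemma for `0 → K → Rʳ → N → 0`, surjectivity for `K` in degree `m + 1`
yields surjectivity for `N` in degree `m` and, with injectivity for `K` in degree `m + 2`,
injectivity for `N` in degree `m + 1`. Above degree `d` both sides vanish. -/
lemma homologyMap_bidual_single [IsNoetherianRing R] (hI : IsDualizingModel I) (n : ℕ) :
    ∀ (m : ℤ), m + n = dim R + 2 → ∀ (N : ModuleCat.{u} R) [Module.Finite R N],
      Epi (HomologicalComplex.homologyMap (bidual (single N) I) m) ∧
      ∀ i, m < i → IsIso (HomologicalComplex.homologyMap (bidual (single N) I) i) := by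
  induction n with
  | zero =>
    intro m hm N _
    have hz : ∀ i : ℤ, (dim R : ℤ) < i →
        IsZero ((homComplex (homComplex (single N) I) I).homology i) := by
      intro i hi
      refine isZero_homology_of_isZero_X (isZero_X_of_subsingleton_cochain fun p q hpq => ?_)
      by_cases hp : p < 0
      · exact Or.inl (hI.isZero_hom_single N p (Or.inl hp))
      · exact Or.inr (hI.isZero q (by lia))
    have hz' : ∀ i : ℤ, (dim R : ℤ) < i → IsZero ((single N).homology i) := fun i hi =>
      isZero_homology_singleAt _ _ (by lia) _
    refine ⟨⟨fun a b _ => (hz m (by lia)).eq_of_src _ _⟩, fun i hi => ?_⟩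
    exact ⟨0, (hz' i (by lia)).eq_of_src _ _, (hz i (by lia)).eq_of_src _ _⟩
  | succ n ih =>
    intro m hm N _
    obtain ⟨r, S, hS, h₂, rfl, h₁⟩ := exists_shortExact_fin N
    have hq : QuasiIso (bidual (single S.X₂) I) := by
      rw [h₂]
      exact quasiIso_bidual_single_fin hI r
    have ih' := ih (m + 1) (by push_cast at hm; lia)
    obtain ⟨e₁, i₁⟩ := ih' S.X₁
    obtain ⟨e₃, i₃⟩ := ih' S.X₃
    have hsS := shortExact_single hS
    have hsT := shortExact_homShortComplex (shortExact_homShortComplex hsS hI.injective)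
      hI.injective
    let φ : S.map (HomologicalComplex.single (ModuleCat.{u} R) (ComplexShape.up ℤ) 0) ⟶
        homShortComplex (homShortComplex _ I) I :=
      ⟨bidual _ I, bidual _ I, bidual _ I, bidual_naturality _ I, bidual_naturality _ I⟩
    have hφ : ∀ i, IsIso (HomologicalComplex.homologyMap φ.τ₂ i) := fun i => by
      change IsIso (HomologicalComplex.homologyMap (bidual (single S.X₂) I) i)
      infer_instance
    constructor
    · refine HomologicalComplex.HomologySequence.epi_homologyMap_τ₃ φ hsS hsT m ?_ ?_ ?_
      · infer_instance
      · rintro j rfl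
        exact e₁
      · intro j _
        infer_instance
    · intro i hi
      obtain hi | rfl := (show m + 1 ≤ i by lia).lt_or_eq
      · exact i₃ i hi
      · have : Mono (HomologicalComplex.homologyMap (bidual (single S.X₃) I) (m + 1)) := by
          refine HomologicalComplex.HomologySequence.mono_homologyMap_τ₃ φ hsS hsT (m + 1) ?_ ?_ ?_
          · exact e₁
          · infer_instance
          · rintro j rfl
            have := i₁ (m + 1 + 1) (by lia)
            change Mono (HomologicalComplex.homologyMap (bidual (single S.X₁) I) (m + 1 + 1))
            infer_instance
        exact isIso_of_mono_of_epi _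

theorem quasiIso_bidual_single [IsNoetherianRing R] (hI : IsDualizingModel I)
    (N : ModuleCat.{u} R) [Module.Finite R N] : QuasiIso (bidual (single N) I) := by
  rw [quasiIso_iff]
  intro i
  rw [quasiIsoAt_iff_isIso_homologyMap]
  -- The bound `min (i - 1) (d + 2)` lies below `i` and keeps `n` nonnegative.
  exact (homologyMap_bidual_single hI ((dim R : ℤ) + 2 - min (i - 1) (dim R + 2)).toNat
    (min (i - 1) (dim R + 2)) (by lia) N).2 i (by lia)

end Model

/-! ### Serre classes and finiteness of the dual -/

section Serre

variable {R : Type u} [CommRing R]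

/-- Classes of modules containing zero and closed under taking the middle term of an exact
sequence. -/
structure IsSerre (P : ModuleCat.{u} R → Prop) : Prop where
  of_isZero : ∀ {N : ModuleCat.{u} R}, IsZero N → P N
  middle : ∀ {S : ShortComplex (ModuleCat.{u} R)}, S.Exact → P S.X₁ → P S.X₃ → P S.X₂

lemma IsSerre.of_iso {P : ModuleCat.{u} R → Prop} (hP : IsSerre P) {M N : ModuleCat.{u} R}
    (e : M ≅ N) (hM : P M) : P N := by
  let S : ShortComplex (ModuleCat.{u} R) := ShortComplex.mk e.hom (0 : N ⟶ N) comp_zero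
  have hS : S.Exact := by
    rw [S.exact_iff_epi rfl]
    exact inferInstanceAs (Epi e.hom)
  have h0 : P (ModuleCat.of R PUnit) := hP.of_isZero (ModuleCat.isZero_of_subsingleton _)
  let S' : ShortComplex (ModuleCat.{u} R) := ShortComplex.mk e.hom
    (0 : N ⟶ ModuleCat.of R PUnit) comp_zero
  have hS' : S'.Exact := by
    rw [S'.exact_iff_epi rfl]
    exact inferInstanceAs (Epi e.hom)
  exact hP.middle hS' hM h0

lemma IsSerre.isThick {P : ModuleCat.{u} R → Prop} (hP : IsSerre P) :
    IsThick fun X : CochainComplex (ModuleCat.{u} R) ℤ => ∀ i, P (X.homology i) where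
  iff_of_quasiIso f _ := by
    refine forall_congr' fun i => ?_
    have e := asIso (HomologicalComplex.homologyMap f i)
    exact ⟨fun h => hP.of_iso e h, fun h => hP.of_iso e.symm h⟩
  of_acyclic X hX i := hP.of_isZero (hX i)
  middle S hS h₁ h₃ i := hP.middle (hS.homology_exact₂ i) (h₁ i) (h₃ i)
  left S hS h₂ h₃ i := hP.middle (hS.homology_exact₁ (i - 1) i (by simp)) (h₃ (i - 1)) (h₂ i)
  right S hS h₁ h₂ i := hP.middle (hS.homology_exact₃ i (i + 1) rfl) (h₂ i) (h₁ (i + 1))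

lemma isThick_bounded : IsThick fun X : CochainComplex (ModuleCat.{u} R) ℤ =>
    ∃ a b : ℤ, ∀ i : ℤ, i < a ∨ b < i → IsZero (X.homology i) where
  iff_of_quasiIso f _ := by
    refine exists_congr fun a => exists_congr fun b => forall₂_congr fun i _ => ?_
    exact (asIso (HomologicalComplex.homologyMap f i)).isZero_iff
  of_acyclic X hX := ⟨0, 0, fun i _ => hX i⟩
  middle S hS := by
    rintro ⟨a, b, h₁⟩ ⟨a', b', h₃⟩
    exact ⟨min a a', max b b', fun i hi => (hS.homology_exact₂ i).isZero_of_both_zeros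
      ((h₁ i (by lia)).eq_of_src _ _) ((h₃ i (by lia)).eq_of_tgt _ _)⟩
  left S hS := by
    rintro ⟨a, b, h₁⟩ ⟨a', b', h₃⟩
    exact ⟨min a (a' + 1), max b (b' + 1), fun i hi =>
      (hS.homology_exact₁ (i - 1) i (by simp)).isZero_of_both_zeros
      ((h₃ (i - 1) (by lia)).eq_of_src _ _) ((h₁ i (by lia)).eq_of_tgt _ _)⟩
  right S hS := by
    rintro ⟨a, b, h₁⟩ ⟨a', b', h₃⟩
    exact ⟨min (a - 1) a', max (b - 1) b', fun i hi =>
      (hS.homology_exact₃ i (i + 1) rfl).isZero_of_both_zeros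
      ((h₃ i (by lia)).eq_of_src _ _) ((h₁ (i + 1) (by lia)).eq_of_tgt _ _)⟩

lemma IsThick.and {W W' : CochainComplex (ModuleCat.{u} R) ℤ → Prop} (hW : IsThick W)
    (hW' : IsThick W') : IsThick fun X => W X ∧ W' X where
  iff_of_quasiIso f hf := and_congr (hW.iff_of_quasiIso f hf) (hW'.iff_of_quasiIso f hf)
  of_acyclic X hX := ⟨hW.of_acyclic X hX, hW'.of_acyclic X hX⟩
  middle S hS h₁ h₃ := ⟨hW.middle S hS h₁.1 h₃.1, hW'.middle S hS h₁.2 h₃.2⟩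
  left S hS h₁ h₃ := ⟨hW.left S hS h₁.1 h₃.1, hW'.left S hS h₁.2 h₃.2⟩
  right S hS h₁ h₃ := ⟨hW.right S hS h₁.1 h₃.1, hW'.right S hS h₁.2 h₃.2⟩

lemma IsThick.homComplex {W : CochainComplex (ModuleCat.{u} R) ℤ → Prop} (hW : IsThick W)
    {Y : CochainComplex (ModuleCat.{u} R) ℤ} [Y.IsKInjective] (hY : ∀ i, Injective (Y.X i)) :
    IsThick fun X => W (homComplex X Y) where
  iff_of_quasiIso f _ := (hW.iff_of_quasiIso (precomp f Y) inferInstance).symm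
  of_acyclic _ hX := hW.of_acyclic _ (isZero_homology_homComplex hX)
  middle _ hS h₁ h₃ := hW.middle _ (shortExact_homShortComplex hS hY) h₃ h₁
  left _ hS h₂ h₃ := hW.right _ (shortExact_homShortComplex hS hY) h₃ h₂
  right _ hS h₁ h₂ := hW.left _ (shortExact_homShortComplex hS hY) h₂ h₁

lemma isSerre_finite [IsNoetherianRing R] :
    IsSerre fun N : ModuleCat.{u} R => Module.Finite R N where
  of_isZero hN := by
    have := ModuleCat.subsingleton_of_isZero hN
    infer_instance
  middle {S} hS _ _ := by
    rw [ShortComplex.moduleCat_exact_iff_range_eq_ker] at hS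
    have := isNoetherian_of_range_eq_ker S.f.hom S.g.hom hS
    infer_instance

/-- The property of being annihilated by a power of `s`. -/
def PowKills (s : R) (N : ModuleCat.{u} R) : Prop := ∃ n : ℕ, ∀ x : N, s ^ n • x = 0

lemma isSerre_powKills (s : R) : IsSerre (PowKills s) where
  of_isZero {N} hN := by
    have := ModuleCat.subsingleton_of_isZero hN
    exact ⟨0, fun x => Subsingleton.elim _ _⟩
  middle {S} hS := by
    rintro ⟨n, hn⟩ ⟨m, hm⟩
    rw [ShortComplex.moduleCat_exact_iff] at hS
    refine ⟨n + m, fun x => ?_⟩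
    obtain ⟨y, hy⟩ := hS (s ^ m • x) (by rw [map_smul, hm])
    rw [pow_add, mul_smul, ← hy, ← map_smul, hn, map_zero]

end Serre

section Finiteness

variable {R : Type u} [CommRing R]

/-- Complexes with bounded and finitely generated cohomology. -/
def HasFiniteCohomology (X : CochainComplex (ModuleCat.{u} R) ℤ) : Prop :=
  (∃ a b : ℤ, ∀ i : ℤ, i < a ∨ b < i → IsZero (X.homology i)) ∧
    ∀ i, Module.Finite R (X.homology i)

lemma isThick_hasFiniteCohomology [IsNoetherianRing R] :
    IsThick (HasFiniteCohomology (R := R)) :=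
  isThick_bounded.and isSerre_finite.isThick

lemma hasFiniteCohomology_iff (X : CochainComplex (ModuleCat.{u} R) ℤ) :
    HasFiniteCohomology X ↔ FinitelyGeneratedCohomology X := by
  classical
  constructor
  · rintro ⟨⟨a, b, hab⟩, hX⟩
    let f : (∀ i : Finset.Icc a b, X.homology i) →ₗ[R] DirectSum ℤ fun i => X.homology i :=
      ∑ i : Finset.Icc a b, DirectSum.lof R ℤ (fun i => X.homology i) i ∘ₗ LinearMap.proj i
    refine Module.Finite.of_surjective f fun x => ⟨fun i => x i, ?_⟩
    have h : ∀ i, i ∉ Finset.Icc a b → x i = 0 := fun i hi => by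
      have := ModuleCat.subsingleton_of_isZero (hab i (by simp at hi; lia))
      exact Subsingleton.elim _ _
    ext i : 1
    simp only [f, LinearMap.sum_apply, LinearMap.comp_apply, LinearMap.proj_apply]
    rw [DirectSum.sum_apply]
    by_cases hi : i ∈ Finset.Icc a b
    · rw [Finset.sum_eq_single ⟨i, hi⟩ ?_ (fun h => (h (Finset.mem_univ _)).elim)]
      · exact DirectSum.of_eq_same _ _
      · intro j _ hj
        exact DirectSum.of_eq_of_ne _ _ _ (fun h => hj (Subtype.ext h.symm))
    · rw [h i hi]
      refine Finset.sum_eq_zero fun j _ => DirectSum.of_eq_of_ne _ _ _ ?_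
      rintro rfl
      exact hi j.2
  · intro (hX : Module.Finite R _)
    refine ⟨?_, fun i => Module.Finite.of_surjective
      (DirectSum.component R ℤ (fun i => X.homology i) i)
      (fun x => ⟨DirectSum.lof R ℤ _ i x, DirectSum.component.lof_self _ _ _⟩)⟩
    obtain ⟨s, hs⟩ := hX.fg_top
    let T : Finset ℤ := s.biUnion fun x => DFinsupp.support x
    have hT : ∀ i, i ∉ T → IsZero (X.homology i) := by
      intro i hi
      rw [ModuleCat.isZero_iff_subsingleton]
      refine subsingleton_of_forall_eq 0 fun y => ?_
      have hle : (⊤ : Submodule R (DirectSum ℤ fun i => X.homology i)) ≤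
          LinearMap.ker (DirectSum.component R ℤ (fun i => X.homology i) i) := by
        rw [← hs, Submodule.span_le]
        intro x hx
        by_contra hx'
        exact hi (Finset.mem_biUnion.2 ⟨x, hx, DFinsupp.mem_support_iff.2 hx'⟩)
      have := hle (Submodule.mem_top (x := DirectSum.lof R ℤ (fun i => X.homology i) i y))
      rwa [LinearMap.mem_ker, DirectSum.component.lof_self] at this
    obtain ⟨a, ha⟩ := T.bddBelow
    obtain ⟨b, hb⟩ := T.bddAbove
    refine ⟨a, b, fun i hi => hT i fun hiT => ?_⟩
    have h₁ := ha hiT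
    have h₂ := hb hiT
    lia

variable {I : CochainComplex (ModuleCat.{u} R) ℤ}

theorem quasiIso_bidual [IsNoetherianRing R] (hI : IsDualizingModel I)
    (X : CochainComplex (ModuleCat.{u} R) ℤ) (hX : HasFiniteCohomology X) :
    QuasiIso (bidual X I) :=
  (isThick_bidual hI).devissage (Good := fun N => Module.Finite R N)
    (fun e h => isSerre_finite.of_iso e h) (fun N _ => quasiIso_bidual_single hI N)
    X hX.1 hX.2

/-- Ascending induction, starting in degree `-1`, where the dual vanishes. For `0 → K → Rʳ → N → 0`,
the group for `N` in degree `n` sits between the one for `K` in degree `n - 1` and the one for `Rʳ`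
in degree `n`. -/
lemma finite_homology_homComplex_single [IsNoetherianRing R] (hI : IsDualizingModel I)
    (hfg : ∀ i, Module.Finite R (I.homology i)) (n : ℕ) :
    ∀ (N : ModuleCat.{u} R) [Module.Finite R N],
      Module.Finite R ((homComplex (single N) I).homology (n - 1)) := by
  have := hI.isKInjective
  induction n with
  | zero =>
    intro N _
    exact isSerre_finite.of_isZero (isZero_homology_of_isZero_X
      (hI.isZero_hom_single N _ (Or.inl (by simp))))
  | succ n ih =>
    intro N _
    obtain ⟨r, S, hS, h₂, rfl, h₁⟩ := exists_shortExact_fin N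
    refine isSerre_finite.middle ((shortExact_homShortComplex (shortExact_single hS)
      hI.injective).homology_exact₁ ((n : ℤ) - 1) _ (by push_cast; simp)) (ih S.X₁) ?_
    have hthick := (isSerre_finite (R := R)).isThick.homComplex hI.injective
    refine (?_ : ∀ i, Module.Finite R ((homComplex (single S.X₂) I).homology i)) _
    rw [h₂]
    refine hthick.single_fin (fun i => ?_) r
    exact isSerre_finite.of_iso (asIso (HomologicalComplex.homologyMap
      (evalSingle (N := ModuleCat.of R R) (1 : R) I) i)).symm (hfg i)

lemma hasFiniteCohomology_homComplex_single [IsNoetherianRing R] (hI : IsDualizingModel I)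
    (hfg : ∀ i, Module.Finite R (I.homology i)) (N : ModuleCat.{u} R) [Module.Finite R N] :
    HasFiniteCohomology (homComplex (single N) I) := by
  have hz : ∀ i : ℤ, i < 0 ∨ (dim R : ℤ) < i → IsZero ((homComplex (single N) I).homology i) :=
    fun i hi => isZero_homology_of_isZero_X (hI.isZero_hom_single N i hi)
  refine ⟨⟨0, dim R, hz⟩, fun i => ?_⟩
  by_cases hi : i < 0
  · exact isSerre_finite.of_isZero (hz i (Or.inl hi))
  · have h := finite_homology_homComplex_single hI hfg (i + 1).toNat N
    rwa [Int.toNat_of_nonneg (by lia), add_sub_cancel_right] at h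

theorem hasFiniteCohomology_homComplex [IsNoetherianRing R] (hI : IsDualizingModel I)
    (hfg : ∀ i, Module.Finite R (I.homology i)) (X : CochainComplex (ModuleCat.{u} R) ℤ)
    (hX : HasFiniteCohomology X) : HasFiniteCohomology (homComplex X I) := by
  have := hI.isKInjective
  exact (isThick_hasFiniteCohomology.homComplex hI.injective).devissage
    (Good := fun N => Module.Finite R N) (fun e h => isSerre_finite.of_iso e h)
    (fun N _ => hasFiniteCohomology_homComplex_single hI hfg N) X hX.1 hX.2

end Finiteness

/-! ### The cohomology of `RHom(k, D)` lies in a single degree -/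

section ResidueField

variable {R : Type u} [CommRing R] [IsLocalRing R] {V : Type u} [AddCommGroup V] [Module R V]

open IsLocalRing

/-- The linear map from the residue field determined by an element of the socle. -/
noncomputable def residueFieldLift (y : V) (hy : ∀ r ∈ maximalIdeal R, r • y = 0) :
    ResidueField R →ₗ[R] V :=
  Submodule.liftQ (maximalIdeal R) (LinearMap.toSpanSingleton R V y) hy

lemma residueFieldLift_one (y : V) (hy : ∀ r ∈ maximalIdeal R, r • y = 0) :
    residueFieldLift y hy 1 = y :=
  one_smul R y

lemma residueField_smul_eq_zero {r : R} (hr : r ∈ maximalIdeal R) (x : ResidueField R) :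
    r • x = 0 := by
  rw [Algebra.smul_def, ResidueField.algebraMap_eq, (residue_eq_zero_iff r).2 hr, zero_mul]

lemma residueField_exists_smul_one (x : ResidueField R) : ∃ r : R, x = r • 1 := by
  obtain ⟨r, rfl⟩ := residue_surjective x
  exact ⟨r, by rw [Algebra.smul_def, ResidueField.algebraMap_eq, mul_one]⟩

lemma residueField_linearMap_ext {f g : ResidueField R →ₗ[R] V} (h : f 1 = g 1) : f = g := by
  ext x
  obtain ⟨r, rfl⟩ := residueField_exists_smul_one x
  rw [map_smul, map_smul, h]

/-- `V` is a vector space over `k`, so the line spanned by `v` splits off. -/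
lemma exists_linearMap_residueField (hV : ∀ r ∈ maximalIdeal R, ∀ v : V, r • v = 0)
    {v : V} (hv : v ≠ 0) : ∃ f : V →ₗ[R] ResidueField R, f v = 1 := by
  have htors : Module.IsTorsionBySet R V (maximalIdeal R) := fun x r => hV r r.2 x
  let : Module (ResidueField R) V := htors.module
  have : IsScalarTower R (ResidueField R) V := htors.isScalarTower
  obtain ⟨g, hg⟩ := LinearMap.exists_leftInverse_of_injective
    (LinearMap.toSpanSingleton (ResidueField R) V v)
    (LinearMap.ker_toSpanSingleton (ResidueField R) hv)
  refine ⟨g.restrictScalars R, ?_⟩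
  have := LinearMap.congr_fun hg 1
  rwa [LinearMap.comp_apply, LinearMap.toSpanSingleton_apply, one_smul] at this

end ResidueField

section Socle

variable {R : Type u} [CommRing R] [IsLocalRing R]

open IsLocalRing CochainComplex.HomComplex

variable {Y : CochainComplex (ModuleCat.{u} R) ℤ}

lemma smul_residueField_cochain {r : R} (hr : r ∈ maximalIdeal R) {n : ℤ}
    (φ : Cochain (single (residueField R)) Y n) : r • φ = 0 := by
  refine single_cochain_ext fun x => ?_
  change r • (φ.v 0 n (zero_add n)).hom (singleEquiv _ x) = 0
  rw [← map_smul, ← map_smul, residueField_smul_eq_zero hr, map_zero, map_zero]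

/-- With `exists_evalSingle_one_eq` and `smul_evalSingle_one`, this identifies `Hom(k, Y)` with the
socle of `Y`, the subcomplex of elements killed by `𝔪`. -/
lemma evalSingle_one_injective {n : ℤ} {φ ψ : Cochain (single (residueField R)) Y n}
    (h : ((evalSingle (N := residueField R) (1 : ResidueField R) Y).f n).hom φ =
      ((evalSingle (N := residueField R) (1 : ResidueField R) Y).f n).hom ψ) : φ = ψ := by
  refine single_cochain_ext fun x => ?_
  obtain ⟨r, rfl⟩ := residueField_exists_smul_one x
  rw [map_smul, map_smul, map_smul]
  exact congrArg (r • ·) h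

lemma exists_evalSingle_one_eq {n : ℤ} (y : Y.X n) (hy : ∀ r ∈ maximalIdeal R, r • y = 0) :
    ∃ φ : Cochain (single (residueField R)) Y n,
      ((evalSingle (N := residueField R) (1 : ResidueField R) Y).f n).hom φ = y :=
  ⟨singleCochain (N := residueField R) (residueFieldLift y hy),
    (singleCochain_v_apply (N := residueField R) _ (1 : ResidueField R)).trans
      (residueFieldLift_one y hy)⟩

lemma smul_evalSingle_one {r : R} (hr : r ∈ maximalIdeal R) {n : ℤ}
    (φ : Cochain (single (residueField R)) Y n) :
    r • ((evalSingle (N := residueField R) (1 : ResidueField R) Y).f n).hom φ = 0 := by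
  change r • (φ.v 0 n (zero_add n)).hom (singleEquiv _ _) = 0
  rw [← map_smul, ← map_smul, residueField_smul_eq_zero hr, map_zero, map_zero]

variable {I : CochainComplex (ModuleCat.{u} R) ℤ} [IsNoetherianRing R]

/-- Up to homotopy, every morphism `Hom(k, I) ⟶ I` is a multiple of the evaluation at `1`. -/
lemma exists_homotopic_smul_evalSingle (hI : IsDualizingModel I)
    (g : Cochain (homComplex (single (residueField R)) I) I 0) (hg : δ 0 1 g = 0) :
    ∃ r : R, ∀ (m n : ℤ) (_ : m + 1 = n) (z : Cochain (single (residueField R)) I n),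
      δ n (n + 1) z = 0 → ∃ w : Cochain (single (residueField R)) I m,
        (g.v n n (add_zero n)).hom z =
          ((evalSingle (N := residueField R) (1 : ResidueField R) I).f n).hom
            (r • z + δ m n w) := by
  have hq : QuasiIso (bidual (single (residueField R)) I) := quasiIso_bidual_single hI _
  -- By biduality for `k`, the class of `g` is evaluation at some `x ∈ k`, up to a coboundary `δ h`.
  obtain ⟨x, -, (h : Cochain (homComplex (single (residueField R)) I) I (-1)), hh⟩ :=
    (homologyMap_surjective_iff (bidual (single (residueField R)) I)
      (-1) 0 1 rfl rfl).1 ((quasiIso_iff_bijective _).1 hq 0).2 g hg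
  obtain ⟨x, rfl⟩ := (singleEquiv (residueField R)).surjective x
  obtain ⟨r, rfl⟩ := residueField_exists_smul_one x
  refine ⟨r, fun m n hmn z hz => ?_⟩
  -- As `Hom(k, I)` is killed by `𝔪`, `h z` lies in the socle of `I`, so it comes from some `w` in
  -- `Hom(k, I)`.
  have hy : ∀ s ∈ maximalIdeal R, s • (h.v n m (by lia)).hom z = 0 := fun s hs => by
    refine (LinearMap.map_smul (h.v n m (by lia)).hom s z).symm.trans ?_
    exact (congrArg (h.v n m (by lia)).hom (smul_residueField_cochain hs z)).trans (map_zero _)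
  obtain ⟨w, hw⟩ := exists_evalSingle_one_eq _ hy
  refine ⟨w, ?_⟩
  have h₁ : (δ (-1) 0 h).v n n (add_zero n) =
      g.v n n (add_zero n) - (evalCochain (Y := I) 0 (singleEquiv (residueField R)
        (r • (1 : ResidueField R)))).v n n (add_zero n) :=
    congrArg (fun a : Cochain (homComplex (single (residueField R)) I) I 0 =>
      a.v n n (add_zero n)) hh
  rw [δ_v (-1) 0 rfl h n n (add_zero n) m (n + 1) (by lia) rfl] at h₁
  have h₂ : (I.d m n).hom ((h.v n m (by lia)).hom z) +
      (Int.negOnePow 0 : ℤ) • (h.v (n + 1) n (by lia)).hom (δ n (n + 1) z) =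
      (g.v n n (add_zero n)).hom z - ((0 * n).negOnePow : ℤ) •
        (z.v 0 n (zero_add n)).hom (singleEquiv (residueField R) (r • (1 : ResidueField R))) :=
    LinearMap.congr_fun (congrArg ModuleCat.Hom.hom h₁) z
  have h₃ : (h.v (n + 1) n (by lia)).hom (δ n (n + 1) z) = 0 :=
    (congrArg (h.v (n + 1) n (by lia)).hom hz).trans (map_zero _)
  rw [h₃, smul_zero, add_zero, zero_mul, Int.negOnePow_zero, Units.val_one, one_smul, map_smul,
    map_smul, ← hw, eq_sub_iff_add_eq, add_comm] at h₂
  have h₄ := hom_comm_apply (evalSingle (N := residueField R) (1 : ResidueField R) I) m n w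
  rw [← h₂, h₄]
  exact (((evalSingle (N := residueField R) (1 : ResidueField R) I).f n).hom.map_add
    (r • z) (δ m n w)).symm

/-- Suppose `a` in degree `s` and `b` in degree `t` are cocycles that do not bound. A linear
functional separating `b` from boundaries yields a morphism `g : Hom(k, I) ⟶ I` that is zero in
degree `s` and agrees with evaluation on `b`. As `g` is homotopic to `r` times evaluation, `r a`
bounds, which forces `r ∈ 𝔪`. Then `r b = 0`, and `b = b - r b` bounds, a contradiction. -/
lemma isZero_homology_hom_residueField_or (hI : IsDualizingModel I) {s t : ℤ} (hst : s ≠ t) :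
    IsZero ((homComplex (single (residueField R)) I).homology s) ∨
      IsZero ((homComplex (single (residueField R)) I).homology t) := by
  by_contra! h
  rw [isZero_homology_iff _ (s - 1) s (s + 1) (by lia) rfl,
    isZero_homology_iff _ (t - 1) t (t + 1) (by lia) rfl] at h
  push Not at h
  obtain ⟨⟨(a : Cochain (single (residueField R)) I s), ha, ha'⟩,
    ⟨(b : Cochain (single (residueField R)) I t), hb, hb'⟩⟩ := h
  set K := homComplex (single (residueField R)) I with hK
  set B := LinearMap.range (K.d (t - 1) t).hom
  obtain ⟨l, hl⟩ := exists_linearMap_residueField (V := K.X t ⧸ B) (v := B.mkQ b)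
    (fun r hr v => by
      obtain ⟨(v : Cochain (single (residueField R)) I t), rfl⟩ := B.mkQ_surjective v
      refine (map_smul B.mkQ r v).symm.trans ?_
      exact (congrArg B.mkQ (smul_residueField_cochain hr v)).trans (map_zero _))
    (fun h => by
      obtain ⟨y, hy⟩ := (Submodule.Quotient.mk_eq_zero B).1 h
      exact hb' y hy)
  set y := ((evalSingle (N := residueField R) (1 : ResidueField R) I).f t).hom b with hy
  let ψ : K.X t →ₗ[R] I.X t := residueFieldLift y
    (fun r hr => smul_evalSingle_one (Y := I) hr b) ∘ₗ l ∘ₗ B.mkQ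
  have hψd : ∀ x : K.X (t - 1), ψ ((K.d (t - 1) t).hom x) = 0 := fun x => by
    have : B.mkQ ((K.d (t - 1) t).hom x) = 0 := (Submodule.Quotient.mk_eq_zero B).2 ⟨x, rfl⟩
    simp only [ψ, LinearMap.comp_apply]
    rw [this, map_zero, map_zero]
  have hψb : ψ b = y := by
    exact (congrArg (residueFieldLift y fun r hr => smul_evalSingle_one (Y := I) hr b) hl).trans
      (residueFieldLift_one y _)
  have hdy : (I.d t (t + 1)).hom y = 0 := by
    rw [hy]
    refine (hom_comm_apply (evalSingle (N := residueField R) (1 : ResidueField R) I) t (t + 1)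
      b).trans ?_
    exact (congrArg _ hb).trans (map_zero _)
  have hdψ : ∀ x, (I.d t (t + 1)).hom (ψ x) = 0 := fun x => by
    obtain ⟨r, hr⟩ := residueField_exists_smul_one (l (B.mkQ x))
    simp only [ψ, LinearMap.comp_apply]
    rw [hr, map_smul, residueFieldLift_one, map_smul, hdy, smul_zero]
  obtain ⟨Ψ, hΨ⟩ : ∃ Ψ : K.X t ⟶ I.X t, Ψ = ModuleCat.ofHom ψ := ⟨_, rfl⟩
  let g : Cochain K I 0 := Cochain.single Ψ 0
  have hg : δ 0 1 g = 0 := by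
    rw [Cochain.δ_single _ 0 1 rfl (t - 1) (t + 1) (by lia) rfl]
    have h₁ : Ψ ≫ I.d t (t + 1) = 0 := by
      rw [hΨ]
      exact ModuleCat.hom_ext (LinearMap.ext hdψ)
    have h₂ : K.d (t - 1) t ≫ Ψ = 0 := by
      rw [hΨ]
      exact ModuleCat.hom_ext (LinearMap.ext hψd)
    rw [h₁, h₂, Cochain.single_zero, Cochain.single_zero, smul_zero, add_zero]
  obtain ⟨r, hr⟩ := exists_homotopic_smul_evalSingle hI g hg
  obtain ⟨w, hw⟩ := hr (s - 1) s (by lia) a ha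
  obtain ⟨w', hw'⟩ := hr (t - 1) t (by lia) b hb
  have hgs : (g.v s s (add_zero s)).hom a = 0 := by
    rw [show g.v s s (add_zero s) = 0 from Cochain.single_v_eq_zero _ _ _ _ _ hst]
    rfl
  have hgt : (g.v t t (add_zero t)).hom b = y := by
    rw [show g.v t t (add_zero t) = ModuleCat.ofHom ψ from (Cochain.single_v _ _ _).trans hΨ]
    exact hψb
  have h₁ : (0 : Cochain (single (residueField R)) I s) = r • a + δ (s - 1) s w :=
    evalSingle_one_injective ((map_zero _).trans (hgs.symm.trans hw))
  have h₂ : b = r • b + δ (t - 1) t w' := evalSingle_one_injective (hgt.symm.trans hw')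
  have hrm : r ∈ maximalIdeal R := by
    rw [mem_maximalIdeal, mem_nonunits_iff]
    rintro ⟨v, rfl⟩
    refine ha' (-((↑v⁻¹ : R) • w)) ?_
    change δ (s - 1) s (-((↑v⁻¹ : R) • w)) = a
    rw [δ_neg, δ_smul, eq_neg_of_add_eq_zero_right h₁.symm, smul_neg, neg_neg, smul_smul,
      Units.inv_mul, one_smul]
  refine hb' w' ?_
  change δ (t - 1) t w' = b
  rw [smul_residueField_cochain hrm, zero_add] at h₂
  exact h₂.symm

/-- If the dual of `k` were acyclic, so would be its bidual, which is `k`. -/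
lemma exists_not_isZero_homology_hom_residueField (hI : IsDualizingModel I) :
    ∃ t : ℤ, ¬ IsZero ((homComplex (single (residueField R)) I).homology t) := by
  by_contra! h
  have := hI.isKInjective
  have hq : QuasiIso (bidual (single (residueField R)) I) := quasiIso_bidual_single hI _
  have h0 : IsZero ((single (residueField R)).homology 0) :=
    (isZero_homology_homComplex h 0).of_iso
      (asIso (HomologicalComplex.homologyMap (bidual (single (residueField R)) I) 0))
  have := ModuleCat.subsingleton_of_isZero
    (h0.of_iso (HomologicalComplex.singleObjHomologySelfIso _ _ _).symm)
  exact one_ne_zero (Subsingleton.elim (1 : ResidueField R) 0)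

end Socle

/-! ### Bass's lemma: the degree is the dimension -/

section Support

variable {R : Type u} [CommRing R]

/-- The vanishing of the localization at `p`, for finitely generated modules. -/
def KilledAway (p : Ideal R) (N : ModuleCat.{u} R) : Prop := ∃ s ∉ p, ∀ x : N, s • x = 0

lemma isSerre_killedAway (p : Ideal R) [hp : p.IsPrime] : IsSerre (KilledAway p) where
  of_isZero {N} hN := by
    have := ModuleCat.subsingleton_of_isZero hN
    exact ⟨1, fun h => hp.ne_top ((Ideal.eq_top_iff_one p).2 h), fun x => Subsingleton.elim _ _⟩
  middle {S} hS := by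
    rintro ⟨s, hs, hsx⟩ ⟨t, ht, htx⟩
    rw [ShortComplex.moduleCat_exact_iff] at hS
    refine ⟨s * t, fun h => (hp.mem_or_mem h).elim hs ht, fun x => ?_⟩
    obtain ⟨y, hy⟩ := hS (t • x) (by rw [map_smul, htx])
    rw [mul_smul, ← hy, ← map_smul, hsx, map_zero]

lemma smul_homology_eq_zero {K : CochainComplex (ModuleCat.{u} R) ℤ} {r : R} {i : ℤ}
    (h : ∀ x : K.X i, r • x = 0) (z : K.homology i) : r • z = 0 := by
  obtain ⟨x, rfl⟩ := hclass_surjective z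
  rw [← map_smul, show r • x = 0 from Subtype.ext (h x), map_zero]

lemma homologyMap_eq_smul {K : CochainComplex (ModuleCat.{u} R) ℤ} {f : K ⟶ K} {r : R} {i : ℤ}
    (h : ∀ x : K.X i, (f.f i).hom x = r • x) (z : K.homology i) :
    (HomologicalComplex.homologyMap f i).hom z = r • z := by
  obtain ⟨⟨x, hx⟩, rfl⟩ := hclass_surjective z
  rw [homologyMap_hclass f x hx (map_mem_ker f hx), ← map_smul]
  exact congrArg _ (Subtype.ext (h x))

lemma smul_homology_hom_single {Y : CochainComplex (ModuleCat.{u} R) ℤ} {N : ModuleCat.{u} R}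
    {r : R} (h : ∀ x : N, r • x = 0) (i : ℤ) (z : (homComplex (single N) Y).homology i) :
    r • z = 0 := by
  refine smul_homology_eq_zero (fun (φ : CochainComplex.HomComplex.Cochain _ _ i) => ?_) z
  refine single_cochain_ext fun x => ?_
  change r • (φ.v 0 i (zero_add i)).hom (singleEquiv N x) = 0
  rw [← map_smul, ← map_smul, h, map_zero, map_zero]

/-- Multiplication by `r` as an endomorphism of a module. -/
abbrev smulHom (N : ModuleCat.{u} R) (r : R) : N ⟶ N := ModuleCat.ofHom (LinearMap.lsmul R N r)

/-- The short exact sequence given by multiplication by a nonzerodivisor. -/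
def smulShortComplex (N : ModuleCat.{u} R) (r : R) : ShortComplex (ModuleCat.{u} R) :=
  ModuleCat.shortComplexOfCompEqZero (LinearMap.lsmul R N r)
    (LinearMap.range (LinearMap.lsmul R N r)).mkQ (LinearMap.range_mkQ_comp _)

lemma shortExact_smulShortComplex {N : ModuleCat.{u} R} {r : R}
    (h : ∀ x : N, r • x = 0 → x = 0) : (smulShortComplex N r).ShortExact := by
  apply ModuleCat.shortComplex_shortExact
  · exact LinearMap.exact_map_mkQ_range (LinearMap.lsmul R N r)
  · exact (injective_iff_map_eq_zero (LinearMap.lsmul R N r)).2 h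
  · exact Submodule.mkQ_surjective _

lemma precomp_smulHom_apply {Y : CochainComplex (ModuleCat.{u} R) ℤ} {N : ModuleCat.{u} R} (r : R)
    {i : ℤ} (φ : CochainComplex.HomComplex.Cochain (single N) Y i) :
    ((precomp ((HomologicalComplex.single _ (ComplexShape.up ℤ) 0).map (smulHom N r)) Y).f i).hom
      φ = r • φ := by
  refine single_cochain_ext (N := N) fun x => ?_
  change (((CochainComplex.HomComplex.Cochain.ofHom ((HomologicalComplex.single _ _ 0).map
    (smulHom N r))).comp φ (zero_add i)).v 0 i (zero_add i)).hom (singleEquiv N x) =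
      r • (φ.v 0 i (zero_add i)).hom (singleEquiv N x)
  rw [CochainComplex.HomComplex.Cochain.zero_cochain_comp_v,
    CochainComplex.HomComplex.Cochain.ofHom_v, ModuleCat.hom_comp, LinearMap.comp_apply,
    single_map_apply, ← map_smul, ← map_smul]
  rfl

/-- In the long exact sequence of `0 → N → N → N/rN → 0`, the kernel of the connecting map is the
image of multiplication by `r`. -/
lemma exact_smul_homology {I : CochainComplex (ModuleCat.{u} R) ℤ} (hI : ∀ i, Injective (I.X i))
    {N : ModuleCat.{u} R} {r : R} (h : ∀ x : N, r • x = 0 → x = 0) (i j : ℤ) (hij : i + 1 = j) :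
    ∃ δ : (homComplex (single N) I).homology i →ₗ[R]
      (homComplex (single (smulShortComplex N r).X₃) I).homology j,
      ∀ z, δ z = 0 → ∃ y, r • y = z := by
  have hS := (shortExact_homShortComplex (shortExact_single (shortExact_smulShortComplex h)) hI)
  refine ⟨(hS.δ i j hij).hom, fun z hz => ?_⟩
  obtain ⟨y, hy⟩ := (ShortComplex.moduleCat_exact_iff _).1 (hS.homology_exact₃ i j hij) z hz
  exact ⟨y, (homologyMap_eq_smul (precomp_smulHom_apply r) y).symm.trans hy⟩

/-- Determinant trick: `s` maps `N` into `xN`, so it satisfies on `N` a monic equation with lower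
coefficients in `(x)`. The value of that polynomial at `s` is a power of `s` modulo `x`, hence
outside `p`. -/
lemma exists_smul_eq_zero_of_smul_mem {N : Type u} [AddCommGroup N] [Module R N]
    [Module.Finite R N] {p : Ideal R} [p.IsPrime] {s x : R} (hs : s ∉ p) (hx : x ∈ p)
    (h : ∀ z : N, ∃ y, x • y = s • z) : ∃ r ∉ p, ∀ z : N, r • z = 0 := by
  obtain ⟨P, hP, -, hc, h0⟩ :=
    LinearMap.exists_monic_and_natDegree_eq_and_coeff_mem_pow_and_aeval_eq_zero R
      (algebraMap R (Module.End R N) s) (Ideal.span {x}) (by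
        rintro _ ⟨z, rfl⟩
        obtain ⟨y, hy⟩ := h z
        change s • z ∈ _
        rw [← hy]
        exact Submodule.smul_mem_smul (Ideal.mem_span_singleton_self x) trivial)
  have hle : Ideal.span {x} ≤ p := (Ideal.span_singleton_le_iff_mem p).2 hx
  refine ⟨P.eval s, fun hmem => ?_, fun z => ?_⟩
  · rw [Polynomial.eval_eq_sum_range, Finset.sum_range_succ, hP.coeff_natDegree, one_mul] at hmem
    refine hs (Ideal.IsPrime.mem_of_pow_mem ‹_› _ ((Submodule.add_mem_iff_right p ?_).1 hmem))
    refine Submodule.sum_mem p fun k hk => Ideal.mul_mem_right _ _ (hle ?_)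
    exact Ideal.pow_le_self (by have := Finset.mem_range.1 hk; lia) (hc k)
  · rw [Polynomial.aeval_algebraMap_apply] at h0
    exact LinearMap.congr_fun h0 z

end Support

section Dimension

variable {R : Type u} [CommRing R] [IsLocalRing R] [IsNoetherianRing R]
  {I : CochainComplex (ModuleCat.{u} R) ℤ}

open IsLocalRing

omit [IsNoetherianRing R] in
lemma subsingleton_of_forall_exists_smul {N : Type u} [AddCommGroup N] [Module R N]
    [Module.Finite R N] {x : R} (hx : x ∈ maximalIdeal R) (h : ∀ z : N, ∃ y, x • y = z) :
    Subsingleton N := by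
  obtain ⟨r, hr, hr'⟩ := exists_smul_eq_zero_of_smul_mem (N := N) (p := maximalIdeal R) (s := 1)
    (fun h1 => (Ideal.ne_top_iff_one _).1 (Ideal.IsPrime.ne_top inferInstance) h1) hx
    (fun z => by simpa using h z)
  obtain ⟨v, rfl⟩ : IsUnit r := by simpa using hr
  refine subsingleton_of_forall_eq 0 fun z => ?_
  have := congrArg (fun w : N => (↑v⁻¹ : R) • w) (hr' z)
  simpa [smul_smul] using this

/-- Descending induction on `i`, with prime filtrations inside. If `N = R/p` and `p ≠ 𝔪`, some `x ∈
𝔪 \ p` is regular on `N`. The group for `N/xN` vanishes in degree `i + 1`, so `x` acts surjectively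
on the one for `N` in degree `i`, and Nakayama's lemma applies. -/
lemma isZero_homology_hom_single_of_lt (hI : IsDualizingModel I)
    (hfg : ∀ i, Module.Finite R (I.homology i)) {t : ℤ}
    (ht : ∀ i, t < i → IsZero ((homComplex (single (residueField R)) I).homology i)) (n : ℕ) :
    ∀ i : ℤ, t < i → dim R + 1 ≤ i + n → ∀ (N : ModuleCat.{u} R) [Module.Finite R N],
      IsZero ((homComplex (single N) I).homology i) := by
  have := hI.isKInjective
  induction n with
  | zero =>
    intro i _ hi' N _
    exact isZero_homology_of_isZero_X (hI.isZero_hom_single N i (Or.inr (by lia)))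
  | succ n ih =>
    intro i hi hi' N hN
    have hiso : ∀ {M N : ModuleCat.{u} R}, (M ≅ N) →
        IsZero ((homComplex (single M) I).homology i) →
        IsZero ((homComplex (single N) I).homology i) := fun e h =>
      h.of_iso (asIso (HomologicalComplex.homologyMap (precomp
        ((HomologicalComplex.single _ (ComplexShape.up ℤ) 0).map e.hom) I) i))
    refine IsNoetherianRing.induction_on_isQuotientEquivQuotientPrime R hN
      (motive := fun N _ _ _ => IsZero ((homComplex (single (ModuleCat.of R N)) I).homology i))
      ?_ ?_ ?_
    · intro N _ _ _ _
      rw [ModuleCat.isZero_iff_subsingleton]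
      exact subsingleton_of_forall_eq 0 fun z => (one_smul R z).symm.trans
        (smul_homology_hom_single (fun x => Subsingleton.elim _ _) i z)
    · intro N _ _ _ p e
      refine hiso e.symm.toModuleIso ?_
      by_cases hp : p.1 = maximalIdeal R
      · rw [hp]
        exact ht i hi
      · obtain ⟨x, hx, hxp⟩ := SetLike.exists_of_lt
          (lt_of_le_of_ne (le_maximalIdeal p.2.ne_top) hp)
        have hx0 : ∀ y : R ⧸ p.1, x • y = 0 → y = 0 := by
          intro y hy
          obtain ⟨y, rfl⟩ := Ideal.Quotient.mk_surjective y
          rw [Algebra.smul_def, Ideal.Quotient.algebraMap_eq, ← map_mul,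
            Ideal.Quotient.eq_zero_iff_mem] at hy
          exact Ideal.Quotient.eq_zero_iff_mem.2 ((p.2.mem_or_mem hy).resolve_left hxp)
        obtain ⟨δ, hδ⟩ := exact_smul_homology hI.injective
          (N := ModuleCat.of R (R ⧸ p.1)) hx0 i (i + 1) rfl
        have hfin : Module.Finite R (smulShortComplex (ModuleCat.of R (R ⧸ p.1)) x).X₃ :=
          inferInstanceAs (Module.Finite R ((R ⧸ p.1) ⧸
            LinearMap.range (LinearMap.lsmul R (R ⧸ p.1) x)))
        have := ModuleCat.subsingleton_of_isZero (ih (i + 1) (by lia) (by push_cast at hi'; lia)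
          (smulShortComplex (ModuleCat.of R (R ⧸ p.1)) x).X₃)
        have := (hasFiniteCohomology_homComplex_single hI hfg (ModuleCat.of R (R ⧸ p.1))).2 i
        rw [ModuleCat.isZero_iff_subsingleton]
        exact subsingleton_of_forall_exists_smul hx fun z => hδ z (Subsingleton.elim _ _)
    · intro N₁ _ _ _ N₂ _ _ _ N₃ _ _ _ f g hf hg hfg h₁ h₃
      let S : ShortComplex (ModuleCat.{u} R) := ModuleCat.shortComplexOfCompEqZero f g
        hfg.linearMap_comp_eq_zero
      have hS : S.ShortExact := ModuleCat.shortComplex_shortExact _ hfg hf hg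
      exact ((shortExact_homShortComplex (shortExact_single hS) hI.injective).homology_exact₂
        i).isZero_of_both_zeros (h₃.eq_of_src _ _) (h₁.eq_of_tgt _ _)

/-- Each step up a chain of primes raises the degree. If `Ext^i(N, I)` is nonzero at `p` and `x ∈ q
\ p` for a prime `q` above `p`, then `Ext^{i+1}(N'/xN', I)` is nonzero at `q`, where `N'` is `N`
modulo `x`-power torsion. Everything vanishes above `t`. -/
lemma add_le_of_not_killedAway (hI : IsDualizingModel I)
    (hfg : ∀ i, Module.Finite R (I.homology i)) {t : ℤ}
    (ht : ∀ i, t < i → IsZero ((homComplex (single (residueField R)) I).homology i)) (n : ℕ) :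
    ∀ (p : PrimeSpectrum R), n ≤ Order.coheight p → ∀ (i : ℤ) (N : ModuleCat.{u} R)
      [Module.Finite R N], ¬ KilledAway p.asIdeal ((homComplex (single N) I).homology i) →
      i + n ≤ t := by
  have := hI.isKInjective
  induction n with
  | zero =>
    intro p _ i N _ h
    by_contra! hlt
    refine h ((isSerre_killedAway p.asIdeal).of_isZero (isZero_homology_hom_single_of_lt hI hfg ht
      (dim R + 1 - i).toNat i (by simpa using hlt) (by lia) N))
  | succ n ih =>
    intro p hp i N _ h
    have hp' : ¬ Order.coheight p ≤ n := fun hle => by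
      have := hp.trans hle
      norm_cast at this
      lia
    rw [Order.coheight_le_coe_iff] at hp'
    push Not at hp'
    obtain ⟨q, hpq, hq⟩ := hp'
    obtain ⟨x, hxq, hxp⟩ := SetLike.exists_of_lt (show p.asIdeal < q.asIdeal from hpq)
    -- The `x`-power torsion `T` is killed by a single `x ^ k`, which lies outside `p`, and `x` is
    -- regular on `N ⧸ T`.
    obtain ⟨k, hk⟩ := monotone_stabilizes_iff_noetherian.2 (inferInstanceAs (IsNoetherian R N))
      ⟨fun k => LinearMap.ker (LinearMap.lsmul R N (x ^ k)), fun a b hab y hy => by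
        obtain ⟨c, rfl⟩ := Nat.exists_eq_add_of_le hab
        change x ^ (a + c) • y = 0
        rw [add_comm, pow_add, mul_smul, show x ^ a • y = 0 from hy, smul_zero]⟩
    set T := LinearMap.ker (LinearMap.lsmul R N (x ^ k)) with hT
    have hx0 : ∀ y : N ⧸ T, x • y = 0 → y = 0 := by
      intro y hy
      obtain ⟨y, rfl⟩ := T.mkQ_surjective y
      have hy' : x • y ∈ T := (Submodule.Quotient.mk_eq_zero T).1 hy
      refine (Submodule.Quotient.mk_eq_zero T).2 ?_
      have h1 : y ∈ LinearMap.ker (LinearMap.lsmul R N (x ^ (k + 1))) := by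
        change x ^ (k + 1) • y = 0
        rw [pow_succ, mul_smul]
        exact hy'
      exact (hk (k + 1) (Nat.le_succ k)).ge h1
    have hS : (ModuleCat.shortComplexOfCompEqZero T.subtype T.mkQ
        (LinearMap.ext fun y => (Submodule.Quotient.mk_eq_zero T).2 y.2)).ShortExact :=
      ModuleCat.shortComplex_shortExact _ (LinearMap.exact_subtype_mkQ T) T.injective_subtype
        T.mkQ_surjective
    obtain ⟨δ, hδ⟩ := exact_smul_homology hI.injective (N := ModuleCat.of R (N ⧸ T)) hx0 i (i + 1)
      rfl
    have hfin : Module.Finite R (smulShortComplex (ModuleCat.of R (N ⧸ T)) x).X₃ :=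
      inferInstanceAs (Module.Finite R ((N ⧸ T) ⧸
        LinearMap.range (LinearMap.lsmul R (N ⧸ T) x)))
    have hle := ih q hq (i + 1) (smulShortComplex (ModuleCat.of R (N ⧸ T)) x).X₃ (by
      rintro ⟨s, hs, hs'⟩
      have := (hasFiniteCohomology_homComplex_single hI hfg (ModuleCat.of R (N ⧸ T))).2 i
      -- If some `s ∉ q` killed the next group, `s` would map `Ext^i(N ⧸ T, I)` into its multiples
      -- by `x`; the determinant trick then kills it by some `r ∉ q`, and `r ∉ p` as well.
      obtain ⟨r, hr, hr'⟩ := exists_smul_eq_zero_of_smul_mem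
        (N := (homComplex (single (ModuleCat.of R (N ⧸ T))) I).homology i) hs hxq
        fun z => hδ _ ((map_smul δ s z).trans (hs' _))
      refine h ((isSerre_killedAway p.asIdeal).middle ((shortExact_homShortComplex
        (shortExact_single hS) hI.injective).homology_exact₂ i) ⟨r, fun hrp => hr (hpq.le hrp), hr'⟩
        ⟨x ^ k, fun hxk => hxp (p.2.mem_of_pow_mem _ hxk), fun z => ?_⟩)
      exact smul_homology_hom_single (N := ModuleCat.of R T) (fun y => Subtype.ext y.2) i z)
    push_cast
    lia

-- Otherwise a product `s ∉ p` kills every `H^i(I)`. By dévissage a power of `s` kills `H^0(Hom(I,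
-- I))`, into which `R` embeds by homothety, so that power is zero and lies in `p`.
omit [IsNoetherianRing R] in
lemma exists_not_killedAway (hI : IsDualizingModel I) (p : Ideal R) [hp : p.IsPrime] :
    ∃ i : ℤ, 0 ≤ i ∧ ¬ KilledAway p (I.homology i) := by
  by_contra! h
  have := hI.isKInjective
  choose! f hf hf' using h
  set s := ∏ i ∈ Finset.Icc (0 : ℤ) (dim R), f i with hs
  have hsp : s ∉ p := fun hmem => by
    obtain ⟨i, hi, hi'⟩ := hp.prod_mem_iff.1 hmem
    exact hf i (Finset.mem_Icc.1 hi).1 hi'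
  have hz : ∀ i : ℤ, i < 0 ∨ (dim R : ℤ) < i → IsZero (I.homology i) :=
    fun i hi => isZero_homology_of_isZero_X (hI.isZero i hi)
  have hkill : ∀ i, PowKills s (I.homology i) := fun i => by
    by_cases hi : 0 ≤ i ∧ i ≤ dim R
    · refine ⟨1, fun x => ?_⟩
      obtain ⟨c, hc⟩ := Finset.dvd_prod_of_mem f (Finset.mem_Icc.2 hi)
      rw [pow_one, hs, hc, mul_comm, mul_smul, hf' i hi.1, smul_zero]
    · exact (isSerre_powKills s).of_isZero (hz i (by lia))
  obtain ⟨n, hn⟩ := ((isSerre_powKills s).isThick.homComplex hI.injective).devissage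
    (Good := PowKills s) (fun e h => (isSerre_powKills s).of_iso e h)
    (fun N hN i => hN.imp fun n hn z => smul_homology_hom_single hn i z) I ⟨0, dim R, hz⟩ hkill 0
  have hq := hI.quasiIso_homothety
  obtain ⟨y, hy⟩ := (homologyMap_injective_iff (homothety I) (-1) 0 1 rfl rfl).1
    ((quasiIso_iff_bijective _).1 hq 0).1 (singleEquiv (ModuleCat.of R R) (s ^ n : R)) (by
      rw [show (single (ModuleCat.of R R)).d 0 1 = 0 from
        HomologicalComplex.single_obj_d _ _ _ _ _]
      rfl) (by
      rw [homothety_apply]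
      have hid : (CochainComplex.HomComplex.Cochain.ofHom (𝟙 I) :
          (homComplex I I).X 0) ∈ LinearMap.ker ((homComplex I I).d 0 (0 + 1)).hom :=
        CochainComplex.HomComplex.δ_ofHom (𝟙 I)
      refine (hclass_eq_zero_iff (s ^ n • ⟨_, hid⟩ : LinearMap.ker _) (-1) rfl).1 ?_
      rw [map_smul]
      exact hn _)
  have := ModuleCat.subsingleton_of_isZero (isZero_single_X (N := ModuleCat.of R R) (n := -1)
    (by lia))
  rw [Subsingleton.elim y 0, map_zero, eq_comm, map_eq_zero_iff _ (LinearEquiv.injective _)] at hy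
  refine hsp (hp.mem_of_pow_mem n ?_)
  rw [show s ^ n = 0 from hy]
  exact zero_mem p

theorem isZero_homology_hom_residueField_iff (hI : IsDualizingModel I)
    (hfg : ∀ i, Module.Finite R (I.homology i)) (i : ℤ) :
    IsZero ((homComplex (single (residueField R)) I).homology i) ↔ i ≠ dim R := by
  have := hI.isKInjective
  obtain ⟨t, ht⟩ := exists_not_isZero_homology_hom_residueField hI
  have ht' : ∀ i, i ≠ t → IsZero ((homComplex (single (residueField R)) I).homology i) :=
    fun i hi => (isZero_homology_hom_residueField_or hI hi).resolve_right ht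
  have hle : t ≤ dim R := by
    by_contra! h
    exact ht (isZero_homology_of_isZero_X (hI.isZero_hom_single _ t (Or.inr h)))
  -- The first prime of a chain of length `d` has coheight at least `d`. Some `H^j(I) = Ext^j(R, I)`
  -- with `j ≥ 0` survives there, so `d ≤ j + d ≤ t`.
  obtain ⟨l, hl⟩ := Order.le_krullDim_iff.1 (ringKrullDim_eq_dim R).ge
  obtain ⟨j, hj, hj'⟩ := exists_not_killedAway hI l.head.asIdeal
  have hge := add_le_of_not_killedAway hI hfg (fun i hi => ht' i hi.ne') (dim R) l.head
    (hl ▸ Order.length_le_coheight_head) j (ModuleCat.of R R) (fun h => hj'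
      ((isSerre_killedAway l.head.asIdeal).of_iso (asIso (HomologicalComplex.homologyMap
        (evalSingle (N := ModuleCat.of R R) (1 : R) I) j)) h))
  obtain rfl : t = dim R := by lia
  refine ⟨?_, ht' i⟩
  rintro h rfl
  exact ht h

end Dimension

/-! ### Injective modules and torsion -/

section Injective

variable {R : Type u} [CommRing R]

lemma exists_pow_smul_eq_zero_of_fg {J : Ideal R} {N : Type u} [AddCommGroup N] [Module R N]
    (A : Submodule R N) (hA : A.FG) (h : A ≤ torsion J N) :
    ∃ n : ℕ, ∀ r ∈ J ^ n, ∀ x ∈ A, r • x = 0 := by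
  classical
  obtain ⟨s, rfl⟩ := hA
  rw [Submodule.span_le] at h
  choose! f hf using h
  refine ⟨s.sup f, fun r hr x hx => ?_⟩
  have : Submodule.span R (s : Set N) ≤ LinearMap.ker (LinearMap.lsmul R N r) := by
    rw [Submodule.span_le]
    exact fun y hy => hf hy r (Ideal.pow_le_pow_right (Finset.le_sup hy) hr)
  exact this hx

/-- Over a noetherian ring the torsion submodule of an injective module is injective. -/
theorem injective_torsion [IsNoetherianRing R] (J : Ideal R) (N : Type u) [AddCommGroup N]
    [Module R N] [hN : Module.Injective R N] : Module.Injective R (torsion J N) := by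
  refine Module.Baer.injective fun a g => ?_
  set g' : a →ₗ[R] N := (torsion J N).subtype ∘ₗ g with hg'
  obtain ⟨n, hn⟩ := exists_pow_smul_eq_zero_of_fg (J := J) (LinearMap.range g')
    (by rw [← Submodule.map_top]; exact (IsNoetherian.noetherian (⊤ : Submodule R a)).map _)
    (by rintro _ ⟨x, rfl⟩; exact (g x).2)
  -- By Artin–Rees `J ^ (n + k) ∩ a ⊆ J ^ n a`, so `g'` vanishes there and factors through a
  -- submodule of `R ⧸ J ^ (n + k)`. Every map from that quotient to `N` has torsion values.
  obtain ⟨k, hk⟩ := Ideal.exists_pow_inf_eq_pow_smul J a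
  have hker : ∀ x : a, (x : R) ∈ J ^ (n + k) → g' x = 0 := by
    intro x hx
    have h1 : (x : R) ∈ J ^ n • (J ^ k • (⊤ : Submodule R R) ⊓ a) := by
      have := hk (n + k) (Nat.le_add_left k n)
      rw [Nat.add_sub_cancel] at this
      rw [← this]
      exact ⟨by simpa using hx, x.2⟩
    have h2 : J ^ n • (J ^ k • (⊤ : Submodule R R) ⊓ a) ≤ (LinearMap.ker g').map a.subtype := by
      rw [Submodule.smul_le]
      rintro r hr y ⟨-, hy⟩
      refine ⟨r • ⟨y, hy⟩, ?_, rfl⟩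
      change g' _ = 0
      rw [map_smul]
      exact hn r hr _ ⟨_, rfl⟩
    obtain ⟨y, hy, hyx⟩ := h2 h1
    obtain rfl : y = x := Subtype.ext hyx
    exact hy
  set φ : a →ₗ[R] R ⧸ J ^ (n + k) := (J ^ (n + k)).mkQ ∘ₗ a.subtype with hφ
  have hφg : LinearMap.ker φ ≤ LinearMap.ker g' := fun x hx =>
    hker x ((Submodule.Quotient.mk_eq_zero _).1 hx)
  obtain ⟨h, hh⟩ := hN.out ((LinearMap.ker φ).liftQ φ le_rfl)
    (LinearMap.ker_eq_bot.1 (Submodule.ker_liftQ_eq_bot' _ _ rfl))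
    ((LinearMap.ker φ).liftQ g' hφg)
  have hmem : ∀ r : R, h (Submodule.Quotient.mk r) ∈ torsion J N := fun r =>
    ⟨n + k, fun s hs => by
      rw [← map_smul, ← Submodule.Quotient.mk_smul, (Submodule.Quotient.mk_eq_zero _).2, map_zero]
      exact Ideal.mul_mem_right _ _ hs⟩
  refine ⟨(h ∘ₗ (J ^ (n + k)).mkQ).codRestrict (torsion J N) hmem, fun x hx => Subtype.ext ?_⟩
  exact hh (Submodule.Quotient.mk ⟨x, hx⟩)

/-- For the least `n` with `J ^ n x ⊆ A`, some multiple of `x` by an element of `J ^ (n - 1)` lies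
outside `A` and is a socle element of the quotient. -/
lemma exists_smul_notMem_of_torsion {J : Ideal R} {N : Type u} [AddCommGroup N] [Module R N]
    (A : Submodule R N) {x : N} (hx : x ∉ A) (h : ∃ n : ℕ, ∀ r ∈ J ^ n, r • x ∈ A) :
    ∃ r : R, r • x ∉ A ∧ ∀ s ∈ J, s • r • x ∈ A := by
  classical
  obtain ⟨n, hn, hmin⟩ : ∃ n : ℕ, (∀ r ∈ J ^ n, r • x ∈ A) ∧
      ∀ m < n, ¬ ∀ r ∈ J ^ m, r • x ∈ A := ⟨Nat.find h, Nat.find_spec h, fun m => Nat.find_min h⟩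
  cases n with
  | zero => exact (hx (by simpa using hn 1 (by simp))).elim
  | succ n =>
    have := hmin n (Nat.lt_succ_self n)
    push Not at this
    obtain ⟨r, hr, hrx⟩ := this
    refine ⟨r, hrx, fun s hs => ?_⟩
    rw [← mul_smul]
    exact hn _ (by rw [pow_succ, mul_comm s]; exact Ideal.mul_mem_mul hr hs)

lemma exists_retraction {N : Type u} [AddCommGroup N] [Module R N] (A : Submodule R N)
    [hA : Module.Injective R A] : ∃ ρ : N →ₗ[R] N, (∀ x, ρ x ∈ A) ∧ ∀ x ∈ A, ρ x = x := by
  obtain ⟨h, hh⟩ := hA.out A.subtype A.injective_subtype LinearMap.id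
  exact ⟨A.subtype ∘ₗ h, fun x => (h x).2, fun x hx => congrArg Subtype.val (hh ⟨x, hx⟩)⟩

/-- The kernel, being injective, is a direct summand, so `q` has a section. -/
lemma injective_of_surjective {N Q : Type u} [AddCommGroup N] [Module R N] [AddCommGroup Q]
    [Module R Q] [hN : Module.Injective R N] (q : N →ₗ[R] Q) (hq : Function.Surjective q)
    [Module.Injective R (LinearMap.ker q)] : Module.Injective R Q := by
  obtain ⟨ρ, hρ, hρ'⟩ := exists_retraction (LinearMap.ker q)
  let σ : Q →ₗ[R] N := (LinearMap.ker q).liftQ (LinearMap.id - ρ)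
    (fun x hx => by simp [hρ' x hx]) ∘ₗ (q.quotKerEquivOfSurjective hq).symm.toLinearMap
  have hσ : ∀ y, q (σ y) = y := by
    intro y
    obtain ⟨x, rfl⟩ := hq y
    have : (q.quotKerEquivOfSurjective hq).symm (q x) = Submodule.Quotient.mk x := by
      rw [LinearEquiv.symm_apply_eq]
      rfl
    simp only [σ, LinearMap.comp_apply, LinearEquiv.coe_coe, this]
    change q (x - ρ x) = q x
    rw [map_sub, LinearMap.mem_ker.1 (hρ x), sub_zero]
  refine ⟨fun X Y _ _ _ _ f hf g => ?_⟩
  obtain ⟨h, hh⟩ := hN.out f hf (σ ∘ₗ g)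
  exact ⟨q ∘ₗ h, fun x => (congrArg q (hh x)).trans (hσ _)⟩

end Injective

/-! ### The torsion of the dualizing complex -/

section TorsionComplex

variable {R : Type u} [CommRing R] {J : Ideal R} {C : CochainComplex (ModuleCat.{u} R) ℤ} {d : ℤ}

/-- The set of boundaries. -/
abbrev boundaries (C : CochainComplex (ModuleCat.{u} R) ℤ) (j i : ℤ) : Submodule R (C.X i) :=
  LinearMap.range (C.d j i).hom

/-- Correcting an element whose multiples by `J` are boundaries by a boundary. -/
lemma exists_socle_sub_mem {j i : ℤ} [Module.Injective R (boundaries C j i)] (z : C.X i)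
    (hz : ∀ s ∈ J, s • z ∈ boundaries C j i) :
    ∃ z', z - z' ∈ boundaries C j i ∧ ∀ s ∈ J, s • z' = 0 := by
  obtain ⟨ρ, hρ, hρ'⟩ := exists_retraction (boundaries C j i)
  refine ⟨z - ρ z, by simpa using hρ z, fun s hs => ?_⟩
  rw [smul_sub, ← map_smul, hρ' _ (hz s hs), sub_self]

/-- By torsion, a cocycle outside the boundaries has a multiple representing a nonzero socle element
modulo boundaries. Injectivity of the boundaries lifts it to a genuine socle element, to which
`hsoc` applies. -/
lemma mem_boundaries_of_socle (htors : ∀ i (x : C.X i), ∃ n : ℕ, ∀ r ∈ J ^ n, r • x = 0)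
    {j i k : ℤ} (hinj : Module.Injective R (boundaries C j i))
    (hsoc : ∀ z : C.X i, (C.d i k).hom z = 0 → (∀ s ∈ J, s • z = 0) → z ∈ boundaries C j i)
    (z : C.X i) (hz : (C.d i k).hom z = 0) : z ∈ boundaries C j i := by
  by_contra hzB
  obtain ⟨r, hr, hr'⟩ := exists_smul_notMem_of_torsion (J := J) _ hzB
    ((htors i z).imp fun n hn r hr => by rw [hn r hr]; exact zero_mem _)
  obtain ⟨z', hz', hs⟩ := exists_socle_sub_mem (J := J) (r • z) hr'
  refine hr ((Submodule.sub_mem_iff_left _ (hsoc z' ?_ hs)).1 hz')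
  obtain ⟨w, hw⟩ := hz'
  have h := congrArg (C.d i k).hom hw
  rw [d_d_apply, map_sub, map_smul, hz, smul_zero, zero_sub, eq_comm, neg_eq_zero] at h
  exact h

/-- Below degree `d` cocycles are boundaries, so each module of boundaries is the quotient of an
injective module by the preceding boundaries, injective by induction. -/
lemma injective_boundaries (hinj : ∀ i, Module.Injective R (C.X i))
    (htors : ∀ i (x : C.X i), ∃ n : ℕ, ∀ r ∈ J ^ n, r • x = 0)
    (hzero : ∀ i : ℤ, i < 0 → IsZero (C.X i))
    (hsoc : ∀ j i k : ℤ, j + 1 = i → i + 1 = k → i < d → ∀ z : C.X i, (C.d i k).hom z = 0 →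
      (∀ s ∈ J, s • z = 0) → z ∈ boundaries C j i) (n : ℕ) :
    ∀ j : ℤ, j + 1 = n → j < d → Module.Injective R (boundaries C j n) := by
  induction n with
  | zero =>
    intro j hj _
    have := ModuleCat.subsingleton_of_isZero (hzero j (by simp at hj; lia))
    have : Subsingleton (boundaries C j (0 : ℕ)) := by
      refine subsingleton_of_forall_eq 0 ?_
      rintro ⟨_, x, rfl⟩
      rw [Subtype.ext_iff]
      simp [Subsingleton.elim x 0]
    exact ⟨fun X Y _ _ _ _ f hf g => ⟨0, fun x => Subsingleton.elim _ _⟩⟩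
  | succ n ih =>
    intro j hj hjd
    obtain rfl : j = n := by push_cast at hj; lia
    have hB := ih (n - 1) (by lia) (by lia)
    have hex := mem_boundaries_of_socle htors hB
      (hsoc (n - 1) n ((n + 1 : ℕ) : ℤ) (by lia) (by push_cast; rfl) hjd)
    have hker : LinearMap.ker (C.d n (n + 1 : ℕ)).hom.rangeRestrict = boundaries C (n - 1) n := by
      rw [LinearMap.ker_rangeRestrict]
      refine le_antisymm (fun z hz => hex z hz) ?_
      rintro _ ⟨w, rfl⟩
      exact d_d_apply C _ _ _ w
    have : Module.Injective R (LinearMap.ker (C.d n (n + 1 : ℕ)).hom.rangeRestrict) := by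
      rw [hker]
      exact hB
    exact injective_of_surjective (C.d n (n + 1 : ℕ)).hom.rangeRestrict
      (LinearMap.surjective_rangeRestrict _)

/-- A bounded complex of torsion injective modules whose socle is acyclic outside the top degree
is quasi-isomorphic to an injective module in that degree. -/
theorem exists_quasiIso_singleAt_of_torsion {d : ℕ} (hinj : ∀ i, Module.Injective R (C.X i))
    (htors : ∀ i (x : C.X i), ∃ n : ℕ, ∀ r ∈ J ^ n, r • x = 0)
    (hzero : ∀ i : ℤ, i < 0 ∨ (d : ℤ) < i → IsZero (C.X i))
    (hsoc : ∀ j i k : ℤ, j + 1 = i → i + 1 = k → i < d → ∀ z : C.X i, (C.d i k).hom z = 0 →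
      (∀ s ∈ J, s • z = 0) → z ∈ boundaries C j i)
    (hd : ∃ z : C.X d, (∀ s ∈ J, s • z = 0) ∧
      ∀ w : C.X (d - 1), (∀ s ∈ J, s • w = 0) → (C.d (d - 1) d).hom w ≠ z) :
    ∃ E : ModuleCat.{u} R, Module.Injective R E ∧
      (∀ x : E, ∃ n : ℕ, ∀ r ∈ J ^ n, r • x = 0) ∧
      (∃ e : E, e ≠ 0 ∧ ∀ s ∈ J, s • e = 0) ∧ ∃ φ : C ⟶ singleAt d E, QuasiIso φ := by
  have hsoc' := fun i => hzero i ∘ Or.inl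
  have hB : ∀ n : ℕ, n ≤ d → Module.Injective R (boundaries C (n - 1) n) := fun n hn =>
    injective_boundaries (d := d) hinj htors hsoc' hsoc n (n - 1) (by lia) (by lia)
  have hex : ∀ j i k : ℤ, j + 1 = i → i + 1 = k → i < d → ∀ z : C.X i, (C.d i k).hom z = 0 →
      z ∈ boundaries C j i := by
    intro j i k hj hk hi z hz
    by_cases h0 : i < 0
    · have := ModuleCat.subsingleton_of_isZero (hsoc' i h0)
      rw [Subsingleton.elim z 0]
      exact zero_mem _
    · lift i to ℕ using by lia
      obtain rfl : j = i - 1 := by lia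
      exact mem_boundaries_of_socle htors (hB i (by lia)) (hsoc _ _ k hj hk hi) z hz
  set B := boundaries C (d - 1) d with hBdef
  have hBd := hB d le_rfl
  have hEinj : Module.Injective R (C.X d ⧸ B) := by
    have : Module.Injective R (LinearMap.ker B.mkQ) := by
      rw [Submodule.ker_mkQ]
      exact hBd
    exact injective_of_surjective B.mkQ B.mkQ_surjective
  let E : ModuleCat.{u} R := ModuleCat.of R (C.X d ⧸ B)
  let q : C.X d ⟶ E := ModuleCat.ofHom B.mkQ
  have hq : C.d (d - 1) d ≫ q = 0 :=
    ModuleCat.hom_ext (LinearMap.ext fun w => (Submodule.Quotient.mk_eq_zero B).2 ⟨w, rfl⟩)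
  let φ : C ⟶ singleAt d E := HomologicalComplex.mkHomToSingle q (by
    intro i hi
    obtain rfl : i = d - 1 := by
      change i + 1 = d at hi
      lia
    exact hq)
  have hφ : ∀ x : C.X d, (φ.f d).hom x =
      (HomologicalComplex.singleObjXSelf (ComplexShape.up ℤ) (d : ℤ) E).symm.toLinearEquiv
        (B.mkQ x) := fun x =>
    LinearMap.congr_fun (congrArg ModuleCat.Hom.hom
      (HomologicalComplex.mkHomToSingle_f (c := ComplexShape.up ℤ) q _)) x
  have hφ0 : ∀ x : C.X d, (φ.f d).hom x = 0 ↔ x ∈ B := fun x => by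
    rw [hφ, map_eq_zero_iff _ (LinearEquiv.injective _)]
    exact Submodule.Quotient.mk_eq_zero B
  have hφs : Function.Surjective (φ.f d).hom := fun y => by
    obtain ⟨x, hx⟩ := B.mkQ_surjective
      ((HomologicalComplex.singleObjXSelf (ComplexShape.up ℤ) (d : ℤ) E).toLinearEquiv y)
    refine ⟨x, (hφ x).trans ?_⟩
    rw [hx]
    exact LinearEquiv.symm_apply_apply
      (HomologicalComplex.singleObjXSelf (ComplexShape.up ℤ) (d : ℤ) E).toLinearEquiv y
  have hz : ∀ i : ℤ, i ≠ d → IsZero (C.homology i) := by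
    intro i hi
    obtain hi | hi := hi.lt_or_gt
    · rw [isZero_homology_iff _ (i - 1) i (i + 1) (by lia) rfl]
      exact fun x hx => hex _ _ _ (by lia) rfl hi x hx
    · exact isZero_homology_of_isZero_X (hzero i (Or.inr hi))
  refine ⟨E, hEinj, ?_, ?_, φ, ?_⟩
  · intro x
    obtain ⟨x, rfl⟩ := B.mkQ_surjective x
    obtain ⟨n, hn⟩ := htors _ x
    refine ⟨n, fun r hr => ?_⟩
    refine (map_smul B.mkQ r x).symm.trans ?_
    rw [hn r hr, map_zero]
  · obtain ⟨z, hz, hzw⟩ := hd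
    refine ⟨B.mkQ z, fun h => ?_, fun s hs => ?_⟩
    · obtain ⟨w, hw⟩ := (Submodule.Quotient.mk_eq_zero B).1 h
      by_cases h0 : d = 0
      · have := ModuleCat.subsingleton_of_isZero (hsoc' (d - 1) (by lia))
        exact hzw w (fun s _ => Subsingleton.elim _ _) hw
      · obtain ⟨n, rfl⟩ := Nat.exists_eq_succ_of_ne_zero h0
        have hBn := hB n (Nat.le_succ n)
        have hn : ((n + 1 : ℕ) : ℤ) - 1 = n := by lia
        rw [← hn] at hBn
        -- If `z = d w`, every `s • w` with `s ∈ J` is a cocycle in degree `d - 1`, hence a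
        -- boundary. So `w` can be corrected by a boundary to a socle element with the same image
        -- `z`, contradicting `hzw`.
        obtain ⟨w', hw', hs⟩ := exists_socle_sub_mem (J := J)
          (j := (((n + 1 : ℕ) : ℤ) - 1 - 1)) w (fun s hs =>
            hex _ _ ((n + 1 : ℕ) : ℤ) (by lia) (by lia) (by lia) _ (by
              rw [map_smul, hw]
              exact hz s hs))
        refine hzw w' hs ?_
        obtain ⟨v, hv⟩ := hw'
        have h := congrArg (C.d (((n + 1 : ℕ) : ℤ) - 1) ((n + 1 : ℕ) : ℤ)).hom hv
        rw [d_d_apply, map_sub, eq_comm, sub_eq_zero] at h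
        rw [← h]
        exact hw
    · refine (map_smul B.mkQ s z).symm.trans ?_
      rw [hz s hs, map_zero]
  · rw [quasiIso_iff_bijective]
    intro i
    by_cases hi : i = d
    · subst hi
      constructor
      · rw [homologyMap_injective_iff φ (d - 1) d (d + 1) (by lia) rfl]
        rintro x - ⟨y, hy⟩
        rw [show (singleAt (d : ℤ) E).d ((d : ℤ) - 1) d = 0 from
          HomologicalComplex.single_obj_d _ _ _ _ _] at hy
        exact (hφ0 x).1 hy.symm
      · rw [homologyMap_surjective_iff φ (d - 1) d (d + 1) (by lia) rfl]
        intro z _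
        obtain ⟨x, hx⟩ := hφs z
        refine ⟨x, ?_, 0, by rw [map_zero, hx, sub_self]⟩
        have := ModuleCat.subsingleton_of_isZero (hzero (d + 1) (by lia))
        exact Subsingleton.elim _ _
    · have h₁ := ModuleCat.subsingleton_of_isZero (hz i hi)
      have h₂ := ModuleCat.subsingleton_of_isZero (isZero_homology_singleAt (d : ℤ) i hi E)
      exact ⟨Function.injective_of_subsingleton _, fun y => ⟨0, Subsingleton.elim _ _⟩⟩

end TorsionComplex

section DualizingTorsion

variable {R : Type u} [CommRing R]

/-- The complex `Γ_J(X)`. -/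
abbrev torsionComplex (J : Ideal R) (X : CochainComplex (ModuleCat.{u} R) ℤ) :
    CochainComplex (ModuleCat.{u} R) ℤ :=
  ((torsionFunctor J).mapHomologicalComplex (ComplexShape.up ℤ)).obj X

open IsLocalRing

lemma isZero_torsionComplex_X {J : Ideal R} {X : CochainComplex (ModuleCat.{u} R) ℤ} {i : ℤ}
    (h : IsZero (X.X i)) : IsZero ((torsionComplex J X).X i) :=
  (torsionFunctor J).map_isZero h

/-- The socle of `Γ_𝔪 I` is `Hom(k, I)`, whose cohomology sits exactly in degree `d`; this supplies
both socle hypotheses of `exists_quasiIso_singleAt_of_torsion`. -/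
theorem exists_quasiIso_torsionComplex_singleAt [IsLocalRing R] [IsNoetherianRing R]
    {I : CochainComplex (ModuleCat.{u} R) ℤ} (hI : IsDualizingModel I)
    (hfg : ∀ i, Module.Finite R (I.homology i)) :
    ∃ E : ModuleCat.{u} R, Module.Injective R E ∧
      (∀ x : E, ∃ n : ℕ, ∀ r ∈ maximalIdeal R ^ n, r • x = 0) ∧
      (∃ e : E, e ≠ 0 ∧ ∀ s ∈ maximalIdeal R, s • e = 0) ∧
      ∃ φ : torsionComplex (maximalIdeal R) I ⟶ singleAt (dim R) E, QuasiIso φ := by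
  let ev := evalSingle (N := residueField R) (1 : ResidueField R) I
  have hmem : ∀ {i : ℤ} (w : CochainComplex.HomComplex.Cochain (single (residueField R)) I i),
      (ev.f i).hom w ∈ torsion (maximalIdeal R) (I.X i) := fun {i} w =>
    ⟨1, fun r hr => smul_evalSingle_one (Y := I) (by rwa [pow_one] at hr) w⟩
  refine exists_quasiIso_singleAt_of_torsion (fun i => ?_) (fun i x => ?_)
    (fun i hi => isZero_torsionComplex_X (hI.isZero i hi)) ?_ ?_
  · have := hI.injective i
    have := Module.injective_module_of_injective_object R (I.X i)
    exact injective_torsion (maximalIdeal R) (I.X i)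
  · obtain ⟨n, hn⟩ := x.2
    exact ⟨n, fun r hr => Subtype.ext (hn r hr)⟩
  · intro j i k hj hk hi z hz hs
    obtain ⟨φ, hφ⟩ := exists_evalSingle_one_eq (Y := I) z.1 fun s hs' =>
      congrArg Subtype.val (hs s hs')
    obtain ⟨(w : CochainComplex.HomComplex.Cochain (single (residueField R)) I j), hw⟩ :=
      (isZero_homology_iff _ j i k hj hk).1
      ((isZero_homology_hom_residueField_iff hI hfg i).2 hi.ne) φ (by
        refine evalSingle_one_injective (Y := I) ?_
        refine (hom_comm_apply ev i k φ).symm.trans (Eq.trans ?_ (map_zero _).symm)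
        rw [hφ]
        exact congrArg Subtype.val hz)
    refine ⟨⟨(ev.f j).hom w, hmem w⟩, Subtype.ext ?_⟩
    refine (hom_comm_apply ev j i w).trans ?_
    rw [hw]
    exact hφ
  · have h := (isZero_homology_hom_residueField_iff hI hfg (dim R)).not.2 (by simp)
    rw [isZero_homology_iff _ (dim R - 1) (dim R) (dim R + 1) (by lia) rfl] at h
    push Not at h
    obtain ⟨(z : CochainComplex.HomComplex.Cochain (single (residueField R)) I (dim R)), -, hz⟩ := h
    refine ⟨⟨(ev.f (dim R)).hom z, hmem z⟩, fun s hs => Subtype.ext (smul_evalSingle_one hs z),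
      fun w hs hw => ?_⟩
    obtain ⟨φ, hφ⟩ := exists_evalSingle_one_eq (Y := I) w.1 fun s hs' =>
      congrArg Subtype.val (hs s hs')
    refine hz φ (evalSingle_one_injective (Y := I) ?_)
    refine (hom_comm_apply ev _ _ φ).symm.trans ?_
    rw [hφ]
    exact congrArg Subtype.val hw

end DualizingTorsion

/-! ### Homotopies and isomorphisms in the derived category -/

section Homotopy

variable {R : Type u} [CommRing R] {X Y Y' : CochainComplex (ModuleCat.{u} R) ℤ}

open CochainComplex.HomComplex

lemma homotopy_apply {f g : X ⟶ Y} (h : Homotopy f g) {j i k : ℤ} (hj : j + 1 = i)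
    (hk : i + 1 = k) (x : X.X i) :
    (f.f i).hom x = (h.hom k i).hom ((X.d i k).hom x) + (Y.d j i).hom ((h.hom i j).hom x) +
      (g.f i).hom x := by
  have := h.comm i
  rw [dNext_eq h.hom (show (ComplexShape.up ℤ).Rel i k from hk),
    prevD_eq h.hom (show (ComplexShape.up ℤ).Rel j i from hj)] at this
  exact LinearMap.congr_fun (congrArg ModuleCat.Hom.hom this) x

lemma homotopy_apply_of_d_eq_zero {f g : X ⟶ Y} (h : Homotopy f g) {j i k : ℤ} (hj : j + 1 = i)
    (hk : i + 1 = k) (x : X.X i) (hx : (X.d i k).hom x = 0) :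
    (f.f i).hom x = (Y.d j i).hom ((h.hom i j).hom x) + (g.f i).hom x := by
  rw [homotopy_apply h hj hk x, hx, map_zero, zero_add]

/-- Postcomposition with homotopic maps gives homotopic maps. -/
noncomputable def postcompHomotopyOfCochain (X : CochainComplex (ModuleCat.{u} R) ℤ) {f g : Y ⟶ Y'}
    (z : Cochain Y Y' (-1))
    (hz : Cochain.ofHom f = δ (-1) 0 z + Cochain.ofHom g) :
    Homotopy (postcomp X f) (postcomp X g) :=
  (Cochain.equivHomotopy _ _).symm ⟨Cochain.mk fun p q hpq => ModuleCat.ofHom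
    { toFun := fun φ : Cochain X Y p => φ.comp z hpq
      map_add' := fun _ _ => Cochain.add_comp _ _ _ _
      map_smul' := fun _ _ => Cochain.smul_comp _ _ _ _ }, by
    refine Cochain.ext₀ _ _ fun p => ?_
    rw [Cochain.add_v, δ_v (-1) 0 rfl _ p p (add_zero p) (p - 1) (p + 1) (by lia) rfl,
      Cochain.ofHom_v, Cochain.ofHom_v, Int.negOnePow_zero, one_smul]
    refine ModuleCat.hom_ext (LinearMap.ext fun (φ : Cochain X Y p) => ?_)
    change φ.comp (Cochain.ofHom f) (add_zero p) =
      δ (p - 1) p (φ.comp z (by lia)) +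
        (δ p (p + 1) φ).comp z (by lia) +
        φ.comp (Cochain.ofHom g) (add_zero p)
    rw [hz, Cochain.comp_add,
      δ_comp φ z (show p + -1 = p - 1 by lia) (p + 1) 0 p (by lia) rfl
        rfl, Int.negOnePow_neg, Int.negOnePow_one]
    simp⟩

/-- Postcomposition with homotopic maps gives homotopic maps. -/
noncomputable def postcompHomotopy (X : CochainComplex (ModuleCat.{u} R) ℤ) {f g : Y ⟶ Y'}
    (h : Homotopy f g) : Homotopy (postcomp X f) (postcomp X g) :=
  postcompHomotopyOfCochain X _ (Cochain.equivHomotopy f g h).2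

/-- `Hom(X, -)` preserves homotopy equivalences. -/
noncomputable def postcompHomotopyEquiv (X : CochainComplex (ModuleCat.{u} R) ℤ)
    (e : HomotopyEquiv Y Y') : HomotopyEquiv (homComplex X Y) (homComplex X Y') where
  hom := postcomp X e.hom
  inv := postcomp X e.inv
  homotopyHomInvId := (Homotopy.ofEq (homComplex_hom_ext fun n φ => by
    change (φ.comp (Cochain.ofHom e.hom) (add_zero n)).comp (Cochain.ofHom e.inv) (add_zero n) =
      φ.comp (Cochain.ofHom (e.hom ≫ e.inv)) (add_zero n)
    rw [Cochain.ofHom_comp, Cochain.comp_assoc_of_third_is_zero_cochain])).trans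
    ((postcompHomotopy X e.homotopyHomInvId).trans (Homotopy.ofEq (homComplex_hom_ext fun n φ =>
      Cochain.comp_id φ)))
  homotopyInvHomId := (Homotopy.ofEq (homComplex_hom_ext fun n φ => by
    change (φ.comp (Cochain.ofHom e.inv) (add_zero n)).comp (Cochain.ofHom e.hom) (add_zero n) =
      φ.comp (Cochain.ofHom (e.inv ≫ e.hom)) (add_zero n)
    rw [Cochain.ofHom_comp, Cochain.comp_assoc_of_third_is_zero_cochain])).trans
    ((postcompHomotopy X e.homotopyInvHomId).trans (Homotopy.ofEq (homComplex_hom_ext fun n φ =>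
      Cochain.comp_id φ)))

lemma isZero_homology_iff_of_homotopyEquiv (e : HomotopyEquiv X Y) (i : ℤ) :
    IsZero (X.homology i) ↔ IsZero (Y.homology i) :=
  (e.toHomologyIso i).isZero_iff

lemma nonempty_homotopyEquiv_of_quasiIso (f : X ⟶ Y) [X.IsKInjective] [Y.IsKInjective]
    [hf : QuasiIso f] : Nonempty (HomotopyEquiv X Y) := by
  obtain ⟨e, -⟩ := (CochainComplex.IsKInjective.quasiIso_iff f).1 hf
  exact ⟨e⟩

lemma derivedIso_of_quasiIso (f : X ⟶ Y) [QuasiIso f] : DerivedIso X Y := by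
  let := HasDerivedCategory.standard (ModuleCat.{u} R)
  exact ⟨asIso (DerivedCategory.Q.map f)⟩

lemma DerivedIso.symm (h : DerivedIso X Y) : DerivedIso Y X := by
  let := HasDerivedCategory.standard (ModuleCat.{u} R)
  exact ⟨h.some.symm⟩

lemma DerivedIso.trans (h : DerivedIso X Y) (h' : DerivedIso Y Y') : DerivedIso X Y' := by
  let := HasDerivedCategory.standard (ModuleCat.{u} R)
  exact ⟨h.some ≪≫ h'.some⟩

lemma DerivedIso.isZero_homology_iff (h : DerivedIso X Y) (i : ℤ) :
    IsZero (X.homology i) ↔ IsZero (Y.homology i) := by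
  let := HasDerivedCategory.standard (ModuleCat.{u} R)
  let e := (DerivedCategory.homologyFunctorFactors (ModuleCat.{u} R) i).app
  exact ((e X).symm ≪≫ (DerivedCategory.homologyFunctor (ModuleCat.{u} R) i).mapIso h.some ≪≫
    e Y).isZero_iff

/-- Morphisms in `D(R)` to a K-injective complex are homotopy classes of chain maps. -/
lemma DerivedIso.exists_quasiIso_to [Y.IsKInjective] (h : DerivedIso X Y) :
    ∃ f : X ⟶ Y, QuasiIso f := by
  let := HasDerivedCategory.standard (ModuleCat.{u} R)
  obtain ⟨e⟩ := h
  obtain ⟨g, hg⟩ := (CochainComplex.IsKInjective.Qh_map_bijective _ Y).surjective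
    ((DerivedCategory.quotientCompQhIso (ModuleCat.{u} R)).hom.app X ≫ e.hom ≫
      (DerivedCategory.quotientCompQhIso (ModuleCat.{u} R)).inv.app Y)
  obtain ⟨f, rfl⟩ := (HomotopyCategory.quotient _ _).map_surjective g
  refine ⟨f, (DerivedCategory.isIso_Q_map_iff_quasiIso _ f).1 ?_⟩
  have : DerivedCategory.Q.map f = e.hom := by
    have h1 := (DerivedCategory.quotientCompQhIso (ModuleCat.{u} R)).hom.naturality f
    rw [Functor.comp_map, hg] at h1
    simpa using h1.symm
  rw [this]
  infer_instance

lemma DerivedIso.exists_quasiIso_from [X.IsKProjective] (h : DerivedIso X Y) :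
    ∃ f : X ⟶ Y, QuasiIso f := by
  let := HasDerivedCategory.standard (ModuleCat.{u} R)
  obtain ⟨e⟩ := h
  obtain ⟨g, hg⟩ := (CochainComplex.IsKProjective.Qh_map_bijective X _).surjective
    ((DerivedCategory.quotientCompQhIso (ModuleCat.{u} R)).hom.app X ≫ e.hom ≫
      (DerivedCategory.quotientCompQhIso (ModuleCat.{u} R)).inv.app Y)
  obtain ⟨f, rfl⟩ := (HomotopyCategory.quotient _ _).map_surjective g
  refine ⟨f, (DerivedCategory.isIso_Q_map_iff_quasiIso _ f).1 ?_⟩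
  have : DerivedCategory.Q.map f = e.hom := by
    have h1 := (DerivedCategory.quotientCompQhIso (ModuleCat.{u} R)).hom.naturality f
    rw [Functor.comp_map, hg] at h1
    simpa using h1.symm
  rw [this]
  infer_instance

lemma DerivedIso.homotopyEquiv_of_isKInjective [X.IsKInjective] [Y.IsKInjective]
    (h : DerivedIso X Y) : Nonempty (HomotopyEquiv X Y) := by
  obtain ⟨f, hf⟩ := h.exists_quasiIso_to
  exact nonempty_homotopyEquiv_of_quasiIso f

lemma DerivedIso.homotopyEquiv_of_isKProjective [X.IsKProjective] [Y.IsKProjective]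
    (h : DerivedIso X Y) : Nonempty (HomotopyEquiv X Y) := by
  obtain ⟨f, hf⟩ := h.exists_quasiIso_from
  obtain ⟨e, -⟩ := (CochainComplex.IsKProjective.quasiIso_iff f).1 hf
  exact ⟨e⟩

end Homotopy

/-! ### Socle classes, residue classes and injective cogenerators -/

section Classes

variable {R : Type u} [CommRing R] {X Y : CochainComplex (ModuleCat.{u} R) ℤ} (J : Ideal R)

/-- The existence of a cocycle in degree `d` that is annihilated by `J` and is not the boundary of
a torsion element. -/
def HasSocleClass (d : ℤ) (Y : CochainComplex (ModuleCat.{u} R) ℤ) : Prop :=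
  ∃ z : Y.X d, (Y.d d (d + 1)).hom z = 0 ∧ (∀ s ∈ J, s • z = 0) ∧
    ∀ w ∈ torsion J (Y.X (d - 1)), (Y.d (d - 1) d).hom w ≠ z

/-- The existence of a cocycle in degree `0` that is not a boundary modulo `J`. -/
def HasResidueClass (Q : CochainComplex (ModuleCat.{u} R) ℤ) : Prop :=
  ∃ z : Q.X 0, (Q.d 0 1).hom z = 0 ∧ z ∉ J • (⊤ : Submodule R (Q.X 0)) ⊔ boundaries Q (-1) 0

variable {J}

lemma map_mem_torsion {M N : Type u} [AddCommGroup M] [Module R M] [AddCommGroup N] [Module R N]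
    (f : M →ₗ[R] N) {x : M} (hx : x ∈ torsion J M) : f x ∈ torsion J N := by
  obtain ⟨n, hn⟩ := hx
  exact ⟨n, fun r hr => by rw [← map_smul, hn r hr, map_zero]⟩

lemma mem_torsion_of_smul {M : Type u} [AddCommGroup M] [Module R M] {x : M}
    (hx : ∀ s ∈ J, s • x = 0) : x ∈ torsion J M :=
  ⟨1, fun r hr => hx r (by rwa [pow_one] at hr)⟩

/-- The homotopy moves `z` by the boundary of an element killed by `J`, which is in particular
torsion. -/
lemma HasSocleClass.of_homotopyEquiv {d : ℤ} (e : HomotopyEquiv X Y) (h : HasSocleClass J d X) :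
    HasSocleClass J d Y := by
  obtain ⟨z, hz, hs, hw⟩ := h
  refine ⟨(e.hom.f d).hom z, ?_, fun s hs' => by rw [← map_smul, hs s hs', map_zero], ?_⟩
  · rw [hom_comm_apply, hz, map_zero]
  · intro w hwt hwz
    have h1 := homotopy_apply_of_d_eq_zero e.homotopyHomInvId (j := d - 1) (by lia) rfl z hz
    rw [show ((e.hom ≫ e.inv).f d).hom z = (e.inv.f d).hom ((e.hom.f d).hom z) from rfl, ← hwz,
      ← hom_comm_apply] at h1
    refine hw ((e.inv.f (d - 1)).hom w - (e.homotopyHomInvId.hom d (d - 1)).hom z)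
      (sub_mem (map_mem_torsion _ hwt) (map_mem_torsion _ (mem_torsion_of_smul hs))) ?_
    rw [map_sub, h1]
    exact add_sub_cancel_left _ _

lemma hasSocleClass_iff_of_homotopyEquiv {d : ℤ} (e : HomotopyEquiv X Y) :
    HasSocleClass J d X ↔ HasSocleClass J d Y :=
  ⟨.of_homotopyEquiv e, .of_homotopyEquiv e.symm⟩

lemma HasResidueClass.of_homotopyEquiv (e : HomotopyEquiv X Y) (h : HasResidueClass J X) :
    HasResidueClass J Y := by
  obtain ⟨z, hz, hw⟩ := h
  refine ⟨(e.hom.f 0).hom z, by rw [hom_comm_apply, hz, map_zero], fun hmem => hw ?_⟩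
  have h1 := homotopy_apply_of_d_eq_zero e.homotopyHomInvId (j := -1) (by lia) rfl z hz
  rw [show ((e.hom ≫ e.inv).f 0).hom z = (e.inv.f 0).hom ((e.hom.f 0).hom z) from rfl,
    ← sub_eq_iff_eq_add'] at h1
  rw [show z = ((𝟙 X : X ⟶ X).f 0).hom z from rfl, ← h1]
  refine sub_mem ?_ (Submodule.mem_sup_right ⟨_, rfl⟩)
  obtain ⟨a, ha, _, ⟨w, rfl⟩, hab⟩ := Submodule.mem_sup.1 hmem
  rw [← hab, map_add, ← hom_comm_apply]
  refine add_mem (Submodule.mem_sup_left ?_) (Submodule.mem_sup_right ⟨_, rfl⟩)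
  have := Submodule.mem_map_of_mem (f := (e.inv.f 0).hom) ha
  rw [Submodule.map_smul''] at this
  exact Submodule.smul_mono le_rfl le_top this

lemma hasResidueClass_iff_of_homotopyEquiv (e : HomotopyEquiv X Y) :
    HasResidueClass J X ↔ HasResidueClass J Y :=
  ⟨.of_homotopyEquiv e, .of_homotopyEquiv e.symm⟩

end Classes

section Cogenerator

variable {R : Type u} [CommRing R]

lemma exists_comp_eq_of_ker_le {A B E : Type u} [AddCommGroup A] [Module R A] [AddCommGroup B]
    [Module R B] [AddCommGroup E] [Module R E] [hE : Module.Injective R E] (f : A →ₗ[R] B)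
    (g : A →ₗ[R] E) (h : LinearMap.ker f ≤ LinearMap.ker g) :
    ∃ k : B →ₗ[R] E, ∀ x, k (f x) = g x := by
  obtain ⟨k, hk⟩ := hE.out ((LinearMap.ker f).liftQ f le_rfl)
    (LinearMap.ker_eq_bot.1 (Submodule.ker_liftQ_eq_bot' _ _ rfl)) ((LinearMap.ker f).liftQ g h)
  exact ⟨k, fun x => hk (Submodule.Quotient.mk x)⟩

/-- The property that the maps to `E` separate the elements of any module. -/
def IsCogenerator (R : Type u) [CommRing R] (E : Type u) [AddCommGroup E] [Module R E] : Prop :=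
  ∀ (V : Type u) [AddCommGroup V] [Module R V] (v : V), v ≠ 0 → ∃ f : V →ₗ[R] E, f v ≠ 0

-- The annihilator of `v ≠ 0` lies in `𝔪`, so `r v ↦ r e` is well defined and extends by
-- injectivity.
open IsLocalRing in
lemma isCogenerator_of_injective [IsLocalRing R] {E : Type u} [AddCommGroup E] [Module R E]
    [Module.Injective R E] {e : E} (he : e ≠ 0) (hs : ∀ s ∈ maximalIdeal R, s • e = 0) :
    IsCogenerator R E := by
  intro V _ _ v hv
  obtain ⟨f, hf⟩ := exists_comp_eq_of_ker_le (LinearMap.toSpanSingleton R V v)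
    (LinearMap.toSpanSingleton R E e) (fun r hr => hs r (by
      rw [mem_maximalIdeal, mem_nonunits_iff]
      rintro ⟨w, rfl⟩
      have h0 : (w : R) • v = 0 := hr
      apply hv
      rw [← one_smul R v, ← Units.inv_mul w, mul_smul, h0, smul_zero]))
  refine ⟨f, fun h => he ?_⟩
  have := hf 1
  rw [LinearMap.toSpanSingleton_apply, LinearMap.toSpanSingleton_apply, one_smul, one_smul, h]
    at this
  exact this.symm

end Cogenerator

section Concentrated

variable {R : Type u} [CommRing R] {P Y : CochainComplex (ModuleCat.{u} R) ℤ} {d : ℤ}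

open CochainComplex.HomComplex

lemma δ_v_of_concentrated (hY : ∀ i, i ≠ d → IsZero (Y.X i)) {n m : ℤ} (φ : Cochain P Y n)
    (hnm : n + 1 = m) {p q : ℤ} (hp : p + m = d) (hq : q + n = d) (x : P.X p) :
    ((δ n m φ).v p d hp).hom x = (m.negOnePow : ℤ) • (φ.v q d hq).hom ((P.d p q).hom x) := by
  rw [δ_v n m hnm φ p d hp (d - 1) q (by lia) (by lia),
    (hY (d - 1) (by lia)).eq_of_tgt (φ.v p (d - 1) (by lia)) 0, zero_comp, zero_add]
  rfl

lemma cochain_ext_of_concentrated (hY : ∀ i, i ≠ d → IsZero (Y.X i)) {n : ℤ} {φ ψ : Cochain P Y n}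
    {q : ℤ} (hq : q + n = d)
    (h : ∀ x, (φ.v q d hq).hom x = (ψ.v q d hq).hom x) : φ = ψ := by
  ext p r hpr : 1
  by_cases hr : r = d
  · subst hr
    obtain rfl : p = q := by lia
    exact ModuleCat.hom_ext (LinearMap.ext h)
  · exact (hY r hr).eq_of_tgt _ _

lemma exists_cochain_of_linearMap {n q : ℤ} (hq : q + n = d) (f : P.X q →ₗ[R] Y.X d) :
    ∃ φ : Cochain P Y n, (φ.v q d hq).hom = f :=
  ⟨Cochain.single (ModuleCat.ofHom f) n, by rw [Cochain.single_v]; rfl⟩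

lemma negOnePow_smul_self {M : Type u} [AddCommGroup M] (n : ℤ) (x : M) :
    (n.negOnePow : ℤ) • (n.negOnePow : ℤ) • x = x := by
  rw [smul_smul, ← Units.val_mul, Int.units_mul_self, Units.val_one, one_smul]

lemma negOnePow_smul_eq_zero_iff {M : Type u} [AddCommGroup M] (n : ℤ) (x : M) :
    (n.negOnePow : ℤ) • x = 0 ↔ x = 0 :=
  ⟨fun h => by rw [← negOnePow_smul_self n x, h, smul_zero], fun h => by rw [h, smul_zero]⟩

lemma δ_eq_zero_iff_of_concentrated (hY : ∀ i, i ≠ d → IsZero (Y.X i)) {n m : ℤ}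
    (φ : Cochain P Y n) (hnm : n + 1 = m) {p q : ℤ} (hp : p + m = d) (hq : q + n = d) :
    δ n m φ = 0 ↔ ∀ x, (φ.v q d hq).hom ((P.d p q).hom x) = 0 := by
  constructor
  · intro h x
    rw [← negOnePow_smul_eq_zero_iff m, ← δ_v_of_concentrated hY φ hnm hp hq, h]
    rfl
  · intro h
    refine cochain_ext_of_concentrated hY hp fun x => ?_
    rw [δ_v_of_concentrated hY φ hnm hp hq, h, smul_zero]
    rfl

/-- A cochain vanishing on cocycles is a coboundary. -/
lemma exists_δ_eq_of_concentrated (hY : ∀ i, i ≠ d → IsZero (Y.X i))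
    [Module.Injective R (Y.X d)] {n m : ℤ} (φ : Cochain P Y m) (hnm : n + 1 = m) {p q : ℤ}
    (hp : p + m = d) (hq : q + n = d)
    (h : ∀ x, (P.d p q).hom x = 0 → (φ.v p d hp).hom x = 0) : ∃ ψ : Cochain P Y n, δ n m ψ = φ := by
  obtain ⟨k, hk⟩ := exists_comp_eq_of_ker_le (P.d p q).hom (φ.v p d hp).hom h
  obtain ⟨ψ, hψ⟩ := exists_cochain_of_linearMap (Y := Y) hq ((m.negOnePow : ℤ) • k)
  refine ⟨ψ, cochain_ext_of_concentrated hY hp fun x => ?_⟩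
  rw [δ_v_of_concentrated hY ψ hnm hp hq, hψ, LinearMap.smul_apply, negOnePow_smul_self, hk]

/-- A cochain is just a map from `P^q` to the module in degree `d`: a cocycle when it kills
boundaries and, by injectivity, a coboundary when it kills cocycles. The cogenerator property
detects the cocycles that do not bound. -/
lemma isZero_homology_hom_concentrated_iff (hY : ∀ i, i ≠ d → IsZero (Y.X i))
    [Module.Injective R (Y.X d)] (hcog : IsCogenerator R (Y.X d)) {i q : ℤ} (hq : q + i = d) :
    IsZero ((homComplex P Y).homology i) ↔ IsZero (P.homology q) := by
  rw [isZero_homology_iff _ (i - 1) i (i + 1) (by lia) rfl,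
    isZero_homology_iff _ (q - 1) q (q + 1) (by lia) rfl]
  constructor
  · intro h x hx
    by_contra hxB
    obtain ⟨f, hf⟩ := hcog (P.X q ⧸ boundaries P (q - 1) q)
      ((boundaries P (q - 1) q).mkQ x) (fun h0 => hxB ((Submodule.Quotient.mk_eq_zero _).1 h0))
    obtain ⟨φ, hφ⟩ := exists_cochain_of_linearMap (Y := Y) hq
      (f ∘ₗ (boundaries P (q - 1) q).mkQ)
    obtain ⟨(ψ : Cochain P Y (i - 1)), hψ⟩ := h φ ((δ_eq_zero_iff_of_concentrated hY φ rfl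
      (show q - 1 + (i + 1) = d by lia) hq).2 fun x => by
        rw [hφ, LinearMap.comp_apply, Submodule.mkQ_apply,
          (Submodule.Quotient.mk_eq_zero (boundaries P (q - 1) q)).2 ⟨x, rfl⟩, map_zero])
    have h1 : (φ.v q d hq).hom x = ((δ (i - 1) i ψ).v q d hq).hom x :=
      congrArg (fun a : Cochain P Y i => (a.v q d hq).hom x) hψ.symm
    rw [δ_v_of_concentrated hY ψ (by lia) hq (show q + 1 + (i - 1) = d by lia), hx, map_zero,
      smul_zero, hφ] at h1
    exact hf h1
  · intro h (φ : Cochain P Y i) hφ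
    refine exists_δ_eq_of_concentrated hY φ (by lia) hq (show q + 1 + (i - 1) = d by lia)
      fun x hx => ?_
    obtain ⟨w, rfl⟩ := h x hx
    exact (δ_eq_zero_iff_of_concentrated hY φ rfl (show q - 1 + (i + 1) = d by lia) hq).1 hφ w

/-- A socle cocycle is a map on `P^0` killing `J P^0` and the boundaries, and it bounds exactly when
it kills all cocycles. By the cogenerator property, one that does not bound exists as soon as some
cocycle survives in the quotient. -/
lemma hasSocleClass_hom_concentrated_iff {J : Ideal R} (hY : ∀ i, i ≠ d → IsZero (Y.X i))
    [Module.Injective R (Y.X d)] (hcog : IsCogenerator R (Y.X d))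
    (htors : ∀ φ : Cochain P Y (d - 1), φ ∈ torsion J (Cochain P Y (d - 1))) :
    HasSocleClass J d (homComplex P Y) ↔ HasResidueClass J P := by
  have hcoc : ∀ φ : Cochain P Y d, δ d (d + 1) φ = 0 ↔
      ∀ x, (φ.v 0 d (zero_add d)).hom ((P.d (-1) 0).hom x) = 0 := fun φ =>
    δ_eq_zero_iff_of_concentrated hY φ rfl (show -1 + (d + 1) = d by lia) (zero_add d)
  constructor
  · rintro ⟨(z : Cochain P Y d), hz, hs, hw⟩
    by_contra h
    simp only [HasResidueClass, not_exists, not_and, not_not] at h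
    obtain ⟨w, hw'⟩ := exists_δ_eq_of_concentrated hY z (show d - 1 + 1 = d by lia) (zero_add d)
      (show 1 + (d - 1) = d by lia) (fun x hx => by
        have hle : J • (⊤ : Submodule R (P.X 0)) ⊔ boundaries P (-1) 0 ≤
            LinearMap.ker (z.v 0 d (zero_add d)).hom := by
          refine sup_le (Submodule.smul_le.2 fun s hs' y _ => ?_) ?_
          · rw [LinearMap.mem_ker, map_smul]
            exact congrArg (fun a : Cochain P Y d => (a.v 0 d (zero_add d)).hom y) (hs s hs')
          · rintro _ ⟨x, rfl⟩
            exact (hcoc z).1 hz x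
        exact hle (h x hx))
    exact hw w (htors w) hw'
  · rintro ⟨x, hx, hxm⟩
    set V := P.X 0 ⧸ (J • (⊤ : Submodule R (P.X 0)) ⊔ boundaries P (-1) 0) with hV
    obtain ⟨f, hf⟩ := hcog V (Submodule.Quotient.mk x)
      (fun h0 => hxm ((Submodule.Quotient.mk_eq_zero _).1 h0))
    obtain ⟨φ, hφ⟩ := exists_cochain_of_linearMap (Y := Y) (zero_add d) (f ∘ₗ Submodule.mkQ _)
    refine ⟨φ, (hcoc φ).2 fun y => ?_, fun s hs => ?_, fun (w : Cochain P Y (d - 1)) _ hw => hf ?_⟩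
    · rw [hφ, LinearMap.comp_apply, Submodule.mkQ_apply,
        (Submodule.Quotient.mk_eq_zero _).2 (Submodule.mem_sup_right
          (show _ ∈ boundaries P (-1) 0 from ⟨y, rfl⟩)), map_zero]
    · refine cochain_ext_of_concentrated hY (zero_add d) fun y => ?_
      change s • (φ.v 0 d (zero_add d)).hom y = 0
      rw [hφ, LinearMap.comp_apply, ← map_smul, ← map_smul, Submodule.mkQ_apply,
        (Submodule.Quotient.mk_eq_zero _).2
          (Submodule.mem_sup_left (Submodule.smul_mem_smul hs Submodule.mem_top)), map_zero]
    · have h1 : (φ.v 0 d (zero_add d)).hom x = ((δ (d - 1) d w).v 0 d (zero_add d)).hom x :=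
        congrArg (fun a : Cochain P Y d => (a.v 0 d (zero_add d)).hom x) hw.symm
      rw [δ_v_of_concentrated hY w (by lia) (zero_add d) (show 1 + (d - 1) = d by lia), hx,
        map_zero, smul_zero, hφ] at h1
      exact h1

end Concentrated

/-! ### Local duality for complexes of finitely generated modules -/

section HomTorsion

variable {R : Type u} [CommRing R] {P Y : CochainComplex (ModuleCat.{u} R) ℤ} {J : Ideal R}

open CochainComplex.HomComplex

lemma isKInjective_of_injective_of_isZero {Y : CochainComplex (ModuleCat.{u} R) ℤ} {a : ℤ}
    (h : ∀ i, Injective (Y.X i)) (h' : ∀ i : ℤ, i < a → IsZero (Y.X i)) : Y.IsKInjective := by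
  have : Y.IsStrictlyGE a := by
    rw [CochainComplex.isStrictlyGE_iff]
    exact h'
  exact CochainComplex.isKInjective_of_injective Y a

/-- Each component has finitely generated image, killed by a power of `J`; as `Y` is bounded, one
power serves all components. -/
lemma cochain_mem_torsion {a b : ℤ} (hP : ∀ p, Module.Finite R (P.X p))
    (hY : ∀ i : ℤ, i < a ∨ b < i → IsZero (Y.X i)) (htors : ∀ i (x : Y.X i), x ∈ torsion J (Y.X i))
    {n : ℤ} (φ : Cochain P Y n) : φ ∈ torsion J (Cochain P Y n) := by
  have h : ∀ q : ℤ, ∃ k : ℕ, ∀ r ∈ J ^ k, ∀ x : P.X (q - n),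
      r • (φ.v (q - n) q (by lia)).hom x = 0 := fun q => by
    obtain ⟨k, hk⟩ := exists_pow_smul_eq_zero_of_fg (J := J)
      (LinearMap.range (φ.v (q - n) q (by lia)).hom)
      (by rw [← Submodule.map_top]; exact (hP _).fg_top.map _) (fun x _ => htors q x)
    exact ⟨k, fun r hr x => hk r hr _ ⟨x, rfl⟩⟩
  choose f hf using h
  refine ⟨(Finset.Icc a b).sup f, fun r hr => ?_⟩
  ext p q hpq : 1
  obtain rfl : p = q - n := by lia
  by_cases hq : q < a ∨ b < q
  · exact (hY q hq).eq_of_tgt _ _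
  · exact ModuleCat.hom_ext (LinearMap.ext fun x => hf q r
      (Ideal.pow_le_pow_right (Finset.le_sup (Finset.mem_Icc.2 (by lia))) hr) x)

variable (J) in
/-- The inclusion of the torsion subcomplex. -/
def torsionι (X : CochainComplex (ModuleCat.{u} R) ℤ) : torsionComplex J X ⟶ X where
  f i := ModuleCat.ofHom (torsion J (X.X i)).subtype

section Embedding

variable {K L : CochainComplex (ModuleCat.{u} R) ℤ} (f : K ⟶ L)
  (hf : ∀ i, Function.Injective (f.f i).hom)
  (hr : ∀ i (y : L.X i), y ∈ torsion J (L.X i) ↔ ∃ x, (f.f i).hom x = y)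

include hf hr

/-- The hypotheses `hf` and `hr` identify `K` with the subcomplex `Γ_J L`. -/
lemma isZero_homology_torsionComplex_iff (i : ℤ) :
    IsZero ((torsionComplex J L).homology i) ↔ IsZero (K.homology i) := by
  rw [isZero_homology_iff _ (i - 1) i (i + 1) (by lia) rfl,
    isZero_homology_iff _ (i - 1) i (i + 1) (by lia) rfl]
  constructor
  · intro h x hx
    obtain ⟨y, hy⟩ := h (⟨(f.f i).hom x, (hr i _).2 ⟨x, rfl⟩⟩ : torsion J (L.X i))
      (Subtype.ext (by
        refine (hom_comm_apply f _ _ x).trans ?_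
        rw [hx, map_zero]
        rfl))
    obtain ⟨y', hy'⟩ := (hr _ _).1 (y : torsion J (L.X (i - 1))).2
    refine ⟨y', hf i ?_⟩
    rw [← hom_comm_apply, hy']
    exact congrArg Subtype.val hy
  · intro h (x : torsion J (L.X i)) hx
    obtain ⟨x', hx'⟩ := (hr _ _).1 x.2
    obtain ⟨y, hy⟩ := h x' (hf _ (by
      rw [← hom_comm_apply, hx', map_zero]
      exact congrArg Subtype.val hx))
    refine ⟨(⟨(f.f (i - 1)).hom y, (hr _ _).2 ⟨y, rfl⟩⟩ : torsion J (L.X (i - 1))),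
      Subtype.ext ?_⟩
    refine (hom_comm_apply f _ _ y).trans ?_
    rw [hy, hx']

lemma hasSocleClass_iff_of_embedding (d : ℤ) :
    HasSocleClass J d L ↔ HasSocleClass J d K := by
  constructor
  · rintro ⟨z, hz, hs, hw⟩
    obtain ⟨z, rfl⟩ := (hr _ _).1 (mem_torsion_of_smul hs)
    refine ⟨z, hf _ ?_, fun s hs' => hf _ ?_, fun w _ hwz => hw _ ((hr _ _).2 ⟨w, rfl⟩) ?_⟩
    · rw [← hom_comm_apply, hz, map_zero]
    · rw [map_smul, hs s hs', map_zero]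
    · rw [hom_comm_apply, hwz]
  · rintro ⟨z, hz, hs, hw⟩
    refine ⟨(f.f d).hom z, ?_, fun s hs' => ?_, fun w hwt hwz => ?_⟩
    · rw [hom_comm_apply, hz, map_zero]
    · rw [← map_smul, hs s hs', map_zero]
    · obtain ⟨w, rfl⟩ := (hr _ _).1 hwt
      obtain ⟨k, hk⟩ := hwt
      refine hw w ⟨k, fun r hr' => hf _ ?_⟩ (hf _ ?_)
      · rw [map_smul, hk r hr', map_zero]
      · rw [← hom_comm_apply, hwz]

end Embedding

lemma postcomp_torsionι_injective (n : ℤ) :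
    Function.Injective ((postcomp P (torsionι J Y)).f n).hom := by
  intro (φ : Cochain P (torsionComplex J Y) n) (ψ : Cochain P (torsionComplex J Y) n) h
  change φ = ψ
  ext p q hpq : 1
  refine ModuleCat.hom_ext (LinearMap.ext fun x => Subtype.ext ?_)
  have h1 : (φ.comp (Cochain.ofHom (torsionι J Y)) (add_zero n)).v p q hpq =
      (ψ.comp (Cochain.ofHom (torsionι J Y)) (add_zero n)).v p q hpq :=
    congrArg (fun a : Cochain P Y n => a.v p q hpq) h
  rw [Cochain.comp_zero_cochain_v, Cochain.comp_zero_cochain_v] at h1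
  exact LinearMap.congr_fun (congrArg ModuleCat.Hom.hom h1) x

/-- This is `Γ_J Hom(P, Y) = Hom(P, Γ_J Y)`; finiteness of `P` and boundedness of `Y` serve the
inclusion from right to left. -/
lemma mem_torsion_cochain_iff {a b : ℤ} (hP : ∀ p, Module.Finite R (P.X p))
    (hY : ∀ i : ℤ, i < a ∨ b < i → IsZero (Y.X i)) (n : ℤ) (φ : Cochain P Y n) :
    φ ∈ torsion J (Cochain P Y n) ↔
      ∃ ψ : Cochain P (torsionComplex J Y) n, ψ.comp (Cochain.ofHom (torsionι J Y)) (add_zero n) =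
        φ := by
  constructor
  · rintro ⟨k, hk⟩
    refine ⟨Cochain.mk fun p q hpq => ModuleCat.ofHom
      ((φ.v p q hpq).hom.codRestrict (torsion J (Y.X q)) fun x => ⟨k, fun r hr => ?_⟩), ?_⟩
    · exact congrArg (fun a : Cochain P Y n => (a.v p q hpq).hom x) (hk r hr)
    · ext p q hpq : 1
      rw [Cochain.comp_zero_cochain_v]
      rfl
  · rintro ⟨ψ, rfl⟩
    exact map_mem_torsion ((postcomp P (torsionι J Y)).f n).hom
      (cochain_mem_torsion (a := a) (b := b) hP (fun i hi => isZero_torsionComplex_X (hY i hi))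
        (fun i x => by
          obtain ⟨k, hk⟩ := (show torsion J (Y.X i) from x).2
          exact ⟨k, fun r hr => Subtype.ext (hk r hr)⟩) ψ)

end HomTorsion

section Duality

variable {R : Type u} [CommRing R] [IsLocalRing R] [IsNoetherianRing R]
  {P I : CochainComplex (ModuleCat.{u} R) ℤ}

open IsLocalRing

/-- Both complexes are bounded below with injective terms, so the quasi-isomorphism is a homotopy
equivalence and survives `Hom(P, -)`. -/
lemma exists_homotopyEquiv_concentrated (hI : IsDualizingModel I)
    (hfg : ∀ i, Module.Finite R (I.homology i)) :
    ∃ Y : CochainComplex (ModuleCat.{u} R) ℤ, (∀ i, i ≠ (dim R : ℤ) → IsZero (Y.X i)) ∧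
      Module.Injective R (Y.X (dim R)) ∧ IsCogenerator R (Y.X (dim R)) ∧
      (∀ i (x : Y.X i), x ∈ torsion (maximalIdeal R) (Y.X i)) ∧
      Nonempty (HomotopyEquiv (torsionComplex (maximalIdeal R) I) Y) := by
  obtain ⟨E, hE, htors, ⟨e, he, hs⟩, φ, hφ⟩ := exists_quasiIso_torsionComplex_singleAt hI hfg
  let ι : (singleAt (dim R) E).X (dim R) ≃ₗ[R] E :=
    (HomologicalComplex.singleObjXSelf (ComplexShape.up ℤ) (dim R : ℤ) E).toLinearEquiv
  have hz : ∀ i, i ≠ (dim R : ℤ) → IsZero ((singleAt (dim R) E).X i) := fun i hi =>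
    HomologicalComplex.isZero_single_obj_X _ _ _ _ hi
  have hinj : Injective ((singleAt (dim R) E).X (dim R)) := by
    have := Module.injective_object_of_injective_module R E
    exact Injective.of_iso
      (HomologicalComplex.singleObjXSelf (ComplexShape.up ℤ) (dim R : ℤ) E).symm inferInstance
  have hinj' : Module.Injective R ((singleAt (dim R) E).X (dim R)) :=
    Module.injective_module_of_injective_object R _
  refine ⟨singleAt (dim R) E, hz, hinj', ?_, ?_, ?_⟩
  · refine isCogenerator_of_injective (e := ι.symm e) (by simpa using he) fun s hs' => ?_
    rw [← map_smul, hs s hs', map_zero]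
  · intro i x
    by_cases hi : i = dim R
    · subst hi
      obtain ⟨n, hn⟩ := htors (ι x)
      refine ⟨n, fun r hr => ι.injective ?_⟩
      rw [map_smul, hn r hr, map_zero]
    · have := ModuleCat.subsingleton_of_isZero (hz i hi)
      exact ⟨0, fun r _ => Subsingleton.elim _ _⟩
  · have : (torsionComplex (maximalIdeal R) I).IsKInjective :=
      isKInjective_of_injective_of_isZero (a := 0) (fun i => by
        have := hI.injective i
        have := Module.injective_module_of_injective_object R (I.X i)
        have := injective_torsion (maximalIdeal R) (I.X i)
        exact Module.injective_object_of_injective_module R (torsion (maximalIdeal R) (I.X i)))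
        (fun i hi => isZero_torsionComplex_X (hI.isZero i (Or.inl hi)))
    have : (singleAt (dim R) E).IsKInjective :=
      isKInjective_of_injective_of_isZero (a := 0) (fun i => by
        by_cases hi : i = dim R
        · subst hi
          exact hinj
        · exact (hz i hi).injective) (fun i hi => hz i (by lia))
    exact nonempty_homotopyEquiv_of_quasiIso φ

theorem isZero_homology_torsionComplex_hom_iff (hI : IsDualizingModel I)
    (hfg : ∀ i, Module.Finite R (I.homology i)) (hP : ∀ p, Module.Finite R (P.X p)) {i q : ℤ}
    (hq : q + i = dim R) :
    IsZero ((torsionComplex (maximalIdeal R) (homComplex P I)).homology i) ↔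
      IsZero (P.homology q) := by
  obtain ⟨Y, hY, hinj, hcog, -, ⟨e⟩⟩ := exists_homotopyEquiv_concentrated hI hfg
  rw [isZero_homology_torsionComplex_iff (postcomp P (torsionι (maximalIdeal R) I))
      postcomp_torsionι_injective (mem_torsion_cochain_iff hP hI.isZero),
    isZero_homology_iff_of_homotopyEquiv (postcompHomotopyEquiv P e),
    isZero_homology_hom_concentrated_iff hY hcog hq]

theorem hasSocleClass_hom_iff (hI : IsDualizingModel I)
    (hfg : ∀ i, Module.Finite R (I.homology i)) (hP : ∀ p, Module.Finite R (P.X p)) :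
    HasSocleClass (maximalIdeal R) (dim R) (homComplex P I) ↔
      HasResidueClass (maximalIdeal R) P := by
  obtain ⟨Y, hY, hinj, hcog, htors, ⟨e⟩⟩ := exists_homotopyEquiv_concentrated hI hfg
  rw [hasSocleClass_iff_of_embedding (postcomp P (torsionι (maximalIdeal R) I))
      postcomp_torsionι_injective (mem_torsion_cochain_iff hP hI.isZero),
    hasSocleClass_iff_of_homotopyEquiv (postcompHomotopyEquiv P e),
    hasSocleClass_hom_concentrated_iff hY hcog]
  exact cochain_mem_torsion (a := dim R) (b := dim R) hP (fun i hi => hY i (by lia)) htors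

end Duality

/-! ### Resolutions by finitely generated projective modules -/

section FreeResolution

variable {R : Type u} [CommRing R]

/-- The number of generators of a chosen finite generating family. -/
noncomputable def freeRank (N : ModuleCat.{u} R) [Module.Finite R N] : ℕ :=
  (Module.Finite.exists_fin' R N).choose

/-- A surjection from a finite free module. -/
noncomputable def freeCover (N : ModuleCat.{u} R) [Module.Finite R N] :
    (Fin (freeRank N) → R) →ₗ[R] N :=
  (Module.Finite.exists_fin' R N).choose_spec.choose

lemma freeCover_surjective (N : ModuleCat.{u} R) [Module.Finite R N] :
    Function.Surjective (freeCover N) :=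
  (Module.Finite.exists_fin' R N).choose_spec.choose_spec

variable [IsNoetherianRing R]

/-- The iterated syzygies of a finitely generated module. -/
noncomputable def syzygy (N : ModuleCat.{u} R) [hN : Module.Finite R N] :
    ℕ → {M : ModuleCat.{u} R // Module.Finite R M}
  | 0 => ⟨N, hN⟩
  | k + 1 =>
    have := (syzygy N k).2
    ⟨ModuleCat.of R (LinearMap.ker (freeCover (syzygy N k).1)),
      inferInstanceAs (Module.Finite R (LinearMap.ker (freeCover (syzygy N k).1)))⟩

variable (N : ModuleCat.{u} R) [hN : Module.Finite R N]

instance finite_syzygy (k : ℕ) : Module.Finite R (syzygy N k).1 := (syzygy N k).2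

/-- The differential of the free resolution. -/
noncomputable def freeResolutionD (k : ℕ) :
    ModuleCat.of R (Fin (freeRank (syzygy N (k + 1)).1) → R) ⟶
      ModuleCat.of R (Fin (freeRank (syzygy N k).1) → R) :=
  ModuleCat.ofHom ((LinearMap.ker (freeCover (syzygy N k).1)).subtype ∘ₗ
    freeCover (syzygy N (k + 1)).1)

lemma freeCover_freeResolutionD (k : ℕ) (x : Fin (freeRank (syzygy N (k + 1)).1) → R) :
    freeCover (syzygy N k).1 ((freeResolutionD N k).hom x) = 0 :=
  (show LinearMap.ker (freeCover (syzygy N k).1) from freeCover (syzygy N (k + 1)).1 x).2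

lemma freeResolutionD_eq_zero_iff (k : ℕ) (x : Fin (freeRank (syzygy N (k + 1)).1) → R) :
    (freeResolutionD N k).hom x = 0 ↔ freeCover (syzygy N (k + 1)).1 x = 0 :=
  ⟨fun h => Subtype.ext h, fun h => congrArg Subtype.val h⟩

lemma exists_freeResolutionD_eq (k : ℕ) (y : Fin (freeRank (syzygy N k).1) → R)
    (hy : freeCover (syzygy N k).1 y = 0) : ∃ x, (freeResolutionD N k).hom x = y := by
  obtain ⟨x, hx⟩ := freeCover_surjective (syzygy N (k + 1)).1
    (show LinearMap.ker (freeCover (syzygy N k).1) from ⟨y, hy⟩)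
  exact ⟨x, congrArg Subtype.val hx⟩

/-- A resolution of a finitely generated module by finite free modules. -/
noncomputable def freeComplex : ChainComplex (ModuleCat.{u} R) ℕ :=
  ChainComplex.of (fun k => ModuleCat.of R (Fin (freeRank (syzygy N k).1) → R)) (freeResolutionD N)
    fun k => ModuleCat.hom_ext (LinearMap.ext fun x =>
      (freeResolutionD_eq_zero_iff N k _).2 (freeCover_freeResolutionD N (k + 1) x))

lemma freeComplex_d (k : ℕ) : (freeComplex N).d (k + 1) k = freeResolutionD N k :=
  ChainComplex.of_d (fun k => ModuleCat.of R (Fin (freeRank (syzygy N k).1) → R))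
    (freeResolutionD N) k

lemma freeComplex_exactAt_succ (k : ℕ) : (freeComplex N).ExactAt (k + 1) := by
  rw [HomologicalComplex.exactAt_iff' _ (k + 1 + 1) (k + 1) k (by simp) (by simp),
    ShortComplex.moduleCat_exact_iff]
  intro x hx
  have hx' : (freeResolutionD N k).hom x = 0 := by
    rw [← freeComplex_d]
    exact hx
  obtain ⟨y, hy⟩ :=
    exists_freeResolutionD_eq N (k + 1) x ((freeResolutionD_eq_zero_iff N k x).1 hx')
  refine ⟨y, ?_⟩
  rw [← hy, ← freeComplex_d]
  rfl

lemma freeComplex_d_comp_freeCover :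
    (freeComplex N).d 1 0 ≫ ModuleCat.ofHom (freeCover N) = 0 := by
  refine ModuleCat.hom_ext (LinearMap.ext fun x => ?_)
  refine (congrArg (fun f => freeCover N (f.hom x)) (freeComplex_d N 0)).trans ?_
  exact freeCover_freeResolutionD N 0 x

lemma freeComplex_exact_zero :
    (ShortComplex.mk _ _ (freeComplex_d_comp_freeCover N)).Exact := by
  rw [ShortComplex.moduleCat_exact_iff]
  intro x hx
  obtain ⟨y, hy⟩ := exists_freeResolutionD_eq N 0 x hx
  exact ⟨y, (congrArg (fun f => f.hom y) (freeComplex_d N 0)).trans hy⟩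

/-- The free resolution, as a projective resolution. -/
noncomputable def freeResolution : ProjectiveResolution N where
  complex := freeComplex N
  projective n := (IsProjective.iff_projective (R := R)
    (Fin (freeRank (syzygy N n).1) → R)).1 inferInstance
  π := (ChainComplex.toSingle₀Equiv _ _).symm ⟨ModuleCat.ofHom (freeCover N),
    freeComplex_d_comp_freeCover N⟩
  quasiIso := ⟨fun n => by
    cases n
    · rw [ChainComplex.quasiIsoAt₀_iff, ShortComplex.quasiIso_iff_of_zeros']
      · refine (ShortComplex.exact_and_epi_g_iff_of_iso ?_).2
          ⟨freeComplex_exact_zero N, (ModuleCat.epi_iff_surjective _).2 (freeCover_surjective N)⟩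
        exact ShortComplex.isoMk (Iso.refl _) (Iso.refl _) (Iso.refl _)
          ((Category.id_comp _).trans (Category.comp_id _).symm)
          ((Category.id_comp _).trans ((ChainComplex.toSingle₀Equiv_symm_apply_f_zero
            (C := freeComplex N) (X := N) (ModuleCat.ofHom (freeCover N))
            (freeComplex_d_comp_freeCover N)).symm.trans (Category.comp_id _).symm))
      · exact (freeComplex N).shape _ _ (by simp)
      · rfl
      · rfl
    · rw [quasiIsoAt_iff_exactAt']
      · apply freeComplex_exactAt_succ
      · apply ChainComplex.exactAt_succ_single_obj⟩

end FreeResolution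

section GoodProjective

variable {R : Type u} [CommRing R]

/-- Bounded above complexes of finitely generated projective modules. -/
structure IsFiniteProjective (P : CochainComplex (ModuleCat.{u} R) ℤ) : Prop where
  isZero : ∃ b : ℤ, ∀ i, b < i → IsZero (P.X i)
  projective : ∀ i, Projective (P.X i)
  finite : ∀ i, Module.Finite R (P.X i)

lemma IsFiniteProjective.isKProjective {P : CochainComplex (ModuleCat.{u} R) ℤ}
    (hP : IsFiniteProjective P) : P.IsKProjective := by
  obtain ⟨b, hb⟩ := hP.isZero
  have : P.IsStrictlyLE b := (CochainComplex.isStrictlyLE_iff P b).2 hb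
  have := hP.projective
  exact CochainComplex.isKProjective_of_projective P b

lemma IsFiniteProjective.shift {P : CochainComplex (ModuleCat.{u} R) ℤ}
    (hP : IsFiniteProjective P) (n : ℤ) : IsFiniteProjective (P⟦n⟧) where
  isZero := hP.isZero.imp' (fun b => b - n) fun b hb i hi => hb (i + n) (by lia)
  projective i := hP.projective (i + n)
  finite i := hP.finite (i + n)

lemma IsFiniteProjective.mappingCone {P Q : CochainComplex (ModuleCat.{u} R) ℤ}
    (hP : IsFiniteProjective P) (hQ : IsFiniteProjective Q) (f : P ⟶ Q) :
    IsFiniteProjective (CochainComplex.mappingCone f) where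
  isZero := by
    obtain ⟨b, hb⟩ := hP.isZero
    obtain ⟨c, hc⟩ := hQ.isZero
    exact ⟨max b c, fun i hi => IsZero.of_iso ((biprod_isZero_iff _ _).2
      ⟨hb (i + 1) (by lia), hc i (by lia)⟩)
      (HomologicalComplex.homotopyCofiber.XIsoBiprod f i (i + 1) rfl)⟩
  projective i := by
    have := hP.projective (i + 1)
    have := hQ.projective i
    exact Projective.of_iso (HomologicalComplex.homotopyCofiber.XIsoBiprod f i (i + 1) rfl).symm
      inferInstance
  finite i := by
    have := hP.finite (i + 1)
    have := hQ.finite i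
    have : Module.Finite R ↑(P.X (i + 1) ⊞ Q.X i) :=
      Module.Finite.equiv (ModuleCat.biprodIsoProd (P.X (i + 1)) (Q.X i)).symm.toLinearEquiv
    exact Module.Finite.equiv
      (HomologicalComplex.homotopyCofiber.XIsoBiprod f i (i + 1) rfl).symm.toLinearEquiv

lemma DerivedIso.shift {X Y : CochainComplex (ModuleCat.{u} R) ℤ} (h : DerivedIso X Y) (n : ℤ) :
    DerivedIso (X⟦n⟧) (Y⟦n⟧) := by
  let := HasDerivedCategory.standard (ModuleCat.{u} R)
  exact ⟨(DerivedCategory.Q.commShiftIso n).app X ≪≫ (shiftFunctor _ n).mapIso h.some ≪≫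
    ((DerivedCategory.Q.commShiftIso n).app Y).symm⟩

lemma derivedIso_of_iso {X Y : CochainComplex (ModuleCat.{u} R) ℤ} (e : X ≅ Y) : DerivedIso X Y :=
  derivedIso_of_quasiIso e.hom

lemma exists_Q_map_eq [HasDerivedCategory (ModuleCat.{u} R)]
    {X Y : CochainComplex (ModuleCat.{u} R) ℤ} [X.IsKProjective]
    (g : DerivedCategory.Q.obj X ⟶ DerivedCategory.Q.obj Y) :
    ∃ f : X ⟶ Y, DerivedCategory.Q.map f = g := by
  obtain ⟨g', hg⟩ := (CochainComplex.IsKProjective.Qh_map_bijective X _).surjective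
    ((DerivedCategory.quotientCompQhIso (ModuleCat.{u} R)).hom.app X ≫ g ≫
      (DerivedCategory.quotientCompQhIso (ModuleCat.{u} R)).inv.app Y)
  obtain ⟨f, rfl⟩ := (HomotopyCategory.quotient _ _).map_surjective g'
  have h1 := (DerivedCategory.quotientCompQhIso (ModuleCat.{u} R)).hom.naturality f
  rw [Functor.comp_map, hg] at h1
  exact ⟨f, by simpa using h1.symm⟩

/-- Up to a shift, the middle term is the cone of the connecting map `X₃ → X₁[1]`, which is
represented by a chain map because `P₃` is K-projective. -/
lemma exists_isFiniteProjective_of_shortExact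
    (S : ShortComplex (CochainComplex (ModuleCat.{u} R) ℤ)) (hS : S.ShortExact)
    (h₁ : ∃ P, IsFiniteProjective P ∧ DerivedIso P S.X₁)
    (h₃ : ∃ P, IsFiniteProjective P ∧ DerivedIso P S.X₃) :
    ∃ P, IsFiniteProjective P ∧ DerivedIso P S.X₂ := by
  let := HasDerivedCategory.standard (ModuleCat.{u} R)
  obtain ⟨P₁, hP₁, ⟨e₁⟩⟩ := h₁
  obtain ⟨P₃, hP₃, ⟨e₃⟩⟩ := h₃
  have := hP₃.isKProjective
  let a : DerivedCategory.Q.obj (P₁⟦(1 : ℤ)⟧) ≅ (DerivedCategory.Q.obj S.X₁)⟦(1 : ℤ)⟧ :=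
    (DerivedCategory.Q.commShiftIso (1 : ℤ)).app P₁ ≪≫ (shiftFunctor _ (1 : ℤ)).mapIso e₁
  obtain ⟨f, hf⟩ := exists_Q_map_eq (e₃.hom ≫ DerivedCategory.triangleOfSESδ hS ≫ a.inv)
  have hT := Pretriangulated.rot_of_distTriang _ (Pretriangulated.rot_of_distTriang _
    (DerivedCategory.triangleOfSES_distinguished hS))
  have e := Pretriangulated.isoTriangleOfIso₁₂ _ _
    (DerivedCategory.mappingCone_triangle_distinguished f) hT e₃ a (by
      change DerivedCategory.Q.map f ≫ a.hom = e₃.hom ≫ DerivedCategory.triangleOfSESδ hS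
      rw [hf]
      simp)
  have h : DerivedIso (CochainComplex.mappingCone f) (S.X₂⟦(1 : ℤ)⟧) :=
    ⟨Pretriangulated.Triangle.π₃.mapIso e ≪≫
      ((DerivedCategory.Q.commShiftIso (1 : ℤ)).app S.X₂).symm⟩
  exact ⟨_, (hP₃.mappingCone (hP₁.shift 1) f).shift (-1), (h.shift (-1)).trans
    (derivedIso_of_iso ((shiftFunctorCompIsoId _ (1 : ℤ) (-1) (by lia)).app S.X₂))⟩

lemma isFiniteProjective_freeResolution [IsNoetherianRing R] (N : ModuleCat.{u} R)
    [Module.Finite R N] : IsFiniteProjective (freeResolution N).cochainComplex where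
  isZero := ⟨0, fun i hi => CochainComplex.isZero_of_isStrictlyLE _ 0 _⟩
  projective i := inferInstance
  finite i := by
    by_cases hi : i ≤ 0
    · obtain ⟨k, rfl⟩ := Int.exists_eq_neg_ofNat hi
      have : Module.Finite R ((freeResolution N).complex.X k) :=
        inferInstanceAs (Module.Finite R (Fin (freeRank (syzygy N k).1) → R))
      exact Module.Finite.equiv
        ((freeResolution N).cochainComplexXIso (-k) k).symm.toLinearEquiv
    · have := ModuleCat.subsingleton_of_isZero
        (CochainComplex.isZero_of_isStrictlyLE (freeResolution N).cochainComplex 0 i)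
      infer_instance

/-- A complex with bounded finitely generated cohomology over a noetherian ring has a resolution
by a bounded above complex of finitely generated projective modules. -/
theorem exists_isFiniteProjective [IsNoetherianRing R] (X : CochainComplex (ModuleCat.{u} R) ℤ)
    (hX : HasFiniteCohomology X) : ∃ P, IsFiniteProjective P ∧ DerivedIso P X := by
  refine devissage (W := fun X => ∃ P, IsFiniteProjective P ∧ DerivedIso P X)
    (Good := fun N => Module.Finite R N) ?_ exists_isFiniteProjective_of_shortExact
    (fun e h => Module.Finite.equiv e.toLinearEquiv) ?_ X hX.1 hX.2
  · intro X Y f hf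
    exact ⟨fun ⟨P, hP, h⟩ => ⟨P, hP, h.trans (derivedIso_of_quasiIso f)⟩,
      fun ⟨P, hP, h⟩ => ⟨P, hP, h.trans (derivedIso_of_quasiIso f).symm⟩⟩
  · intro n N hN
    refine ⟨(freeResolution N).cochainComplex⟦-n⟧,
      (isFiniteProjective_freeResolution N).shift (-n), ?_⟩
    have h := (derivedIso_of_quasiIso (freeResolution N).π').shift (-n)
    refine h.trans (derivedIso_of_iso (((CochainComplex.singleFunctors (ModuleCat.{u} R)).shiftIso
      (-n) n 0 (by lia)).app N))

end GoodProjective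

/-! ### Injectivity of Hom modules and Hom complexes -/

section InjectiveHom

variable {R : Type u} [CommRing R]

open CochainComplex.HomComplex TensorProduct

/-- By adjunction `Hom(A, Hom(M, E)) = Hom(M ⊗ A, E)`, and tensoring with the flat module `M`
preserves injections. -/
lemma injective_linearMap (M E : Type u) [AddCommGroup M] [Module R M] [Module.Flat R M]
    [AddCommGroup E] [Module R E] [Module.Injective R E] : Module.Injective R (M →ₗ[R] E) where
  out A B _ _ _ _ f hf g := by
    obtain ⟨h, hh⟩ := Module.Injective.out (f.lTensor M)
      (Module.Flat.lTensor_preserves_injective_linearMap f hf) (TensorProduct.lift g.flip)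
    refine ⟨(TensorProduct.curry h).flip, fun a => LinearMap.ext fun m => ?_⟩
    exact (hh (m ⊗ₜ a)).trans (TensorProduct.lift.tmul _ _)

lemma injective_homComplex_X {P I : CochainComplex (ModuleCat.{u} R) ℤ}
    (hP : ∀ i, Projective (P.X i)) (hI : ∀ i, Injective (I.X i)) (n : ℤ) :
    Injective ((homComplex P I).X n) := by
  have h (T : Triplet n) : Module.Injective R (P.X T.p ⟶ I.X T.q) := by
    have : Module.Projective R (P.X T.p) := (IsProjective.iff_projective _).2 (hP T.p)
    have : Module.Injective R (I.X T.q) :=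
      have := hI T.q
      Module.injective_module_of_injective_object R (I.X T.q)
    have := injective_linearMap (R := R) (P.X T.p) (I.X T.q)
    let e := ModuleCat.homLinearEquiv (S := R) (M := P.X T.p) (N := I.X T.q)
    exact ⟨fun A B _ _ _ _ f hf g => by
      obtain ⟨h, hh⟩ := Module.Injective.out f hf (e.toLinearMap ∘ₗ g)
      exact ⟨e.symm.toLinearMap ∘ₗ h, fun a => (congrArg e.symm (hh a)).trans
        (e.symm_apply_apply _)⟩⟩
  have : Module.Injective R (∀ T : Triplet n, P.X T.p ⟶ I.X T.q) := inferInstance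
  exact Module.injective_object_of_injective_module R (∀ T : Triplet n, P.X T.p ⟶ I.X T.q)

/-- The complex of homomorphisms from a bounded above complex of projective modules to a bounded
below complex of injective modules is K-injective. -/
lemma isKInjective_homComplex {P I : CochainComplex (ModuleCat.{u} R) ℤ} {a b : ℤ}
    (hP : ∀ i, Projective (P.X i)) (hb : ∀ i, b < i → IsZero (P.X i))
    (hI : ∀ i, Injective (I.X i)) (ha : ∀ i, i < a → IsZero (I.X i)) :
    (homComplex P I).IsKInjective := by
  refine isKInjective_of_injective_of_isZero (a := a - b) (injective_homComplex_X hP hI)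
    fun n hn => ?_
  have : Subsingleton (Cochain P I n) := ⟨fun φ ψ => by
    ext p q hpq : 1
    by_cases hp : b < p
    · exact (hb p hp).eq_of_src _ _
    · exact (ha q (by lia)).eq_of_tgt _ _⟩
  exact ModuleCat.isZero_of_subsingleton (ModuleCat.of R (Cochain P I n))

end InjectiveHom

/-! ### The two nonvanishing conditions read on resolutions -/

section ResidueClass

variable {R : Type u} [CommRing R] [IsLocalRing R]

open IsLocalRing TensorProduct

lemma toTensorResidueField_apply (P : CochainComplex (ModuleCat.{u} R) ℤ) (i : ℤ) (x : P.X i) :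
    ((toTensorResidueField P).f i).hom x = (1 : ResidueField R) ⊗ₜ[R] x := by
  change (algebraMap R (ResidueField R) 1) ⊗ₜ[R] x = _
  rw [map_one]

lemma one_tmul_eq_zero_iff {N : Type u} [AddCommGroup N] [Module R N] (x : N) :
    (1 : ResidueField R) ⊗ₜ[R] x = 0 ↔ x ∈ maximalIdeal R • (⊤ : Submodule R N) := by
  have h : TensorProduct.quotTensorEquivQuotSMul N (maximalIdeal R)
      ((1 : R ⧸ maximalIdeal R) ⊗ₜ[R] x) = Submodule.Quotient.mk x :=
    (TensorProduct.quotTensorEquivQuotSMul_mk_tmul (maximalIdeal R) 1 x).trans (by rw [one_smul])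
  rw [← Submodule.Quotient.mk_eq_zero, ← h]
  exact (LinearEquiv.map_eq_zero_iff _).symm

lemma exists_eq_one_tmul {N : Type u} [AddCommGroup N] [Module R N] (y : ResidueField R ⊗[R] N) :
    ∃ x : N, (1 : ResidueField R) ⊗ₜ[R] x = y := by
  induction y with
  | zero => exact ⟨0, tmul_zero _ _⟩
  | tmul a x =>
    obtain ⟨r, rfl⟩ := residue_surjective a
    refine ⟨r • x, ?_⟩
    rw [← smul_tmul, Algebra.smul_def, mul_one]
    rfl
  | add y z hy hz =>
    obtain ⟨x, rfl⟩ := hy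
    obtain ⟨x', rfl⟩ := hz
    exact ⟨x + x', tmul_add _ _ _⟩

/-- The map `H^0(P) ⟶ H^0(k ⊗ P)` is nonzero if and only if some cocycle of degree `0` is not a
boundary modulo the maximal ideal. -/
theorem hasResidueClass_iff (P : CochainComplex (ModuleCat.{u} R) ℤ) :
    HasResidueClass (maximalIdeal R) P ↔
      HomologicalComplex.homologyMap (toTensorResidueField P) 0 ≠ 0 := by
  rw [Ne, homologyMap_eq_zero_iff _ (-1) 0 1 rfl rfl]
  push Not
  refine exists_congr fun z => and_congr_right fun _ => ?_
  rw [toTensorResidueField_apply, ← not_exists, not_iff_not, Submodule.mem_sup]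
  constructor
  · rintro ⟨a, ha, _, ⟨w, rfl⟩, rfl⟩
    refine ⟨(1 : ResidueField R) ⊗ₜ[R] w, ?_⟩
    rw [tmul_add, (one_tmul_eq_zero_iff a).2 ha, zero_add]
    rfl
  · rintro ⟨y, hy⟩
    obtain ⟨w, rfl⟩ := exists_eq_one_tmul y
    refine ⟨z - (P.d (-1) 0).hom w, (one_tmul_eq_zero_iff _).1 ?_, _, ⟨w, rfl⟩,
      sub_add_cancel _ _⟩
    rw [tmul_sub, sub_eq_zero]
    exact hy.symm

end ResidueClass

section ShortComplexHomology

variable {R : Type u} [CommRing R] {S T : ShortComplex (ModuleCat.{u} R)}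

lemma moduleCat_homologyπ_eq_zero_iff (c : S.cycles) :
    S.homologyπ.hom c = 0 ↔ ∃ y : S.X₁, S.f.hom y = S.iCycles.hom c := by
  have hex : (ShortComplex.mk S.toCycles S.homologyπ (by simp)).Exact :=
    ShortComplex.exact_of_g_is_cokernel _ S.homologyIsCokernel
  have hinj : Function.Injective S.iCycles.hom := (ModuleCat.mono_iff_injective _).1 inferInstance
  have hi (y : S.X₁) : S.iCycles.hom (S.toCycles.hom y) = S.f.hom y :=
    LinearMap.congr_fun (congrArg ModuleCat.Hom.hom S.toCycles_i) y
  rw [ShortComplex.moduleCat_exact_iff] at hex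
  refine ⟨fun h => ?_, fun ⟨y, hy⟩ => ?_⟩
  · obtain ⟨y, hy⟩ := hex c h
    exact ⟨y, (hi y).symm.trans (congrArg S.iCycles.hom hy)⟩
  · rw [← hinj ((hi y).trans hy)]
    exact LinearMap.congr_fun (congrArg ModuleCat.Hom.hom S.toCycles_comp_homologyπ) y

lemma moduleCat_homologyMap_eq_zero_iff (φ : S ⟶ T) : ShortComplex.homologyMap φ = 0 ↔
    ∀ x : S.X₂, S.g.hom x = 0 → ∃ y : T.X₁, T.f.hom y = φ.τ₂.hom x := by
  have hcyc (c : S.cycles) : T.iCycles.hom ((ShortComplex.cyclesMap φ).hom c) =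
      φ.τ₂.hom (S.iCycles.hom c) :=
    LinearMap.congr_fun (congrArg ModuleCat.Hom.hom (ShortComplex.cyclesMap_i φ)) c
  rw [← cancel_epi S.homologyπ, ShortComplex.homologyπ_naturality, comp_zero]
  constructor
  · intro h x hx
    obtain ⟨c, rfl⟩ := (ShortComplex.moduleCat_exact_iff _).1
      (ShortComplex.exact_of_f_is_kernel (ShortComplex.mk S.iCycles S.g S.iCycles_g)
        S.cyclesIsKernel) x hx
    rw [← hcyc]
    exact (moduleCat_homologyπ_eq_zero_iff _).1
      (LinearMap.congr_fun (congrArg ModuleCat.Hom.hom h) c)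
  · intro h
    refine ModuleCat.hom_ext (LinearMap.ext fun c => ?_)
    obtain ⟨y, hy⟩ := h (S.iCycles.hom c)
      (LinearMap.congr_fun (congrArg ModuleCat.Hom.hom S.iCycles_g) c)
    exact (moduleCat_homologyπ_eq_zero_iff _).2 ⟨y, hy.trans (hcyc c).symm⟩

end ShortComplexHomology

section Zeta

variable {R : Type u} [CommRing R] [IsLocalRing R] {N : ModuleCat.{u} R}

open IsLocalRing

/-- On an injective resolution, `ζ^i` sends the class of `f : k → I^i` to the class of `f 1` in
`H^i(Γ_𝔪 I)`. -/
lemma zeta_eq_zero_iff (I : InjectiveResolution N) (i : ℕ) :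
    zeta i N = 0 ↔ ∀ f : residueField R ⟶ I.cocomplex.X i, f ≫ I.cocomplex.d i (i + 1) = 0 →
      ∃ y ∈ torsion (maximalIdeal R) (I.cocomplex.X ((ComplexShape.up ℕ).prev i)),
        (I.cocomplex.d _ i).hom y = f.hom (1 : ResidueField R) := by
  rw [zeta, InjectiveResolution.rightDerived_app_eq (homToTorsion R) I i]
  have h : ∀ {A B C D : ModuleCat.{u} R} (e : A ≅ B) (g : B ⟶ C) (e' : C ≅ D),
      e.hom ≫ g ≫ e'.hom = 0 ↔ g = 0 := fun e g e' => by
    rw [← Category.assoc, Preadditive.IsIso.comp_right_eq_zero,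
      Preadditive.IsIso.comp_left_eq_zero]
  refine (h (I.isoRightDerivedObj _ i) _ (I.isoRightDerivedObj _ i).symm).trans
    ((moduleCat_homologyMap_eq_zero_iff _).trans ?_)
  refine forall_congr' fun (f : residueField R ⟶ I.cocomplex.X i) => imp_congr ?_ ?_
  · change f ≫ I.cocomplex.d i ((ComplexShape.up ℕ).next i) = 0 ↔ _
    rw [show (ComplexShape.up ℕ).next i = i + 1 from CochainComplex.next ℕ i]
  · constructor
    · rintro ⟨y, hy⟩
      exact ⟨y.1, y.2, congrArg Subtype.val hy⟩
    · rintro ⟨y, hy, h⟩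
      exact ⟨⟨y, hy⟩, Subtype.ext h⟩

variable (I : InjectiveResolution N)

omit [IsLocalRing R] in
lemma cochainComplex_d_apply (i j : ℤ) (k l : ℕ) (hk : k = i) (hl : l = j)
    (z : I.cochainComplex.X i) : (I.cochainComplexXIso j l hl).hom.hom
      ((I.cochainComplex.d i j).hom z) =
    (I.cocomplex.d k l).hom ((I.cochainComplexXIso i k hk).hom.hom z) := by
  have h : I.cochainComplex.d i j ≫ (I.cochainComplexXIso j l hl).hom =
      (I.cochainComplexXIso i k hk).hom ≫ I.cocomplex.d k l := by
    rw [I.cochainComplex_d i j k l hk hl]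
    simp
  exact LinearMap.congr_fun (congrArg ModuleCat.Hom.hom h) z

omit [IsLocalRing R] in
lemma exists_torsion_d_eq_iff (J : Ideal R) (i : ℕ) (z : I.cochainComplex.X i) :
    (∃ w ∈ torsion J (I.cochainComplex.X (i - 1)), (I.cochainComplex.d _ i).hom w = z) ↔
      ∃ y ∈ torsion J (I.cocomplex.X ((ComplexShape.up ℕ).prev i)),
        (I.cocomplex.d _ i).hom y = (I.cochainComplexXIso i i rfl).hom.hom z := by
  have hinj := ((I.cochainComplexXIso i i rfl).toLinearEquiv).injective
  cases i with
  | zero =>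
    -- In degree `0` both sides say `z = 0`: the complex over `ℤ` vanishes in degree `-1`, and over
    -- `ℕ` the default `prev 0 = 0` carries the zero differential.
    have h1 := CochainComplex.isZero_of_isStrictlyGE I.cochainComplex 0 ((0 : ℕ) - 1 : ℤ)
      (by simp)
    have := ModuleCat.subsingleton_of_isZero h1
    have h2 : I.cocomplex.d ((ComplexShape.up ℕ).prev 0) 0 = 0 :=
      I.cocomplex.shape _ _ (by simp)
    constructor
    · rintro ⟨w, -, rfl⟩
      refine ⟨0, zero_mem _, ?_⟩
      rw [Subsingleton.elim w 0, map_zero, map_zero, map_zero]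
    · rintro ⟨y, -, hy⟩
      refine ⟨0, zero_mem _, hinj ?_⟩
      rw [map_zero, map_zero]
      rw [h2] at hy
      exact hy
  | succ n =>
    rw [CochainComplex.prev_nat_succ]
    have hn : (n : ℤ) = (n + 1 : ℕ) - 1 := by push_cast; ring
    constructor
    · rintro ⟨w, hw, rfl⟩
      exact ⟨(I.cochainComplexXIso _ n hn).hom.hom w, map_mem_torsion _ hw,
        (cochainComplex_d_apply I _ _ n (n + 1) hn rfl w).symm⟩
    · rintro ⟨y, hy, h⟩
      refine ⟨(I.cochainComplexXIso _ n hn).inv.hom y, map_mem_torsion _ hy, hinj ?_⟩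
      refine (cochainComplex_d_apply I _ _ n (n + 1) hn rfl _).trans (Eq.trans ?_ h)
      exact congrArg _ ((I.cochainComplexXIso _ n hn).toLinearEquiv.apply_symm_apply y)

/-- The map `ζ^i_N` is nonzero if and only if an injective resolution of `N` has a socle class in
degree `i`. -/
theorem zeta_ne_zero_iff_cochainComplex (i : ℕ) :
    zeta i N ≠ 0 ↔ HasSocleClass (maximalIdeal R) i I.cochainComplex := by
  let e := (I.cochainComplexXIso i i rfl).toLinearEquiv
  let e' := (I.cochainComplexXIso (i + 1) (i + 1) rfl).toLinearEquiv
  have hd (z : I.cochainComplex.X i) :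
      e' ((I.cochainComplex.d i (i + 1)).hom z) = (I.cocomplex.d i (i + 1)).hom (e z) :=
    cochainComplex_d_apply I _ _ i (i + 1) rfl rfl z
  rw [Ne, zeta_eq_zero_iff I]
  constructor
  · intro h
    push Not at h
    obtain ⟨f, hf, h⟩ := h
    refine ⟨e.symm (f.hom (1 : ResidueField R)), e'.injective ?_, fun s hs => ?_,
      fun w hw hwz => ?_⟩
    · rw [hd, e.apply_symm_apply, map_zero]
      exact LinearMap.congr_fun (congrArg ModuleCat.Hom.hom hf) (1 : ResidueField R)
    · rw [← map_smul, ← map_smul, residueField_smul_eq_zero hs, map_zero, map_zero]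
    · obtain ⟨y, hy, hyz⟩ := (exists_torsion_d_eq_iff I _ i _).1 ⟨w, hw, hwz⟩
      exact h y hy (hyz.trans (e.apply_symm_apply _))
  · rintro ⟨z, hz, hs, hw⟩ h
    have hs' : ∀ s ∈ maximalIdeal R, s • e z = 0 := fun s hs' => by
      rw [← map_smul, hs s hs', map_zero]
    obtain ⟨y, hy, hyz⟩ := h (ModuleCat.ofHom (residueFieldLift (e z) hs'))
      (ModuleCat.hom_ext (residueField_linearMap_ext (by
        refine (congrArg _ (residueFieldLift_one (e z) hs')).trans ?_
        exact (hd z).symm.trans ((congrArg e' hz).trans (map_zero e')))))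
    obtain ⟨w, hwt, hwz⟩ := (exists_torsion_d_eq_iff I _ i z).2
      ⟨y, hy, hyz.trans (residueFieldLift_one (e z) hs')⟩
    exact hw w hwt hwz

/-- The map `ζ^i_N` is nonzero if and only if a K-injective resolution of `N` has a socle class in
degree `i`. -/
theorem zeta_ne_zero_iff (Y : CochainComplex (ModuleCat.{u} R) ℤ) [Y.IsKInjective]
    (h : DerivedIso Y (single N)) (i : ℕ) :
    zeta i N ≠ 0 ↔ HasSocleClass (maximalIdeal R) i Y := by
  let I := injectiveResolution N
  have hI := derivedIso_of_quasiIso I.ι'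
  obtain ⟨e⟩ := (h.trans hI).homotopyEquiv_of_isKInjective
  exact (zeta_ne_zero_iff_cochainComplex I i).trans (hasSocleClass_iff_of_homotopyEquiv e).symm

end Zeta

/-! ### Local duality in the derived category and the MCM criterion -/

section DerivedInvariance

variable {R : Type u} [CommRing R] {X Y : CochainComplex (ModuleCat.{u} R) ℤ}

lemma DerivedIso.nonempty_homologyIso (h : DerivedIso X Y) (i : ℤ) :
    Nonempty (X.homology i ≅ Y.homology i) := by
  let := HasDerivedCategory.standard (ModuleCat.{u} R)
  let e := (DerivedCategory.homologyFunctorFactors (ModuleCat.{u} R) i).app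
  exact ⟨(e X).symm ≪≫ (DerivedCategory.homologyFunctor (ModuleCat.{u} R) i).mapIso h.some ≪≫ e Y⟩

lemma HasFiniteCohomology.of_derivedIso (hX : HasFiniteCohomology X) (h : DerivedIso X Y) :
    HasFiniteCohomology Y := by
  refine ⟨?_, fun i => ?_⟩
  · obtain ⟨a, b, hab⟩ := hX.1
    exact ⟨a, b, fun i hi => (h.isZero_homology_iff i).1 (hab i hi)⟩
  · obtain ⟨e⟩ := h.nonempty_homologyIso i
    have := hX.2 i
    exact Module.Finite.equiv e.toLinearEquiv

lemma quasiIso_homotopyEquiv_hom (e : HomotopyEquiv X Y) : QuasiIso e.hom :=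
  homotopyEquivalences_le_quasiIso _ _ _ ⟨e, rfl⟩

lemma hasFiniteCohomology_single [IsNoetherianRing R] (N : ModuleCat.{u} R) [Module.Finite R N] :
    HasFiniteCohomology (single N) := by
  refine ⟨⟨0, 0, fun i hi => isZero_homology_singleAt 0 i (by lia) N⟩, fun i => ?_⟩
  by_cases hi : i = 0
  · subst hi
    exact Module.Finite.equiv (HomologicalComplex.singleObjHomologySelfIso
      (ComplexShape.up ℤ) 0 N).symm.toLinearEquiv
  · have := ModuleCat.subsingleton_of_isZero (isZero_homology_singleAt 0 i hi N)
    infer_instance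

lemma derivedIso_single_iff : DerivedIso X (single (X.homology 0)) ↔
    ∀ i : ℤ, i ≠ 0 → IsZero (X.homology i) := by
  refine ⟨fun h i hi => (h.isZero_homology_iff i).2 (isZero_homology_singleAt 0 i hi _),
    fun h => ?_⟩
  obtain ⟨Y, f, g, hf, hg⟩ := exists_quasiIso_singleAt X 0 h
  exact (derivedIso_of_quasiIso f).symm.trans (derivedIso_of_quasiIso g)

end DerivedInvariance

section CohenMacaulay

variable {R : Type u} [CommRing R] [IsLocalRing R] [IsNoetherianRing R]
  {I M : CochainComplex (ModuleCat.{u} R) ℤ}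

open IsLocalRing

omit [IsLocalRing R] [IsNoetherianRing R] in
lemma IsDualizingModel.isKInjective_homComplex (hI : IsDualizingModel I)
    {P : CochainComplex (ModuleCat.{u} R) ℤ} (hP : IsFiniteProjective P) :
    (homComplex P I).IsKInjective := by
  obtain ⟨b, hb⟩ := hP.isZero
  exact MCM.isKInjective_homComplex hP.projective hb hI.injective
    fun i hi => hI.isZero i (Or.inl hi)

omit [IsLocalRing R] [IsNoetherianRing R] in
lemma IsDualizingModel.derivedIso_homComplex (hI : IsDualizingModel I)
    {P X : CochainComplex (ModuleCat.{u} R) ℤ} (hP : IsFiniteProjective P) (h : DerivedIso P X) :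
    DerivedIso (homComplex P I) (homComplex X I) := by
  have := hI.isKInjective
  have := hP.isKProjective
  obtain ⟨f, hf⟩ := h.exists_quasiIso_from
  exact (derivedIso_of_quasiIso (precomp f I)).symm

omit [IsNoetherianRing R] in
lemma localCohomology_isZero_iff {Y : CochainComplex (ModuleCat.{u} R) ℤ} [Y.IsKInjective]
    (h : DerivedIso M Y) (J : SemiInjectiveResolution M) (i : ℤ) :
    IsZero (J.localCohomology (maximalIdeal R) i) ↔
      IsZero ((torsionComplex (maximalIdeal R) Y).homology i) := by
  have := J.kInjective
  have := J.quasiIso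
  obtain ⟨e⟩ := ((derivedIso_of_quasiIso J.ι).symm.trans h).homotopyEquiv_of_isKInjective
  exact isZero_homology_iff_of_homotopyEquiv
    ((torsionFunctor (maximalIdeal R)).mapHomotopyEquiv e) i

/-- Local duality: the local cohomology of `M` is concentrated in degree `dim R` if and only if
the cohomology of the dual of `M` is concentrated in degree `0`. -/
theorem localCohomology_vanishing_iff (hI : IsDualizingModel I)
    (hfg : ∀ i, Module.Finite R (I.homology i)) (hM : HasFiniteCohomology M) :
    (∃ J : SemiInjectiveResolution M, ∀ i : ℤ, i ≠ (dim R : ℤ) →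
      IsZero (J.localCohomology (maximalIdeal R) i)) ↔
      ∀ i : ℤ, i ≠ 0 → IsZero ((homComplex M I).homology i) := by
  -- `P` resolves the dual of `M`, so by biduality `Hom(P, I)` is a K-injective model of `M`.
  obtain ⟨P, hP, hPX⟩ := exists_isFiniteProjective _ (hasFiniteCohomology_homComplex hI hfg M hM)
  have := hI.isKInjective_homComplex hP
  have hqi := quasiIso_bidual hI M hM
  have hMY : DerivedIso M (homComplex P I) :=
    (derivedIso_of_quasiIso (bidual M I)).trans (hI.derivedIso_homComplex hP hPX).symm
  have key (J : SemiInjectiveResolution M) (i q : ℤ) (hq : q + i = dim R) :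
      IsZero (J.localCohomology (maximalIdeal R) i) ↔ IsZero ((homComplex M I).homology q) := by
    rw [localCohomology_isZero_iff hMY J,
      isZero_homology_torsionComplex_hom_iff hI hfg hP.finite hq, hPX.isZero_homology_iff]
  constructor
  · rintro ⟨J, hJ⟩ q hq
    exact (key J (dim R - q) q (by lia)).1 (hJ _ (by lia))
  · intro h
    obtain ⟨f, hf⟩ := hMY.exists_quasiIso_to
    let J : SemiInjectiveResolution M := ⟨_, f, inferInstance, hf⟩
    exact ⟨J, fun i hi => (key J i (dim R - i) (by lia)).2 (h _ (by lia))⟩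

/-- If the dual of `M` is a module `N`, then `H^0(M) ⟶ H^0(k ⊗ᴸ M)` is nonzero if and only if
`ζ^d_N` is nonzero. -/
theorem homologyMap_toTensorResidueField_ne_zero_iff (hI : IsDualizingModel I)
    (hfg : ∀ i, Module.Finite R (I.homology i)) (hM : HasFiniteCohomology M)
    {N : ModuleCat.{u} R} (hN : DerivedIso (homComplex M I) (single N)) :
    (∃ P : SemiProjectiveResolution M,
      HomologicalComplex.homologyMap (toTensorResidueField P.complex) 0 ≠ 0) ↔
      zeta (dim R) N ≠ 0 := by
  -- Now `M` itself is resolved, so `Hom(Q, I)` is a K-injective model of `N`.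
  obtain ⟨Q, hQ, hQM⟩ := exists_isFiniteProjective M hM
  have := hI.isKInjective_homComplex hQ
  have := hQ.isKProjective
  rw [zeta_ne_zero_iff _ ((hI.derivedIso_homComplex hQ hQM).trans hN),
    hasSocleClass_hom_iff hI hfg hQ.finite]
  constructor
  · rintro ⟨P, hP⟩
    have := P.kProjective
    have := P.quasiIso
    obtain ⟨e⟩ := ((derivedIso_of_quasiIso P.π).trans hQM.symm).homotopyEquiv_of_isKProjective
    exact (hasResidueClass_iff_of_homotopyEquiv e).1 ((hasResidueClass_iff _).2 hP)
  · intro h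
    obtain ⟨f, hf⟩ := hQM.exists_quasiIso_from
    exact ⟨⟨Q, f, inferInstance, hf⟩, (hasResidueClass_iff Q).1 h⟩

/-- Leaving `N` existential serves both assertions: it may be `H^0` of the dual or a module given in
advance. -/
theorem isMCM_iff (hI : IsDualizingModel I)
    (hfg : ∀ i, Module.Finite R (I.homology i)) (hM : HasFiniteCohomology M) :
    IsMCM M ↔ ∃ N : ModuleCat.{u} R, DerivedIso (homComplex M I) (single N) ∧
      zeta (dim R) N ≠ 0 := by
  constructor
  · intro h
    have h' := derivedIso_single_iff.2 ((localCohomology_vanishing_iff hI hfg hM).1 h.vanishing)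
    exact ⟨_, h', (homologyMap_toTensorResidueField_ne_zero_iff hI hfg hM h').1 h.nonzero⟩
  · rintro ⟨N, h, hN⟩
    exact
      { bounded := hM.1
        nonzero := (homologyMap_toTensorResidueField_ne_zero_iff hI hfg hM h).2 hN
        vanishing := (localCohomology_vanishing_iff hI hfg hM).2 fun i hi =>
          (h.isZero_homology_iff i).2 (isZero_homology_singleAt 0 i hi N)
        finitelyGenerated := (hasFiniteCohomology_iff M).1 hM }

omit [IsNoetherianRing R] in
lemma zeta_ne_zero_of_derivedIso {N N' : ModuleCat.{u} R}
    (h : DerivedIso (single N) (single N')) (i : ℕ) (hN : zeta i N ≠ 0) : zeta i N' ≠ 0 := by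
  have hι := derivedIso_of_quasiIso (injectiveResolution N).ι'
  exact (zeta_ne_zero_iff (injectiveResolution N).cochainComplex (hι.symm.trans h) i).2
    ((zeta_ne_zero_iff _ hι.symm i).1 hN)

omit [IsLocalRing R] [IsNoetherianRing R] in
lemma IsNormalizedDualizing.exists_model {D : CochainComplex (ModuleCat.{u} R) ℤ}
    (hD : IsNormalizedDualizing D) (J : SemiInjectiveResolution D) :
    ∃ I : CochainComplex (ModuleCat.{u} R) ℤ, IsDualizingModel I ∧
      (∀ i, Module.Finite R (I.homology i)) ∧ Nonempty (HomotopyEquiv J.complex I) := by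
  obtain ⟨I, ι, hι, hinj, hz, hh⟩ := hD.exists_resolution
  have hI : IsDualizingModel I := ⟨hinj, hz, hh⟩
  have := hI.isKInjective
  have := J.kInjective
  have := J.quasiIso
  exact ⟨I, hI, (((hasFiniteCohomology_iff D).2 hD.finitelyGenerated).of_derivedIso
    (derivedIso_of_quasiIso ι)).2,
    ((derivedIso_of_quasiIso J.ι).symm.trans
      (derivedIso_of_quasiIso ι)).homotopyEquiv_of_isKInjective⟩

end CohenMacaulay

end MCM

theorem mainTheorem5 {R : Type u} [CommRing R] [IsLocalRing R] [IsNoetherianRing R]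
    (D : CochainComplex (ModuleCat.{u} R) ℤ) (hD : MCM.IsNormalizedDualizing D)
    (J : MCM.SemiInjectiveResolution D) :
    (∀ M : CochainComplex (ModuleCat.{u} R) ℤ, MCM.FinitelyGeneratedCohomology M →
      (MCM.IsMCM M ↔
        MCM.DerivedIso (MCM.RHom M J) (MCM.single ((MCM.RHom M J).homology 0)) ∧
          MCM.zeta (MCM.dim R) ((MCM.RHom M J).homology 0) ≠ 0)) ∧
    (∀ N : ModuleCat.{u} R, Module.Finite R N → MCM.zeta (MCM.dim R) N ≠ 0 →
      MCM.IsMCM (MCM.RHom (MCM.single N) J)) := by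
  open MCM in
  -- The arbitrary resolution `J` is homotopy equivalent to the bounded model `I`, so `RHom(M, D)`
  -- may be computed with either.
  obtain ⟨I, hI, hfg, ⟨e⟩⟩ := hD.exists_model J
  have := hI.isKInjective
  have hqi (M : CochainComplex (ModuleCat.{u} R) ℤ) : QuasiIso (postcomp M e.hom) :=
    quasiIso_homotopyEquiv_hom (postcompHomotopyEquiv M e)
  have hR (M : CochainComplex (ModuleCat.{u} R) ℤ) : DerivedIso (RHom M J) (homComplex M I) :=
    have := hqi M
    have h := derivedIso_of_quasiIso (postcomp M e.hom)
    h
  refine ⟨fun M hM => ?_, fun N hN hζ => ?_⟩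
  · rw [isMCM_iff hI hfg ((hasFiniteCohomology_iff M).2 hM)]
    constructor
    · rintro ⟨N, h, hζ⟩
      have h' := (hR M).trans h
      have h'' : DerivedIso (RHom M J) (single ((RHom M J).homology 0)) :=
        derivedIso_single_iff.2 fun i hi => (h'.isZero_homology_iff i).2
          (isZero_homology_singleAt 0 i hi N)
      exact ⟨h'', zeta_ne_zero_of_derivedIso (h'.symm.trans h'') _ hζ⟩
    · rintro ⟨h, hζ⟩
      exact ⟨_, (hR M).symm.trans h, hζ⟩
  · have hfin := hasFiniteCohomology_single N
    have hX := (hasFiniteCohomology_homComplex hI hfg _ hfin).of_derivedIso (hR (single N)).symm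
    -- By biduality the dual of `RHom(N, D)` is `N` itself.
    refine (isMCM_iff hI hfg hX).2 ⟨N, ?_, hζ⟩
    have := hqi (single N)
    have := quasiIso_bidual hI (single N) hfin
    exact (derivedIso_of_quasiIso (precomp (postcomp (single N) e.hom) I)).symm.trans
      (derivedIso_of_quasiIso (bidual (single N) I)).symm
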